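/- Let $\mathbb T^2=\mathbb R^2/(2\pi\mathbb Z)^2$, $\nu>0$, $2\le p<\infty$, and let $\nu\Delta$ be the operator on the complex space $L^p(\mathbb T^2)$ with domain $W^{2,p}(\mathbb T^2)$. Put $$C_p=\Bigl(1+\frac{p^2}{4}\Bigr)^{1/2},\qquad \delta=\frac12\,\frac1{1+C_p}.$$ An operator generates a uniformly bounded analytic semigroup if it is, with its domain, the infinitesimal generator of a family $T(z)$ of uniformly bounded operators, analytic in a sector $\{|\arg z|<\theta\}$ with $0<\theta<\pi/2$, such that $T(0)=I$, $T(z_1+z_2)=T(z_1)T(z_2)$, and $T(z)x\to x$ as $z\to0$ in the sector, for every $x$. Then: 1. For all $\lambda\in\mathbb C$ with $\operatorname{Re}\lambda\ge0$ and all $u\in W^{2,p}(\mathbb T^2)$: $|\lambda|\,\|u\|_{L^p}\le C_p\,\|\lambda u-\Delta u\|_{L^p}$. 2. If $B$ is a linear operator in $L^p(\mathbb T^2)$ with $W^{2,p}(\mathbb T^2)\subset D(B)$ and $\|Bf\|_{L^p}\le a\|\nu\Delta f\|_{L^p}$ for all $f\in W^{2,p}(\mathbb T^2)$, where $0\le a\le\delta$,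 then $\nu\Delta+B$, with domain $W^{2,p}(\mathbb T^2)$, generates a uniformly bounded analytic semigroup on $L^p(\mathbb T^2)$. 3. There is a constant $K>0$, depending only on $\nu$ and $p$, such that $$\|\partial_i\partial_j f\|_{L^p}\le \frac K4\,\|\nu\Delta f\|_{L^p}\qquad\text{for all } f\in W^{2,p}(\mathbb T^2),\ i,j\in\{1,2\}. \tag{$*$}$$ 4. Let $K>0$ satisfy $(*)$, and let $(\sigma^k)_{k\in\mathbb N}$ be smooth divergence-free vector fields $\mathbb T^2\to\mathbb R^2$ with $\sum_k\|\sigma^k\|_\infty^2<\infty$ and $\sum_k\|\nabla\sigma^k\|_\infty^2<\infty$. Write $\sigma\sigma^T=\sum_k\sigma^k(\sigma^k)^T$, and for $f\in W^{2,p}(\mathbb T^2)$ with Hessian $Hf$ write $Bf=\frac12\sum_k(\sigma^k)^T(Hf)\,\sigma^k=\frac12\sum_{i,j}(\sigma\sigma^T)_{ij}\,\partial_i\partial_jf$. If $$s:=\sup_{i,j=1,2}\|(\sigma\sigma^T)_{ij}\|_{L^\infty(\mathbb T^2)}<\frac{\delta}{K},$$ then $\|Bf\|_{L^p}\le a\,\|\nu\Delta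 f\|_{L^p}$ for all $f\in W^{2,p}(\mathbb T^2)$, with $a=Ks<\delta$, and the operator $A=\nu\Delta+B$ with domain $W^{2,p}(\mathbb T^2)$ generates a uniformly bounded analytic semigroup on $L^p(\mathbb T^2)$. -/

import Mathlib

open scoped ENNReal ContDiff Topology

namespace TorusSemigroup

noncomputable section

instance fact_two_pi_pos : Fact (0 < 2 * Real.pi) := ⟨Real.two_pi_pos⟩

/-- The two-dimensional torus `ℝ² / (2πℤ)²`, with the Lebesgue measure `volume` of total mass
`4π²`. -/
abbrev Torus : Type := Fin 2 → AddCircle (2 * Real.pi)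

/-- The complex Lebesgue space `L^p` of the torus. -/
abbrev LpT (p : ℝ≥0∞) : Type :=
  MeasureTheory.Lp ℂ p (MeasureTheory.volume : MeasureTheory.Measure Torus)

/-- The covering map `ℝ² → 𝕋²`. -/
def cover (v : Fin 2 → ℝ) : Torus := fun i => (v i : AddCircle (2 * Real.pi))

/-- A function on the torus is smooth when its periodic lift to the plane is smooth. -/
def IsSmooth {E : Type*} [NormedAddCommGroup E] [NormedSpace ℝ E] (φ : Torus → E) : Prop :=
  ContDiff ℝ ∞ (fun v : Fin 2 → ℝ => φ (cover v))

/-- The classical partial derivative `∂ᵢ φ` of a function on the torus. -/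
def partialDeriv {E : Type*} [NormedAddCommGroup E] [NormedSpace ℝ E] (i : Fin 2)
    (φ : Torus → E) (x : Torus) : E :=
  deriv (fun t : ℝ => φ (x + Pi.single i (t : AddCircle (2 * Real.pi)))) 0

/-- `g` is the weak partial derivative `∂ᵢ f`. -/
def IsWeakPartial {p : ℝ≥0∞} (i : Fin 2) (f g : LpT p) : Prop :=
  ∀ φ : Torus → ℂ, IsSmooth φ → ∫ x, f x * partialDeriv i φ x = -∫ x, g x * φ x

/-! ### Uniqueness of weak derivatives -/

theorem continuous_cover : Continuous cover :=
  continuous_pi fun i => (AddCircle.continuous_mk' _).comp (continuous_apply i)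

theorem isOpenQuotientMap_cover : IsOpenQuotientMap cover := by
  have h : ∀ _ : Fin 2, IsOpenQuotientMap (fun t : ℝ => (t : AddCircle (2 * Real.pi))) :=
    fun _ => QuotientAddGroup.isOpenQuotientMap_mk
  exact IsOpenQuotientMap.piMap h

theorem IsSmooth.continuous {E : Type*} [NormedAddCommGroup E] [NormedSpace ℝ E]
    {φ : Torus → E} (h : IsSmooth φ) : Continuous φ :=
  isOpenQuotientMap_cover.isQuotientMap.continuous_iff.2 (ContDiff.continuous h)

theorem partialDeriv_cover {E : Type*} [NormedAddCommGroup E] [NormedSpace ℝ E] {φ : Torus → E}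
    (h : IsSmooth φ) (i : Fin 2) (v : Fin 2 → ℝ) :
    partialDeriv i φ (cover v) =
      fderiv ℝ (fun w : Fin 2 → ℝ => φ (cover w)) v (Pi.single i 1) := by
  have h1 : ∀ t : ℝ, cover v + Pi.single i (t : AddCircle (2 * Real.pi)) =
      cover (v + t • Pi.single i 1) := by
    intro t
    ext j
    by_cases hj : j = i
    · subst hj; simp [cover]
    · simp [cover, hj]
  have h2 : HasFDerivAt (fun w : Fin 2 → ℝ => φ (cover w))
      (fderiv ℝ (fun w : Fin 2 → ℝ => φ (cover w)) v) v :=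
    (ContDiff.differentiable h (by simp)).differentiableAt.hasFDerivAt
  unfold partialDeriv
  simp only [h1]
  exact (h2.hasLineDerivAt (Pi.single i 1)).deriv

theorem IsSmooth.continuous_partialDeriv {E : Type*} [NormedAddCommGroup E] [NormedSpace ℝ E]
    {φ : Torus → E} (h : IsSmooth φ) (i : Fin 2) : Continuous (partialDeriv i φ) := by
  refine isOpenQuotientMap_cover.isQuotientMap.continuous_iff.2 ?_
  have : (partialDeriv i φ ∘ cover) = fun v =>
      fderiv ℝ (fun w : Fin 2 → ℝ => φ (cover w)) v (Pi.single i 1) :=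
    funext fun v => partialDeriv_cover h i v
  rw [this]
  exact (ContDiff.continuous_fderiv h (by simp)).clm_apply continuous_const

theorem integrable_mul {f : Torus → ℂ} (hf : MeasureTheory.Integrable f) {c : Torus → ℂ}
    (hc : Continuous c) : MeasureTheory.Integrable (fun x => f x * c x) := by
  obtain ⟨C, hC⟩ := isCompact_univ.exists_bound_of_continuousOn hc.continuousOn
  exact hf.mul_bdd (c := C) hc.aestronglyMeasurable
    (Filter.Eventually.of_forall fun x => hC x (Set.mem_univ x))

theorem integrable_LpT {p : ℝ≥0∞} [Fact (1 ≤ p)] (f : LpT p) :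
    MeasureTheory.Integrable (fun x => f x) :=
  (MeasureTheory.Lp.memLp f).integrable Fact.out

/-- The star algebra of smooth functions. -/
def smoothAlgebra : StarSubalgebra ℂ C(Torus, ℂ) where
  carrier := {c | IsSmooth (E := ℂ) c}
  mul_mem' {a b} ha hb := by
    have ha' : ContDiff ℝ ∞ (fun v : Fin 2 → ℝ => a (cover v)) := ha
    have hb' : ContDiff ℝ ∞ (fun v : Fin 2 → ℝ => b (cover v)) := hb
    exact ha'.mul hb'
  add_mem' {a b} ha hb := by
    have ha' : ContDiff ℝ ∞ (fun v : Fin 2 → ℝ => a (cover v)) := ha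
    have hb' : ContDiff ℝ ∞ (fun v : Fin 2 → ℝ => b (cover v)) := hb
    exact ha'.add hb'
  algebraMap_mem' r := by
    change ContDiff ℝ ∞ (fun _ : Fin 2 → ℝ => r)
    exact contDiff_const
  star_mem' {a} ha := by
    have ha' : ContDiff ℝ ∞ (fun v : Fin 2 → ℝ => a (cover v)) := ha
    exact Complex.conjCLE.contDiff.comp ha'

theorem isSmooth_fourier (i : Fin 2) :
    IsSmooth (fun x : Torus => fourier (T := 2 * Real.pi) 1 (x i)) := by
  have : (fun v : Fin 2 → ℝ => fourier (T := 2 * Real.pi) 1 (cover v i)) =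
      fun v => Complex.exp (Complex.I * (v i : ℂ)) := by
    funext v
    have hpi : (Real.pi : ℂ) ≠ 0 := by exact_mod_cast Real.pi_ne_zero
    rw [cover, fourier_coe_apply]
    congr 1
    push_cast
    field_simp
  change ContDiff ℝ ∞ (fun v : Fin 2 → ℝ => fourier (T := 2 * Real.pi) 1 (cover v i))
  rw [this]
  exact (contDiff_const.mul (Complex.ofRealCLM.contDiff.comp (contDiff_apply ℝ ℝ i))).cexp

theorem smoothAlgebra_closure : smoothAlgebra.topologicalClosure = ⊤ := by
  refine ContinuousMap.starSubalgebra_topologicalClosure_eq_top_of_separatesPoints _ ?_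
  intro x y hxy
  obtain ⟨i, hi⟩ := Function.ne_iff.1 hxy
  refine ⟨_, ⟨⟨_, (isSmooth_fourier i).continuous⟩, isSmooth_fourier i, rfl⟩, ?_⟩
  simp only [ContinuousMap.coe_mk, fourier_one, ne_eq]
  intro h
  exact hi (AddCircle.injective_toCircle Real.two_pi_pos.ne' (Subtype.ext h))

theorem ae_zero_of_forall_smooth {u : Torus → ℂ} (hu : MeasureTheory.Integrable u)
    (h : ∀ φ : Torus → ℂ, IsSmooth φ → ∫ x, u x * φ x = 0) :
    u =ᵐ[MeasureTheory.volume] 0 := by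
  have hcont : ∀ c : C(Torus, ℂ), ∫ x, u x * c x = 0 := by
    intro c
    have hc : c ∈ smoothAlgebra.topologicalClosure := by rw [smoothAlgebra_closure]; trivial
    have hc' : c ∈ closure (smoothAlgebra : Set C(Torus, ℂ)) := hc
    rw [mem_closure_iff_seq_limit] at hc'
    obtain ⟨s, hs, hlim⟩ := hc'
    have hb : ∃ M, ∀ n, ‖s n‖ ≤ M := by
      obtain ⟨M, hM⟩ := (Metric.isBounded_range_of_tendsto s hlim).exists_norm_le
      exact ⟨M, fun n => hM _ ⟨n, rfl⟩⟩
    obtain ⟨M, hM⟩ := hb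
    have ht : Filter.Tendsto (fun n => ∫ x, u x * s n x) Filter.atTop (𝓝 (∫ x, u x * c x)) := by
      refine MeasureTheory.tendsto_integral_of_dominated_convergence (fun x => ‖u x‖ * M)
        (fun n => (integrable_mul hu (s n).continuous).aestronglyMeasurable)
        (hu.norm.mul_const M) (fun n => Filter.Eventually.of_forall fun x => ?_)
        (Filter.Eventually.of_forall fun x => ?_)
      · rw [norm_mul]
        exact mul_le_mul_of_nonneg_left (((s n).norm_coe_le_norm x).trans (hM n)) (norm_nonneg _)
      · exact ((ContinuousEvalConst.continuous_eval_const x).tendsto c |>.comp hlim).const_mul (u x)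
    have h0 : (fun n => ∫ x, u x * s n x) = fun _ => (0 : ℂ) := funext fun n => h _ (hs n)
    rw [h0] at ht
    exact tendsto_nhds_unique ht tendsto_const_nhds
  refine MeasureTheory.ae_eq_zero_of_forall_setIntegral_isClosed_eq_zero hu fun F hF => ?_
  have ht : Filter.Tendsto (fun n => ∫ x, u x * ((hF.apprSeq n x : ℝ) : ℂ)) Filter.atTop
      (𝓝 (∫ x, F.indicator u x)) := by
    refine MeasureTheory.tendsto_integral_of_dominated_convergence (fun x => ‖u x‖)
      (fun n => (integrable_mul hu ?_).aestronglyMeasurable)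
      hu.norm (fun n => Filter.Eventually.of_forall fun x => ?_)
      (Filter.Eventually.of_forall fun x => ?_)
    · exact Complex.continuous_ofReal.comp (NNReal.continuous_coe.comp (hF.apprSeq n).continuous)
    · rw [norm_mul]
      refine mul_le_of_le_one_right (norm_nonneg _) ?_
      have := HasOuterApproxClosed.apprSeq_apply_le_one hF n x
      simpa using this
    · have h1 := (tendsto_pi_nhds.1 (HasOuterApproxClosed.tendsto_apprSeq hF)) x
      have h2 := ((Complex.continuous_ofReal.comp NNReal.continuous_coe).tendsto _).comp h1
      have h3 := h2.const_mul (u x)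
      have h4 : F.indicator u x =
          u x * (Complex.ofReal ∘ NNReal.toReal) (F.indicator (fun _ => 1) x) := by
        by_cases hx : x ∈ F
        · rw [Set.indicator_of_mem hx, Set.indicator_of_mem hx]; simp
        · rw [Set.indicator_of_notMem hx, Set.indicator_of_notMem hx]; simp
      rw [h4]
      exact h3
  have h0 : (fun n => ∫ x, u x * ((hF.apprSeq n x : ℝ) : ℂ)) = fun _ => (0 : ℂ) :=
    funext fun n => hcont ⟨fun x => ((hF.apprSeq n x : ℝ) : ℂ),
      Complex.continuous_ofReal.comp (NNReal.continuous_coe.comp (hF.apprSeq n).continuous)⟩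
  rw [h0] at ht
  rw [← MeasureTheory.integral_indicator hF.measurableSet]
  exact tendsto_nhds_unique ht tendsto_const_nhds

section Sobolev

variable {p : ℝ≥0∞} [Fact (1 ≤ p)]

theorem IsWeakPartial.unique {i : Fin 2} {f g g' : LpT p} (h : IsWeakPartial i f g)
    (h' : IsWeakPartial i f g') : g = g' := by
  have key := ae_zero_of_forall_smooth (u := fun x => g x - g' x)
    ((integrable_LpT g).sub (integrable_LpT g')) (fun φ hφ => by
      simp only [sub_mul]
      rw [MeasureTheory.integral_sub (integrable_mul (integrable_LpT g) hφ.continuous)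
        (integrable_mul (integrable_LpT g') hφ.continuous)]
      have := (h φ hφ).symm.trans (h' φ hφ)
      rw [neg_inj] at this
      rw [this, sub_self])
  refine MeasureTheory.Lp.ext ?_
  filter_upwards [key] with x hx
  exact sub_eq_zero.1 hx

theorem IsWeakPartial.add {i : Fin 2} {f g f' g' : LpT p} (h : IsWeakPartial i f g)
    (h' : IsWeakPartial i f' g') : IsWeakPartial i (f + f') (g + g') := by
  intro φ hφ
  have hd := hφ.continuous_partialDeriv i
  have e1 : ∫ x, (f + f' : LpT p) x * partialDeriv i φ x =
      ∫ x, (f x * partialDeriv i φ x + f' x * partialDeriv i φ x) := by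
    refine MeasureTheory.integral_congr_ae ?_
    filter_upwards [MeasureTheory.Lp.coeFn_add f f'] with x hx
    rw [hx, Pi.add_apply, add_mul]
  have e2 : ∫ x, (g + g' : LpT p) x * φ x = ∫ x, (g x * φ x + g' x * φ x) := by
    refine MeasureTheory.integral_congr_ae ?_
    filter_upwards [MeasureTheory.Lp.coeFn_add g g'] with x hx
    rw [hx, Pi.add_apply, add_mul]
  rw [e1, e2, MeasureTheory.integral_add (integrable_mul (integrable_LpT f) hd)
      (integrable_mul (integrable_LpT f') hd),
    MeasureTheory.integral_add (integrable_mul (integrable_LpT g) hφ.continuous)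
      (integrable_mul (integrable_LpT g') hφ.continuous), h φ hφ, h' φ hφ, neg_add]

theorem IsWeakPartial.smul {p : ℝ≥0∞} {i : Fin 2} {f g : LpT p} (c : ℂ) (h : IsWeakPartial i f g) :
    IsWeakPartial i (c • f) (c • g) := by
  intro φ hφ
  have e1 : ∫ x, (c • f : LpT p) x * partialDeriv i φ x =
      ∫ x, c * (f x * partialDeriv i φ x) := by
    refine MeasureTheory.integral_congr_ae ?_
    filter_upwards [MeasureTheory.Lp.coeFn_smul c f] with x hx
    rw [hx, Pi.smul_apply, smul_eq_mul, mul_assoc]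
  have e2 : ∫ x, (c • g : LpT p) x * φ x = ∫ x, c * (g x * φ x) := by
    refine MeasureTheory.integral_congr_ae ?_
    filter_upwards [MeasureTheory.Lp.coeFn_smul c g] with x hx
    rw [hx, Pi.smul_apply, smul_eq_mul, mul_assoc]
  rw [e1, e2, MeasureTheory.integral_const_mul, MeasureTheory.integral_const_mul, h φ hφ, mul_neg]

/-- `G i` and `H i j` are the weak derivatives `∂ᵢ f` and `∂ⱼ ∂ᵢ f`, all of them in `L^p`. -/
def HasWeakDerivs {p : ℝ≥0∞} (f : LpT p) (G : Fin 2 → LpT p) (H : Fin 2 → Fin 2 → LpT p) : Prop :=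
  (∀ i, IsWeakPartial i f (G i)) ∧ ∀ i j, IsWeakPartial j (G i) (H i j)

theorem HasWeakDerivs.add {f f' : LpT p} {G G' : Fin 2 → LpT p} {H H' : Fin 2 → Fin 2 → LpT p}
    (h : HasWeakDerivs f G H) (h' : HasWeakDerivs f' G' H') :
    HasWeakDerivs (f + f') (G + G') (H + H') :=
  ⟨fun i => (h.1 i).add (h'.1 i), fun i j => (h.2 i j).add (h'.2 i j)⟩

theorem HasWeakDerivs.smul {p : ℝ≥0∞} {f : LpT p} {G : Fin 2 → LpT p} {H : Fin 2 → Fin 2 → LpT p} (c : ℂ)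
    (h : HasWeakDerivs f G H) : HasWeakDerivs (c • f) (c • G) (c • H) :=
  ⟨fun i => (h.1 i).smul c, fun i j => (h.2 i j).smul c⟩

theorem HasWeakDerivs.unique {f : LpT p} {G G' : Fin 2 → LpT p} {H H' : Fin 2 → Fin 2 → LpT p}
    (h : HasWeakDerivs f G H) (h' : HasWeakDerivs f G' H') : H = H' := by
  have hG : G = G' := funext fun i => (h.1 i).unique (h'.1 i)
  subst hG
  exact funext fun i => funext fun j => (h.2 i j).unique (h'.2 i j)

variable (p)

/-- The Sobolev space `W^{2,p}` of the torus. -/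
def W2 : Submodule ℂ (LpT p) where
  carrier := {f | ∃ G H, HasWeakDerivs f G H}
  zero_mem' := ⟨0, 0, fun i φ _ => by simp, fun i j φ _ => by simp⟩
  add_mem' := fun ⟨G, H, h⟩ ⟨G', H', h'⟩ => ⟨G + G', H + H', h.add h'⟩
  smul_mem' := fun c _ ⟨G, H, h⟩ => ⟨c • G, c • H, h.smul c⟩

variable {p}

/-- The weak Hessian of a function of class `W^{2,p}`. -/
def hessian (f : W2 p) : Fin 2 → Fin 2 → LpT p := f.2.choose_spec.choose

theorem hessian_spec (f : W2 p) : ∃ G, HasWeakDerivs (f : LpT p) G (hessian f) :=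
  ⟨f.2.choose, f.2.choose_spec.choose_spec⟩

theorem hessian_eq {f : W2 p} {G : Fin 2 → LpT p} {H : Fin 2 → Fin 2 → LpT p}
    (h : HasWeakDerivs (f : LpT p) G H) : hessian f = H :=
  let ⟨_, h'⟩ := hessian_spec f
  h'.unique h

/-- The weak second derivative `∂ⱼ ∂ᵢ : W^{2,p} → L^p`. -/
def secondDeriv (p : ℝ≥0∞) [Fact (1 ≤ p)] (i j : Fin 2) : W2 p →ₗ[ℂ] LpT p where
  toFun f := hessian f i j
  map_add' f g := by
    obtain ⟨G, hG⟩ := hessian_spec f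
    obtain ⟨G', hG'⟩ := hessian_spec g
    rw [hessian_eq (f := f + g) (hG.add hG')]; rfl
  map_smul' c f := by
    obtain ⟨G, hG⟩ := hessian_spec f
    rw [hessian_eq (f := c • f) (hG.smul c)]; rfl

end Sobolev

/-- Multiplication by a continuous real function on `L^p`. -/
def mulOp (p : ℝ≥0∞) (a : C(Torus, ℝ)) : LpT p →ₗ[ℂ] LpT p where
  toFun f := MeasureTheory.MemLp.toLp (fun x => (a x : ℂ) * f x)
    (MeasureTheory.MemLp.of_le_mul (c := ‖a‖) (MeasureTheory.Lp.memLp f)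
      ((Complex.continuous_ofReal.comp a.continuous).aestronglyMeasurable.mul
        (MeasureTheory.Lp.aestronglyMeasurable f))
      (Filter.Eventually.of_forall fun x => by
        rw [norm_mul, Complex.norm_real]
        exact mul_le_mul_of_nonneg_right (a.norm_coe_le_norm x) (norm_nonneg _)))
  map_add' f g := by
    rw [← MeasureTheory.MemLp.toLp_add, MeasureTheory.MemLp.toLp_eq_toLp_iff]
    filter_upwards [MeasureTheory.Lp.coeFn_add f g] with x hx
    simp only [hx, Pi.add_apply, mul_add]
  map_smul' c f := by
    rw [RingHom.id_apply, ← MeasureTheory.MemLp.toLp_const_smul,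
      MeasureTheory.MemLp.toLp_eq_toLp_iff]
    filter_upwards [MeasureTheory.Lp.coeFn_smul c f] with x hx
    simp only [hx, Pi.smul_apply, smul_eq_mul]
    ring

/-- The noise coefficients: a sequence of smooth divergence-free vector fields `σ_k` on the torus
with `∑ ‖σ_k‖_∞² < ∞` and `∑ ‖∇σ_k‖_∞² < ∞`. -/
structure NoiseFamily where
  field : ℕ → Torus → EuclideanSpace ℝ (Fin 2)
  smooth : ∀ k, IsSmooth (field k)
  divFree : ∀ k x, ∑ i, partialDeriv i (fun y => field k y i) x = 0
  summable_sq : Summable fun k => (⨆ x, ‖field k x‖) ^ 2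
  summable_grad_sq : ∀ i j,
    Summable fun k => (⨆ x, |partialDeriv j (fun y => field k y i) x|) ^ 2

theorem NoiseFamily.abs_mul_le (S : NoiseFamily) (i j : Fin 2) (k : ℕ) (x : Torus) :
    ‖S.field k x i * S.field k x j‖ ≤ (⨆ y, ‖S.field k y‖) ^ 2 := by
  have hb : BddAbove (Set.range fun y => ‖S.field k y‖) :=
    (isCompact_range (S.smooth k).continuous.norm).bddAbove
  have h : ‖S.field k x‖ ≤ ⨆ y, ‖S.field k y‖ := le_ciSup hb x
  rw [norm_mul, sq]
  exact mul_le_mul ((PiLp.norm_apply_le _ i).trans h) ((PiLp.norm_apply_le _ j).trans h)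
    (norm_nonneg _) ((norm_nonneg _).trans h)

/-- The entry `(σ σᵀ)_{i j} = ∑_k σ_k^i σ_k^j`. -/
def NoiseFamily.covariance (S : NoiseFamily) (i j : Fin 2) : C(Torus, ℝ) where
  toFun x := ∑' k, S.field k x i * S.field k x j
  continuous_toFun := by
    refine continuous_tsum (fun k => ?_) S.summable_sq (S.abs_mul_le i j)
    have := (S.smooth k).continuous
    fun_prop

/-- `sup_{i,j} ‖(σ σᵀ)_{i j}‖_{L^∞}`. -/
def NoiseFamily.size (S : NoiseFamily) : ℝ := ⨆ i, ⨆ j, ‖S.covariance i j‖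

/-- The operator `νΔ` on `L^p` with domain `W^{2,p}`. -/
def laplaceOp (ν : ℝ) (p : ℝ≥0∞) [Fact (1 ≤ p)] : LpT p →ₗ.[ℂ] LpT p where
  domain := W2 p
  toFun := (ν : ℂ) • ∑ i, secondDeriv p i i

/-- The operator `f ↦ ½ ∑_k (σ_k)ᵀ (H f) σ_k = ½ ∑_{i,j} (σ σᵀ)_{i j} ∂ᵢ ∂ⱼ f` on `L^p` with
domain `W^{2,p}`. -/
def NoiseFamily.noiseOp (S : NoiseFamily) (p : ℝ≥0∞) [Fact (1 ≤ p)] : LpT p →ₗ.[ℂ] LpT p where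
  domain := W2 p
  toFun := (1 / 2 : ℂ) • ∑ i, ∑ j, mulOp p (S.covariance i j) ∘ₗ secondDeriv p i j

/-- The bound `‖∂ᵢ∂ⱼ f‖_p ≤ (K/4) ‖νΔ f‖_p` on all second derivatives in `W^{2,p}`. -/
def HessianBound (ν : ℝ) (p : ℝ≥0∞) [Fact (1 ≤ p)] (K : ℝ) : Prop :=
  ∀ (f : W2 p) (i j : Fin 2), ‖secondDeriv p i j f‖ ≤ K / 4 * ‖laplaceOp ν p f‖

/-- The constant `C_p = (1 + p²/4)^{1/2}`. -/
def resolventConst (p : ℝ≥0∞) : ℝ := Real.sqrt (1 + p.toReal ^ 2 / 4)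

/-- The threshold `δ = ½ · 1 / (1 + C_p)`. -/
def threshold (p : ℝ≥0∞) : ℝ := 1 / 2 * (1 / (1 + resolventConst p))

section Semigroup

variable {X : Type*} [NormedAddCommGroup X] [NormedSpace ℂ X]

/-- The open sector `{z : φ₁ < arg z < φ₂}`; the vertex is excluded. -/
def sector (φ₁ φ₂ : ℝ) : Set ℂ := {z | z ≠ 0 ∧ φ₁ < z.arg ∧ z.arg < φ₂}

/-- `T` is an analytic semigroup of bounded operators in the sector `{φ₁ < arg z < φ₂}`. The values
of `T` outside the sector and the origin play no role. -/
structure IsAnalyticSemigroup (φ₁ φ₂ : ℝ) (T : ℂ → X →L[ℂ] X) : Prop where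
  neg : φ₁ < 0
  pos : 0 < φ₂
  analytic : DifferentiableOn ℂ T (sector φ₁ φ₂)
  zero : T 0 = 1
  tendsto : ∀ x, Filter.Tendsto (fun z => T z x) (𝓝[sector φ₁ φ₂] 0) (𝓝 x)
  add : ∀ z₁ ∈ sector φ₁ φ₂, ∀ z₂ ∈ sector φ₁ φ₂, T (z₁ + z₂) = T z₁ * T z₂

/-- `A`, with its domain, is the infinitesimal generator of `T`: the pairs `(x, A x)`, `x ∈ D(A)`,
are exactly the pairs `(x, lim_{t ↓ 0} (T t x - x) / t)` for which the limit exists. -/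
def IsGenerator (A : X →ₗ.[ℂ] X) (T : ℂ → X →L[ℂ] X) : Prop :=
  ∀ x y : X, (x, y) ∈ A.graph ↔
    Filter.Tendsto (fun t : ℝ => (t : ℂ)⁻¹ • (T t x - x)) (𝓝[>] 0) (𝓝 y)

/-- `A` is the infinitesimal generator of a uniformly bounded analytic semigroup in a sector
`{|arg z| < θ}`, `0 < θ < π/2`. -/
def GeneratesBoundedAnalyticSemigroup (A : X →ₗ.[ℂ] X) : Prop :=
  ∃ (θ : ℝ) (T : ℂ → X →L[ℂ] X), θ < Real.pi / 2 ∧ IsAnalyticSemigroup (-θ) θ T ∧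
    (∃ M : ℝ, ∀ z ∈ sector (-θ) θ, ‖T z‖ ≤ M) ∧ IsGenerator A T

end Semigroup

end

end TorusSemigroup

open TorusSemigroup

/-!
Let `A` be densely defined with `|z| ‖(z - A)⁻¹‖ ≤ C` on the right half-plane. Its Yosida
approximations are bounded operators `a` with a bound of the same kind, so that `r = m (m - a)⁻¹`
satisfies Ritt's condition, uniformly in `m > 0`. Cauchy's estimate for `(r (1 - w r)⁻¹) ^ 2` on
circles approaching the unit circle then bounds the powers of `r`, hence `exp (t a)` for `t ≥ 0`. A
Neumann series rotates the half-plane a little, and the bound extends to `exp (z a)` for `z` in a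
sector; the semigroup is the strong limit of these exponentials. If `‖B f‖ ≤ a ‖A f‖`, then
`‖B (z - A)⁻¹‖ ≤ a (1 + C) ≤ 1 / 2` at the threshold `a ≤ δ`, so another Neumann series shows that
`B` at most doubles the constant.

For `Δ` the resolvent estimate comes from testing `z u - Δ u` against the duality map
`|u|^(p-2) ū`: integrating `-Δ u |u|^(p-2) ū` by parts gives a number in a sector around the
positive axis, whose aperture determines `C_p`.

The bound of `∂ᵢ ∂ⱼ` by `Δ` is the boundedness of the second-order Riesz transforms. By duality it
is a bound of the pairing of `g` with `∂ᵢ ∂ⱼ Δ⁻¹ f`, which is twice the time integral of the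
pairings of `∂ᵢ g_t` with `∂ⱼ f_t` for the heat flows `g_t` and `f_t` of `g` and `f`. The integrand
is controlled by the heat operator applied to a Bellman function of `|g_t|²` and `|f_t|²`, and the
integral of the latter telescopes.

Both estimates are easier for trigonometric polynomials, which are preserved by the resolvent of
`Δ`; this solves `z u - Δ u = f` in `W^{2,p}` by approximation and carries the estimates over.
-/

namespace TorusSemigroup

open MeasureTheory Filter

noncomputable section

/-! ### Power boundedness under the Ritt condition -/

section PowerBounded

theorem norm_iteratedDeriv_le_circleAverage {E : Type*} [NormedAddCommGroup E] [NormedSpace ℂ E]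
    [CompleteSpace E] {F : ℂ → E} {c : ℂ} {R : ℝ} (hR : 0 < R)
    (hF : DiffContOnCl ℂ F (Metric.ball c R)) (n : ℕ) :
    ‖iteratedDeriv n F c‖ ≤ n.factorial / R ^ n * Real.circleAverage (fun z => ‖F z‖) c R := by
  have cauchy := hF.circleIntegral_one_div_sub_center_pow_smul hR n
  have bound : ‖∮ z in C(c, R), (1 / (z - c) ^ (n + 1)) • F z‖ ≤
      2 * Real.pi / R ^ n * Real.circleAverage (fun z => ‖F z‖) c R := by
    rw [Real.circleAverage_def, smul_eq_mul, ← mul_assoc,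
      show 2 * Real.pi / R ^ n * (2 * Real.pi)⁻¹ = (R ^ n)⁻¹ by field_simp,
      ← intervalIntegral.integral_const_mul, circleIntegral]
    refine (intervalIntegral.norm_integral_le_integral_norm Real.two_pi_pos.le).trans_eq ?_
    refine intervalIntegral.integral_congr fun θ _ => ?_
    simp only [norm_smul, deriv_circleMap, norm_mul, norm_circleMap_zero, Complex.norm_I,
      norm_div, norm_pow, norm_one, circleMap_sub_center, abs_of_pos hR, pow_succ]
    field_simp
  rw [cauchy, norm_smul, norm_div, Complex.norm_natCast] at bound
  have norm_two_pi_I : ‖(2 * Real.pi * Complex.I : ℂ)‖ = 2 * Real.pi := by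
    simp [abs_of_pos Real.pi_pos]
  rw [norm_two_pi_I, div_mul_eq_mul_div, div_mul_eq_mul_div, mul_div_assoc, mul_div_assoc] at bound
  have := le_of_mul_le_mul_left bound Real.two_pi_pos
  rw [div_le_iff₀ (by positivity)] at this
  exact this.trans_eq (by ring)

/-- The integrand is, up to the factor `1 - ρ ^ 2`, the Poisson kernel of the point `ρ ^ 2`. -/
theorem circleAverage_inv_norm_one_sub_sq {ρ : ℝ} (hρ : 0 < ρ) (hρ1 : ρ < 1) :
    Real.circleAverage (fun w : ℂ => (‖1 - w‖ ^ 2)⁻¹) 0 ρ = (1 - ρ ^ 2)⁻¹ := by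
  have hlt : ρ ^ 2 < ρ := by nlinarith
  have hmem : ((ρ ^ 2 : ℝ) : ℂ) ∈ Metric.ball (0 : ℂ) ρ := by
    simpa [abs_of_pos hρ] using hlt
  have poisson := InnerProductSpace.HarmonicOnNhd.circleAverage_poissonKernel_smul
    (f := fun _ : ℂ => (1 : ℝ)) (fun z _ => InnerProductSpace.harmonicAt_const 1) hmem
  have kernel_eq : Set.EqOn (poissonKernel 0 ((ρ ^ 2 : ℝ) : ℂ) • fun _ : ℂ => (1 : ℝ))
      (fun z => (1 - ρ ^ 2) • (‖1 - z‖ ^ 2)⁻¹) (Metric.sphere 0 |ρ|) := by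
    intro z hz
    have hz : ‖z‖ = ρ := by simpa [abs_of_pos hρ] using hz
    have reflect : z - ((ρ ^ 2 : ℝ) : ℂ) = z * (starRingEnd ℂ) (1 - z) := by
      rw [map_sub, map_one, mul_sub, mul_one, Complex.mul_conj, Complex.normSq_eq_norm_sq, hz]
    simp only [Pi.smul_apply', poissonKernel_def, sub_zero, reflect, norm_mul, RCLike.norm_conj,
      hz, Complex.norm_real, Real.norm_of_nonneg (sq_nonneg ρ), smul_eq_mul, mul_one]
    rw [mul_pow, show ρ ^ 2 - (ρ ^ 2) ^ 2 = ρ ^ 2 * (1 - ρ ^ 2) by ring,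
      mul_div_mul_left _ _ (by positivity), div_eq_mul_inv]
  rw [Real.circleAverage_congr_sphere kernel_eq, Real.circleAverage_fun_smul, smul_eq_mul]
    at poisson
  exact eq_inv_of_mul_eq_one_right poisson

variable {𝔸 : Type*} [NormedRing 𝔸] [NormedAlgebra ℂ 𝔸]

/-- The function `w ↦ (r (1 - w r)⁻¹) ^ 2`, whose Taylor coefficients at the origin are multiples of
the powers of `r`. It is bracketed as `r` times the derivative of `w ↦ (1 - w r)⁻¹`. -/
def resolventSq (r : 𝔸) (w : ℂ) : 𝔸 :=
  r * (Ring.inverse (1 - w • r) * r * Ring.inverse (1 - w • r))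

/-- The Ritt resolvent condition on `r`, which makes `r` power bounded. It is written in the
variable `w = 1 / z` of the unit disc: then `‖(z - 1) (z - r)⁻¹ r‖ ≤ M` for `|z| > 1`. -/
structure RittBound (r : 𝔸) (M : ℝ) : Prop where
  isUnit : ∀ w : ℂ, ‖w‖ < 1 → IsUnit (1 - w • r)
  norm_le : ∀ w : ℂ, ‖w‖ < 1 → ‖1 - w‖ * ‖r * Ring.inverse (1 - w • r)‖ ≤ M

namespace RittBound

variable {r : 𝔸} {M : ℝ}

theorem norm_self_le (h : RittBound r M) : ‖r‖ ≤ M := by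
  simpa using h.norm_le 0 (by simp)

theorem nonneg (h : RittBound r M) : 0 ≤ M := (norm_nonneg r).trans h.norm_self_le

theorem norm_resolventSq_le (h : RittBound r M) {w : ℂ} (hw : ‖w‖ < 1) :
    ‖resolventSq r w‖ ≤ M ^ 2 * (‖1 - w‖ ^ 2)⁻¹ := by
  have hpos : 0 < ‖1 - w‖ := by
    rw [norm_pos_iff, sub_ne_zero]
    rintro rfl
    simp at hw
  have factor_le : ‖r * Ring.inverse (1 - w • r)‖ ≤ M * ‖1 - w‖⁻¹ := by
    rw [← div_eq_mul_inv, le_div_iff₀ hpos, mul_comm]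
    exact h.norm_le w hw
  calc ‖resolventSq r w‖
      = ‖(r * Ring.inverse (1 - w • r)) * (r * Ring.inverse (1 - w • r))‖ := by
        simp only [resolventSq, mul_assoc]
    _ ≤ (M * ‖1 - w‖⁻¹) * (M * ‖1 - w‖⁻¹) :=
        norm_mul_le_of_le factor_le factor_le
    _ = M ^ 2 * (‖1 - w‖ ^ 2)⁻¹ := by rw [← inv_pow]; ring

end RittBound

variable [CompleteSpace 𝔸]

theorem hasDerivAt_inverse_one_sub_smul {r : 𝔸} {w : ℂ} (hw : IsUnit (1 - w • r)) :
    HasDerivAt (fun z : ℂ => Ring.inverse (1 - z • r))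
      (Ring.inverse (1 - w • r) * r * Ring.inverse (1 - w • r)) w := by
  have hinv : HasFDerivAt Ring.inverse _ (1 - w • r) := hasFDerivAt_ringInverse (𝕜 := ℂ) hw.unit
  have haff : HasDerivAt (fun z : ℂ => 1 - z • r) (-r) w := by
    simpa using ((hasDerivAt_id w).smul_const r).const_sub 1
  simpa [← Ring.inverse_unit hw.unit] using! hinv.comp_hasDerivAt w haff

theorem iteratedDeriv_resolventSq (r : 𝔸) (n : ℕ) :
    iteratedDeriv n (resolventSq r) 0 = ((n + 1).factorial : ℂ) • r ^ (n + 2) := by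
  have taylor := (spectrum.hasFPowerSeriesOnBall_inverse_one_sub_smul ℂ r).factorial_smul 1 (n + 1)
  rw [← iteratedDeriv_eq_iteratedFDeriv] at taylor
  have eventually_deriv : (fun w : ℂ => Ring.inverse (1 - w • r) * r * Ring.inverse (1 - w • r))
      =ᶠ[𝓝 0] deriv (fun z : ℂ => Ring.inverse (1 - z • r)) := by
    have hcont : Continuous fun w : ℂ => 1 - w • r := by fun_prop
    filter_upwards [hcont.continuousAt.eventually (Units.isOpen.mem_nhds (by simp))] with w hw
    exact (hasDerivAt_inverse_one_sub_smul hw).deriv.symm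
  have smooth : ContDiffAt ℂ n (fun w : ℂ => Ring.inverse (1 - w • r)) 0 := by
    have haff : ContDiffAt ℂ n (fun w : ℂ => 1 - w • r) 0 := by fun_prop
    refine ContDiffAt.comp (g := Ring.inverse) (0 : ℂ) ?_ haff
    simpa using contDiffAt_ringInverse ℂ (1 : 𝔸ˣ)
  unfold resolventSq
  rw [iteratedDeriv_const_mul r ((smooth.mul contDiffAt_const).mul smooth),
    eventually_deriv.iteratedDeriv_eq, ← iteratedDeriv_succ', ← taylor, pow_succ' r (n + 1)]
  simp [← Nat.cast_smul_eq_nsmul ℂ]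

theorem RittBound.differentiableAt_resolventSq {r : 𝔸} {M : ℝ} (h : RittBound r M) {w : ℂ}
    (hw : ‖w‖ < 1) : DifferentiableAt ℂ (resolventSq r) w := by
  have hinv := (hasDerivAt_inverse_one_sub_smul (h.isUnit w hw)).differentiableAt
  exact ((hinv.mul_const r).mul hinv).const_mul r

theorem RittBound.circleAverage_norm_resolventSq_le {r : 𝔸} {M : ℝ} (h : RittBound r M) {ρ : ℝ}
    (hρ : 0 < ρ) (hρ1 : ρ < 1) :
    Real.circleAverage (fun w => ‖resolventSq r w‖) 0 ρ ≤ M ^ 2 * (1 - ρ ^ 2)⁻¹ := by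
  have norm_lt_one : ∀ w ∈ Metric.sphere (0 : ℂ) |ρ|, ‖w‖ < 1 := fun w hw => by
    rwa [mem_sphere_zero_iff_norm.1 hw, abs_of_pos hρ]
  rw [← circleAverage_inv_norm_one_sub_sq hρ hρ1, ← smul_eq_mul (M ^ 2),
    ← Real.circleAverage_fun_smul]
  refine Real.circleAverage_mono ?_ ?_ fun w hw => h.norm_resolventSq_le (norm_lt_one w hw)
  · exact ContinuousOn.circleIntegrable' fun w hw =>
      (h.differentiableAt_resolventSq (norm_lt_one w hw)).continuousAt.norm.continuousWithinAt
  · have hcont : ContinuousOn (fun w : ℂ => (‖1 - w‖ ^ 2)⁻¹) (Metric.sphere 0 |ρ|) := by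
      refine ContinuousOn.inv₀ (by fun_prop) fun w hw hzero => ?_
      obtain rfl : 1 = w := by simpa [sub_eq_zero] using hzero
      simpa using norm_lt_one 1 hw
    exact (hcont.const_smul (M ^ 2)).circleIntegrable'

theorem inv_pow_mul_inv_one_sub_sq_le (n : ℕ) :
    (((n + 1) / (n + 2) : ℝ) ^ n)⁻¹ * (1 - ((n + 1) / (n + 2) : ℝ) ^ 2)⁻¹ ≤ 6 * ((n : ℝ) + 1) := by
  have : (0 : ℝ) ≤ n := n.cast_nonneg
  have inv_pow_le : (((n + 1) / (n + 2) : ℝ) ^ n)⁻¹ ≤ 3 :=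
    calc (((n + 1) / (n + 2) : ℝ) ^ n)⁻¹ = (1 / ((n : ℝ) + 1) + 1) ^ n := by
          rw [← inv_pow]; congr 1; field_simp; ring
      _ ≤ (Real.exp (1 / (n + 1))) ^ n := by
          gcongr
          exact Real.add_one_le_exp _
      _ = Real.exp (n * (1 / (n + 1))) := by rw [← Real.exp_nat_mul]
      _ ≤ Real.exp 1 := by
          rw [Real.exp_le_exp, mul_one_div, div_le_one (by positivity)]
          linarith
      _ ≤ 3 := Real.exp_one_lt_d9.le.trans (by norm_num)
  have one_sub_sq : 1 - ((n + 1) / (n + 2) : ℝ) ^ 2 = (2 * n + 3) / (n + 2) ^ 2 := by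
    field_simp; ring
  have inv_one_sub_sq_le : (1 - ((n + 1) / (n + 2) : ℝ) ^ 2)⁻¹ ≤ 2 * ((n : ℝ) + 1) := by
    rw [one_sub_sq, inv_div, div_le_iff₀ (by positivity)]
    nlinarith
  calc _ ≤ 3 * (2 * ((n : ℝ) + 1)) := by
        refine mul_le_mul inv_pow_le inv_one_sub_sq_le ?_ (by norm_num)
        rw [one_sub_sq]
        positivity
    _ = 6 * (n + 1) := by ring

/-- Cauchy's estimate for `(r (1 - w r)⁻¹) ^ 2 = ∑ (n + 1) r ^ (n + 2) w ^ n` on the circle of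
radius `ρ = 1 - 1 / (n + 2)`: the mean of this function over the circle is of the order `n`. -/
theorem RittBound.norm_pow_le {r : 𝔸} {M : ℝ} (h : RittBound r M) (n : ℕ) :
    ‖r ^ n‖ ≤ ‖(1 : 𝔸)‖ + M + 6 * M ^ 2 := by
  have hM := h.nonneg
  have hone : 0 ≤ ‖(1 : 𝔸)‖ := norm_nonneg _
  rcases n with _ | _ | n
  · rw [pow_zero]; nlinarith
  · rw [zero_add, pow_one]; nlinarith [h.norm_self_le]
  set ρ : ℝ := (n + 1) / (n + 2) with hρ
  have hρ0 : 0 < ρ := by positivity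
  have hρ1 : ρ < 1 := by rw [hρ, div_lt_one (by positivity)]; linarith
  have hdiff : DiffContOnCl ℂ (resolventSq r) (Metric.ball 0 ρ) := by
    refine DifferentiableOn.diffContOnCl fun w hw => ?_
    rw [closure_ball _ hρ0.ne', mem_closedBall_zero_iff] at hw
    exact (h.differentiableAt_resolventSq (hw.trans_lt hρ1)).differentiableWithinAt
  have cauchy := norm_iteratedDeriv_le_circleAverage hρ0 hdiff n
  rw [iteratedDeriv_resolventSq, norm_smul, Complex.norm_natCast, Nat.factorial_succ,
    Nat.cast_mul, mul_comm _ (n.factorial : ℝ), div_mul_eq_mul_div, mul_assoc, mul_div_assoc]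
    at cauchy
  have key : (n + 1) * ‖r ^ (n + 2)‖ ≤ (n + 1) * (6 * M ^ 2) :=
    calc (n + 1) * ‖r ^ (n + 2)‖
        ≤ Real.circleAverage (fun w => ‖resolventSq r w‖) 0 ρ / ρ ^ n := by
          exact_mod_cast le_of_mul_le_mul_left cauchy (by positivity)
      _ ≤ M ^ 2 * (1 - ρ ^ 2)⁻¹ / ρ ^ n := by
          gcongr
          exact h.circleAverage_norm_resolventSq_le hρ0 hρ1
      _ = M ^ 2 * ((ρ ^ n)⁻¹ * (1 - ρ ^ 2)⁻¹) := by ring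
      _ ≤ M ^ 2 * (6 * (n + 1)) :=
          mul_le_mul_of_nonneg_left (inv_pow_mul_inv_one_sub_sq_le n) (sq_nonneg M)
      _ = (n + 1) * (6 * M ^ 2) := by ring
  linarith [le_of_mul_le_mul_left key (by positivity)]

end PowerBounded

section HalfPlane

theorem norm_inv_oneSub_le {𝔸 : Type*} [NormedRing 𝔸] [CompleteSpace 𝔸] {y : 𝔸} (hy : ‖y‖ ≤ 1 / 2) :
    ‖(↑(Units.oneSub y (hy.trans_lt one_half_lt_one))⁻¹ : 𝔸)‖ ≤ 2 * ‖(1 : 𝔸)‖ := by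
  set u := Units.oneSub y (hy.trans_lt one_half_lt_one)
  have fixed_point : (↑u⁻¹ : 𝔸) = 1 + y * ↑u⁻¹ := by
    rw [← sub_eq_iff_eq_add, ← one_sub_mul]
    exact u.mul_inv
  have self_bound : ‖(↑u⁻¹ : 𝔸)‖ ≤ ‖(1 : 𝔸)‖ + 1 / 2 * ‖(↑u⁻¹ : 𝔸)‖ := by
    nth_rw 1 [fixed_point]
    refine (norm_add_le _ _).trans (add_le_add_right ((norm_mul_le _ _).trans ?_) _)
    gcongr
  linarith

variable {𝔸 : Type*} [NormedRing 𝔸] [NormedAlgebra ℂ 𝔸]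

/-- The resolvent of `a` exists in the open right half-plane and `‖z (z - a)⁻¹‖ ≤ M` there. -/
def HalfPlaneBound (a : 𝔸) (M : ℝ) : Prop :=
  ∀ z : ℂ, 0 < z.re → ∃ s : 𝔸, (z • 1 - a) * s = 1 ∧ s * (z • 1 - a) = 1 ∧ ‖z‖ * ‖s‖ ≤ M

theorem smul_sub_one_of_sub_mul_eq_one {a s : 𝔸} {z : ℂ} (h : (z • 1 - a) * s = 1) :
    z • s - 1 = a * s := by
  rw [sub_mul, smul_mul_assoc, one_mul] at h
  rw [← h]
  abel

theorem HalfPlaneBound.rittBound {a : 𝔸} {M : ℝ} (h : HalfPlaneBound a M) {m : ℝ} (hm : 0 < m)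
    {s : 𝔸} (right_inv : ((m : ℂ) • 1 - a) * s = 1) (left_inv : s * ((m : ℂ) • 1 - a) = 1) :
    RittBound ((m : ℂ) • s) M := by
  have exists_unit : ∀ w : ℂ, ‖w‖ < 1 → ∃ u : 𝔸ˣ, (u : 𝔸) = 1 - w • ((m : ℂ) • s) ∧
      ‖1 - w‖ * ‖((m : ℂ) • s) * (↑u⁻¹ : 𝔸)‖ ≤ M := by
    intro w hw
    have re_pos : 0 < ((m : ℂ) * (1 - w)).re := by
      rw [Complex.re_ofReal_mul, Complex.sub_re, Complex.one_re]
      exact mul_pos hm (by linarith [(Complex.re_le_norm w).trans_lt hw])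
    obtain ⟨s', right_inv', left_inv', norm_le⟩ := h _ re_pos
    refine ⟨⟨(((m : ℂ) * (1 - w)) • 1 - a) * s, ((m : ℂ) • 1 - a) * s', ?_, ?_⟩, ?_, ?_⟩
    · rw [mul_assoc, ← mul_assoc s, left_inv, one_mul, right_inv']
    · rw [mul_assoc, ← mul_assoc s', left_inv', one_mul, right_inv]
    · rw [Units.val_mk, mul_sub, mul_one, mul_comm (m : ℂ) w, sub_smul, sub_right_comm, sub_mul,
        right_inv, smul_mul_assoc, one_mul, smul_smul]
    · rw [Units.inv_mk, Units.val_mk, smul_mul_assoc, ← mul_assoc, left_inv, one_mul, norm_smul,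
        ← mul_assoc, mul_comm ‖1 - w‖, ← norm_mul]
      exact norm_le
  constructor
  · intro w hw
    obtain ⟨u, hu, -⟩ := exists_unit w hw
    exact hu ▸ u.isUnit
  · intro w hw
    obtain ⟨u, hu, norm_le⟩ := exists_unit w hw
    rwa [← hu, Ring.inverse_unit]

variable [CompleteSpace 𝔸]

theorem norm_exp_smul_le_of_norm_pow_le {r : 𝔸} {C : ℝ} (h : ∀ n, ‖r ^ n‖ ≤ C) {t : ℝ}
    (ht : 0 ≤ t) : ‖NormedSpace.exp ((t : ℂ) • (r - 1))‖ ≤ C := by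
  let _ : NormedAlgebra ℚ 𝔸 := NormedAlgebra.restrictScalars ℚ ℂ 𝔸
  have norm_exp_le : ‖NormedSpace.exp ((t : ℂ) • r)‖ ≤ Real.exp t * C := by
    have scalar_series : HasSum (fun n : ℕ => t ^ n / n.factorial * C) (Real.exp t * C) := by
      rw [Real.exp_eq_exp_ℝ]
      exact (NormedSpace.expSeries_div_hasSum_exp t).mul_right C
    rw [← (NormedSpace.exp_series_hasSum_exp' (𝕂 := ℂ) ((t : ℂ) • r)).tsum_eq]
    refine tsum_of_norm_bounded scalar_series fun n => ?_
    rw [smul_pow, smul_smul, norm_smul, norm_mul, norm_inv, norm_pow, Complex.norm_natCast,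
      Complex.norm_real, Real.norm_of_nonneg ht, ← div_eq_inv_mul]
    gcongr
    exact h n
  have split : (t : ℂ) • (r - 1) = (t : ℂ) • r + algebraMap ℂ 𝔸 (-t) := by
    rw [smul_sub, Algebra.algebraMap_eq_smul_one, neg_smul, sub_eq_add_neg]
  rw [split, NormedSpace.exp_add_of_commute (Algebra.commutes _ _).symm,
    ← NormedSpace.algebraMap_exp_comm, ← Algebra.commutes, ← Algebra.smul_def, norm_smul,
    ← Complex.exp_eq_exp_ℂ, Complex.norm_exp]
  calc Real.exp (-(t : ℂ)).re * ‖NormedSpace.exp ((t : ℂ) • r)‖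
      ≤ Real.exp (-t) * (Real.exp t * C) := by
        gcongr
        simp
    _ = C := by rw [← mul_assoc, ← Real.exp_add, neg_add_cancel, Real.exp_zero, one_mul]

/-- The Yosida approximations `m • (m s - 1)` of `a`, where `s = (m - a)⁻¹`, converge to `a` as
`m → ∞`, and `m s` is power bounded. -/
theorem HalfPlaneBound.norm_exp_le {a : 𝔸} {M : ℝ} (h : HalfPlaneBound a M) {t : ℝ} (ht : 0 ≤ t) :
    ‖NormedSpace.exp ((t : ℂ) • a)‖ ≤ ‖(1 : 𝔸)‖ + M + 6 * M ^ 2 := by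
  let _ : NormedAlgebra ℚ 𝔸 := NormedAlgebra.restrictScalars ℚ ℂ 𝔸
  set m : ℕ → ℝ := fun n => n + 1
  have m_pos : ∀ n, 0 < m n := fun n => n.cast_add_one_pos
  choose s right_inv left_inv norm_le using fun n => h (m n : ℂ) (by simpa using m_pos n)
  have yosida : ∀ n, (m n : ℂ) • s n - 1 = a * s n := fun n =>
    smul_sub_one_of_sub_mul_eq_one (right_inv n)
  have norm_s_le : ∀ n, ‖s n‖ ≤ M * (1 / ((n : ℝ) + 1)) := fun n => by
    rw [mul_one_div, le_div_iff₀ (m_pos n), mul_comm]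
    simpa only [Complex.norm_real, Real.norm_of_nonneg (m_pos n).le] using norm_le n
  have tendsto_s : Tendsto s atTop (𝓝 0) := by
    refine squeeze_zero_norm norm_s_le ?_
    simpa using tendsto_one_div_add_atTop_nhds_zero_nat.const_mul M
  have tendsto_one : Tendsto (fun n => (m n : ℂ) • s n) atTop (𝓝 1) := by
    rw [← tendsto_sub_nhds_zero_iff]
    simpa only [yosida, mul_zero] using tendsto_s.const_mul a
  have tendsto_exp : Tendsto (fun n => NormedSpace.exp (((t * m n : ℝ) : ℂ) •
      ((m n : ℂ) • s n - 1))) atTop (𝓝 (NormedSpace.exp ((t : ℂ) • a))) := by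
    have yosida_eq : ∀ n, ((t * m n : ℝ) : ℂ) • ((m n : ℂ) • s n - 1) =
        (t : ℂ) • (a * ((m n : ℂ) • s n)) := fun n => by
      rw [yosida, mul_smul_comm, smul_smul, Complex.ofReal_mul]
    simp only [yosida_eq]
    refine (NormedSpace.exp_continuous.tendsto _).comp ?_
    simpa using (tendsto_one.const_mul a).const_smul (t : ℂ)
  refine le_of_tendsto tendsto_exp.norm (Eventually.of_forall fun n => ?_)
  exact norm_exp_smul_le_of_norm_pow_le
    (h.rittBound (m_pos n) (right_inv n) (left_inv n)).norm_pow_le (mul_nonneg ht (m_pos n).le)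

/-- With `y = (c - 1) a (z - a)⁻¹`, one has `z - c a = (1 - y) (z - a)`. -/
theorem HalfPlaneBound.rotate {a : 𝔸} {M : ℝ} (h : HalfPlaneBound a M) {c : ℂ}
    (hc : ‖c - 1‖ * (‖(1 : 𝔸)‖ + M) ≤ 1 / 2) :
    HalfPlaneBound (c • a) (2 * ‖(1 : 𝔸)‖ * M) := by
  intro z hz
  obtain ⟨s, right_inv, left_inv, norm_le⟩ := h z hz
  set y : 𝔸 := (c - 1) • (a * s) with hy
  have norm_y_le : ‖y‖ ≤ 1 / 2 := by
    refine le_trans ?_ hc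
    rw [hy, norm_smul, ← smul_sub_one_of_sub_mul_eq_one right_inv]
    gcongr
    refine (norm_sub_le _ _).trans ?_
    rw [norm_smul]
    linarith
  set u : 𝔸ˣ := Units.oneSub y (norm_y_le.trans_lt one_half_lt_one) with hu
  have factor : z • 1 - c • a = u * (z • 1 - a) := by
    rw [hu, Units.val_oneSub, one_sub_mul, hy, smul_mul_assoc, mul_assoc, left_inv, mul_one,
      sub_smul, one_smul]
    abel
  refine ⟨s * ↑u⁻¹, ?_, ?_, ?_⟩
  · rw [factor, mul_assoc, ← mul_assoc _ s, right_inv, one_mul, u.mul_inv]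
  · rw [factor, mul_assoc, ← mul_assoc (↑u⁻¹ : 𝔸), u.inv_mul, one_mul, left_inv]
  · calc ‖z‖ * ‖s * ↑u⁻¹‖ ≤ ‖z‖ * (‖s‖ * (2 * ‖(1 : 𝔸)‖)) := by
          gcongr
          exact norm_mul_le_of_le le_rfl (norm_inv_oneSub_le norm_y_le)
      _ = 2 * ‖(1 : 𝔸)‖ * (‖z‖ * ‖s‖) := by ring
      _ ≤ 2 * ‖(1 : 𝔸)‖ * M := by gcongr

end HalfPlane

/-! ### Generation of analytic semigroups -/

section StrongConvergence

variable {ι X Y : Type*} [NormedAddCommGroup X] [NormedSpace ℂ X] [NormedAddCommGroup Y]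
  [NormedSpace ℂ Y] {C : ℝ}

theorem tendsto_clm_apply_of_norm_le {l : Filter ι} {T : ι → X →L[ℂ] Y} (hT : ∀ i, ‖T i‖ ≤ C)
    {u : ι → X} {x : X} {y : Y} (hu : Tendsto u l (𝓝 x)) (hx : Tendsto (fun i => T i x) l (𝓝 y)) :
    Tendsto (fun i => T i (u i)) l (𝓝 y) := by
  have tendsto_error : Tendsto (fun i => T i (u i - x)) l (𝓝 0) := by
    refine squeeze_zero_norm (fun i => (T i).le_of_opNorm_le (hT i) _) ?_
    simpa using (tendsto_iff_norm_sub_tendsto_zero.1 hu).const_mul C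
  simpa using tendsto_error.add hx

theorem tendsto_clm_apply_of_dense {l : Filter ι} {T : ι → X →L[ℂ] Y} {L : X →L[ℂ] Y}
    (hT : ∀ᶠ i in l, ‖T i‖ ≤ C) {D : Set X} (hD : Dense D)
    (h : ∀ x ∈ D, Tendsto (fun i => T i x) l (𝓝 (L x))) (x : X) :
    Tendsto (fun i => T i x) l (𝓝 (L x)) := by
  rw [Metric.tendsto_nhds]
  intro ε hε
  have radius_pos : 0 < ε / (2 * (|C| + ‖L‖ + 1)) := by positivity
  obtain ⟨x', hx', hxx'⟩ := hD.exists_dist_lt x radius_pos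
  filter_upwards [hT, Metric.tendsto_nhds.1 (h x' hx') (ε / 2) (by positivity)] with i hTi hi
  rw [dist_eq_norm] at hxx' hi ⊢
  calc ‖T i x - L x‖ = ‖T i (x - x') + (T i x' - L x') - L (x - x')‖ := by
        simp only [map_sub]
        abel_nf
    _ ≤ ‖T i (x - x')‖ + ‖T i x' - L x'‖ + ‖L (x - x')‖ :=
        (norm_sub_le _ _).trans (add_le_add_left (norm_add_le _ _) _)
    _ ≤ |C| * ‖x - x'‖ + ‖T i x' - L x'‖ + ‖L‖ * ‖x - x'‖ := by
        gcongr
        · exact (T i).le_of_opNorm_le (hTi.trans (le_abs_self C)) _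
        · exact L.le_opNorm _
    _ < (|C| + ‖L‖ + 1) * (ε / (2 * (|C| + ‖L‖ + 1))) + ε / 2 := by
        have := mul_le_mul_of_nonneg_left hxx'.le (by positivity : 0 ≤ |C| + ‖L‖ + 1)
        linarith [norm_nonneg (x - x')]
    _ = ε := by field_simp; ring

theorem uniformCauchySeqOn_clm_apply_of_dense {α : Type*} {S : Set α} {T : ℕ → α → X →L[ℂ] Y}
    (hT : ∀ n, ∀ z ∈ S, ‖T n z‖ ≤ C) {D : Set X} (hD : Dense D)
    (h : ∀ x ∈ D, UniformCauchySeqOn (fun n z => T n z x) atTop S) (x : X) :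
    UniformCauchySeqOn (fun n z => T n z x) atTop S := by
  rw [Metric.uniformCauchySeqOn_iff]
  intro ε hε
  have radius_pos : 0 < ε / (4 * (|C| + 1)) := by positivity
  obtain ⟨x', hx', hxx'⟩ := hD.exists_dist_lt x radius_pos
  obtain ⟨N, hN⟩ := Metric.uniformCauchySeqOn_iff.1 (h x' hx') (ε / 2) (by positivity)
  refine ⟨N, fun m hm n hn z hz => ?_⟩
  have error_le : ∀ k, dist (T k z x) (T k z x') ≤ ε / 4 := fun k =>
    calc dist (T k z x) (T k z x') = ‖T k z (x - x')‖ := by rw [dist_eq_norm, map_sub]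
      _ ≤ (|C| + 1) * ‖x - x'‖ :=
          (T k z).le_of_opNorm_le ((hT k z hz).trans (by linarith [le_abs_self C])) _
      _ ≤ (|C| + 1) * (ε / (4 * (|C| + 1))) := by
          rw [← dist_eq_norm]
          gcongr
      _ = ε / 4 := by field_simp
  calc dist (T m z x) (T n z x)
      ≤ dist (T m z x) (T m z x') + dist (T m z x') (T n z x') + dist (T n z x') (T n z x) :=
        dist_triangle4 _ _ _ _
    _ < ε := by linarith [error_le m, error_le n, hN m hm n hn z hz, dist_comm (T n z x) (T n z x')]

end StrongConvergence

section StrongHolomorphy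

variable {X Y : Type*} [NormedAddCommGroup X] [NormedSpace ℂ X] [NormedAddCommGroup Y]
  [NormedSpace ℂ Y] {T : ℂ → X →L[ℂ] Y} {C : ℝ} {c : ℂ} {r : ℝ}

theorem lipschitzOnWith_clm_of_differentiableOn_apply (hr : 0 < r)
    (bound : ∀ z ∈ Metric.ball c (2 * r), ‖T z‖ ≤ C)
    (h : ∀ x, DifferentiableOn ℂ (fun z => T z x) (Metric.ball c (2 * r))) :
    LipschitzOnWith (C / r).toNNReal T (Metric.ball c r) := by
  have hC : 0 ≤ C := (norm_nonneg _).trans (bound c (Metric.mem_ball_self (by positivity)))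
  have deriv_le : ∀ x, ∀ w ∈ Metric.ball c r, ‖deriv (fun z => T z x) w‖ ≤ C * ‖x‖ / r := by
    intro x w hw
    have closedBall_subset : Metric.closedBall w r ⊆ Metric.ball c (2 * r) :=
      Metric.closedBall_subset_ball' (by linarith [Metric.mem_ball.1 hw])
    refine Complex.norm_deriv_le_of_forall_mem_sphere_norm_le hr
      (((h x).mono closedBall_subset).diffContOnCl_ball subset_rfl) fun z hz => ?_
    exact (T z).le_of_opNorm_le
      (bound z (closedBall_subset (Metric.sphere_subset_closedBall hz))) x
  have ball_subset : Metric.ball c r ⊆ Metric.ball c (2 * r) :=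
    Metric.ball_subset_ball (by linarith)
  refine LipschitzOnWith.of_dist_le_mul fun z hz w hw => ?_
  rw [dist_eq_norm, dist_eq_norm, Real.coe_toNNReal _ (by positivity)]
  refine ContinuousLinearMap.opNorm_le_bound _ (by positivity) fun x => ?_
  calc ‖T z x - T w x‖ ≤ C * ‖x‖ / r * ‖z - w‖ :=
        (convex_ball c r).norm_image_sub_le_of_norm_deriv_le (𝕜 := ℂ) (f := fun z => T z x)
          (fun v hv => (h x).differentiableAt (Metric.isOpen_ball.mem_nhds (ball_subset hv)))
          (deriv_le x) hw hz
    _ = C / r * ‖z - w‖ * ‖x‖ := by ring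

variable [CompleteSpace Y]

/-- Cauchy's formula holds for `z ↦ T z x`, hence for the norm continuous function `T`. -/
theorem differentiableAt_clm_of_differentiableOn_apply (hr : 0 < r)
    (bound : ∀ z ∈ Metric.ball c (2 * r), ‖T z‖ ≤ C)
    (h : ∀ x, DifferentiableOn ℂ (fun z => T z x) (Metric.ball c (2 * r))) :
    DifferentiableAt ℂ T c := by
  have hcont : ContinuousOn T (Metric.ball c r) :=
    (lipschitzOnWith_clm_of_differentiableOn_apply hr bound h).continuousOn
  set ρ : NNReal := (r / 2).toNNReal with hρ
  have coe_ρ : (ρ : ℝ) = r / 2 := Real.coe_toNNReal _ (by positivity)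
  have ρ_pos : 0 < ρ := by simpa [hρ] using hr
  have sphere_subset : Metric.sphere c ρ ⊆ Metric.ball c r :=
    Metric.sphere_subset_ball (by rw [coe_ρ]; linarith)
  have integrable : CircleIntegrable T c ρ :=
    (hcont.mono sphere_subset).circleIntegrable ρ.coe_nonneg
  have cauchy_eq : ∀ w ∈ Metric.ball c ρ,
      (2 * Real.pi * Complex.I : ℂ)⁻¹ • (∮ z in C(c, ρ), (z - w)⁻¹ • T z) = T w := by
    intro w hw
    ext x
    have kernel_integrable : CircleIntegrable (fun z => (z - w)⁻¹ • T z) c ρ := by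
      have sub_continuous : ContinuousOn (fun z : ℂ => z - w) (Metric.sphere c ρ) := by fun_prop
      refine ((sub_continuous.inv₀ fun z hz hzero => ?_).smul
        (hcont.mono sphere_subset)).circleIntegrable ρ.coe_nonneg
      rw [sub_eq_zero.1 hzero] at hz
      exact (Metric.mem_ball.1 hw).ne (Metric.mem_sphere.1 hz)
    have diffContOnCl : DiffContOnCl ℂ (fun z => T z x) (Metric.ball c ρ) := by
      refine ((h x).mono (Metric.closedBall_subset_ball ?_)).diffContOnCl_ball subset_rfl
      rw [coe_ρ]
      linarith
    rw [smul_apply, circleIntegral,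
      ContinuousLinearMap.intervalIntegral_apply kernel_integrable.out]
    exact diffContOnCl.two_pi_i_inv_smul_circleIntegral_sub_inv_smul hw
  have cauchy_differentiableAt :=
    (hasFPowerSeriesOn_cauchy_integral integrable ρ_pos).analyticAt.differentiableAt
  refine cauchy_differentiableAt.congr_of_eventuallyEq ?_
  filter_upwards [Metric.ball_mem_nhds c ρ_pos] with w hw using (cauchy_eq w hw).symm

theorem differentiableOn_clm_of_apply {U : Set ℂ} (hU : IsOpen U) (bound : ∀ z ∈ U, ‖T z‖ ≤ C)
    (h : ∀ x, DifferentiableOn ℂ (fun z => T z x) U) : DifferentiableOn ℂ T U := by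
  intro z hz
  obtain ⟨ε, hε, ball_subset⟩ := Metric.isOpen_iff.1 hU z hz
  rw [← mul_div_cancel₀ ε two_ne_zero] at ball_subset
  exact (differentiableAt_clm_of_differentiableOn_apply (half_pos hε)
    (fun w hw => bound w (ball_subset hw))
    (fun x => (h x).mono ball_subset)).differentiableWithinAt

end StrongHolomorphy

section Exponential

variable {X : Type*} [NormedAddCommGroup X] [NormedSpace ℂ X] [CompleteSpace X]

theorem hasDerivAt_exp_ofReal_smul (a : X →L[ℂ] X) (s : ℝ) :
    HasDerivAt (fun s : ℝ => NormedSpace.exp ((s : ℂ) • a)) (NormedSpace.exp ((s : ℂ) • a) * a) s :=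
  (hasDerivAt_exp_smul_const (𝕂 := ℂ) a (s : ℂ)).scomp s
    (Complex.ofRealCLM.hasDerivAt (x := s)) |>.congr_deriv (one_smul ℂ _)

theorem hasDerivAt_exp_ofReal_smul_apply (a : X →L[ℂ] X) (x : X) (s : ℝ) :
    HasDerivAt (fun s : ℝ => NormedSpace.exp ((s : ℂ) • a) x)
      (NormedSpace.exp ((s : ℂ) • a) (a x)) s :=
  ((ContinuousLinearMap.apply ℂ X x).restrictScalars ℝ).hasFDerivAt.comp_hasDerivAt s
    (hasDerivAt_exp_ofReal_smul a s)

theorem exp_ofReal_smul_apply_sub (a : X →L[ℂ] X) (x : X) (t : ℝ) :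
    NormedSpace.exp ((t : ℂ) • a) x - x =
      ∫ s in (0 : ℝ)..t, NormedSpace.exp ((s : ℂ) • a) (a x) := by
  have hcont : Continuous fun s : ℝ => NormedSpace.exp ((s : ℂ) • a) (a x) :=
    continuous_iff_continuousAt.2 fun s =>
      (hasDerivAt_exp_ofReal_smul_apply a (a x) s).continuousAt
  rw [intervalIntegral.integral_eq_sub_of_hasDerivAt
    (fun s _ => hasDerivAt_exp_ofReal_smul_apply a x s) (hcont.intervalIntegrable _ _)]
  simp

/-- Differentiate `s ↦ exp (s a) exp ((1 - s) b) x` between `0` and `1`. -/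
theorem norm_exp_sub_exp_le {a b : X →L[ℂ] X} (hab : Commute a b) {C : ℝ}
    (ha : ∀ s ∈ Set.Icc (0 : ℝ) 1, ‖NormedSpace.exp ((s : ℂ) • a)‖ ≤ C)
    (hb : ∀ s ∈ Set.Icc (0 : ℝ) 1, ‖NormedSpace.exp ((s : ℂ) • b)‖ ≤ C) (x : X) :
    ‖NormedSpace.exp a x - NormedSpace.exp b x‖ ≤ C ^ 2 * ‖a x - b x‖ := by
  have interpolation_deriv : ∀ s : ℝ, HasDerivAt
      (fun s : ℝ => (NormedSpace.exp ((s : ℂ) • a) * NormedSpace.exp (((1 - s : ℝ) : ℂ) • b)) x)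
      ((NormedSpace.exp ((s : ℂ) • a) * NormedSpace.exp (((1 - s : ℝ) : ℂ) • b)) (a x - b x))
      s := by
    intro s
    have left_deriv := hasDerivAt_exp_ofReal_smul a s
    have right_deriv : HasDerivAt (fun s : ℝ => NormedSpace.exp (((1 - s : ℝ) : ℂ) • b))
        (-(NormedSpace.exp (((1 - s : ℝ) : ℂ) • b) * b)) s :=
      ((hasDerivAt_exp_ofReal_smul b (1 - s)).scomp s ((hasDerivAt_id s).const_sub 1)).congr_deriv
        (neg_one_smul ℝ _)
    refine (((ContinuousLinearMap.apply ℂ X x).restrictScalars ℝ).hasFDerivAt.comp_hasDerivAt s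
      (left_deriv.mul right_deriv)).congr_deriv ?_
    have commute_exp : a * NormedSpace.exp (((1 - s : ℝ) : ℂ) • b) =
        NormedSpace.exp (((1 - s : ℝ) : ℂ) • b) * a := by
      let _ : NormedAlgebra ℚ (X →L[ℂ] X) := NormedAlgebra.restrictScalars ℚ ℂ (X →L[ℂ] X)
      exact (hab.smul_right _).exp_right.eq
    rw [mul_assoc, commute_exp, mul_neg, ← sub_eq_add_neg, ← mul_assoc, ← mul_assoc, ← mul_sub]
    simp
  have mean_value := norm_image_sub_le_of_norm_deriv_le_segment_01' (C := C ^ 2 * ‖a x - b x‖)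
    (fun s _ => (interpolation_deriv s).hasDerivWithinAt) fun s hs => by
      refine ContinuousLinearMap.le_of_opNorm_le _ ?_ _
      rw [pow_two]
      exact norm_mul_le_of_le (ha s ⟨hs.1, hs.2.le⟩)
        (hb _ ⟨by linarith [hs.2], by linarith [hs.1]⟩)
  simpa using mean_value

end Exponential

section SectorialLimit

variable {X : Type*} [NormedAddCommGroup X] [NormedSpace ℂ X]

theorem isOpen_sector {θ : ℝ} (hθ : θ < Real.pi) : IsOpen (sector (-θ) θ) := by
  rw [isOpen_iff_mem_nhds]
  rintro z ⟨hz, arg_gt, arg_lt⟩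
  have mem_slitPlane : z ∈ Complex.slitPlane := by
    rw [Complex.mem_slitPlane_iff_arg]
    exact ⟨(arg_lt.trans hθ).ne, hz⟩
  filter_upwards [(Complex.continuousAt_arg mem_slitPlane).eventually (Ioo_mem_nhds arg_gt arg_lt),
    isOpen_ne.mem_nhds hz] with w hw hw0 using ⟨hw0, hw⟩

theorem ofReal_mul_mem_sector {φ₁ φ₂ : ℝ} {z : ℂ} (hz : z ∈ sector φ₁ φ₂) {s : ℝ} (hs : 0 < s) :
    (s : ℂ) * z ∈ sector φ₁ φ₂ := by
  obtain ⟨hz, arg_gt, arg_lt⟩ := hz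
  refine ⟨mul_ne_zero (by exact_mod_cast hs.ne') hz, ?_, ?_⟩ <;> rwa [Complex.arg_real_mul z hs]

theorem ofReal_mem_sector {θ : ℝ} (hθ : 0 < θ) {s : ℝ} (hs : 0 < s) :
    (s : ℂ) ∈ sector (-θ) θ := by
  refine ⟨by exact_mod_cast hs.ne', ?_, ?_⟩ <;> rw [Complex.arg_ofReal_of_nonneg hs.le] <;> linarith

/-- A sequence of commuting bounded operators `a n` approximating an unbounded generator: their
exponentials are bounded by `C` in the sector, and they converge strongly on the dense set `D`. -/
structure SectorialApprox (a : ℕ → X →L[ℂ] X) (θ C : ℝ) (D : Set X) : Prop where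
  pos : 0 < θ
  lt : θ < Real.pi
  commute : ∀ m n, Commute (a m) (a n)
  bound : ∀ n, ∀ z ∈ insert 0 (sector (-θ) θ), ‖NormedSpace.exp (z • a n)‖ ≤ C
  dense : Dense D
  tendsto : ∀ x ∈ D, ∃ y, Tendsto (fun n => a n x) atTop (𝓝 y)

namespace SectorialApprox

variable {a : ℕ → X →L[ℂ] X} {θ C : ℝ} {D : Set X}

theorem nonneg (h : SectorialApprox a θ C D) : 0 ≤ C :=
  (norm_nonneg _).trans (h.bound 0 0 (Set.mem_insert _ _))

theorem norm_exp_segment_le (h : SectorialApprox a θ C D) (n : ℕ) {z : ℂ}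
    (hz : z ∈ insert 0 (sector (-θ) θ)) {s : ℝ} (hs : 0 ≤ s) :
    ‖NormedSpace.exp ((s : ℂ) • z • a n)‖ ≤ C := by
  rw [smul_smul]
  refine h.bound n _ ?_
  rcases hs.eq_or_lt with rfl | hs
  · simp
  · rcases hz with rfl | hz
    · simp
    · exact Or.inr (ofReal_mul_mem_sector hz hs)

theorem ofReal_mem (h : SectorialApprox a θ C D) {s : ℝ} (hs : 0 ≤ s) :
    (s : ℂ) ∈ insert 0 (sector (-θ) θ) := by
  rcases hs.eq_or_lt with rfl | hs
  · simp
  · exact Or.inr (ofReal_mem_sector h.pos hs)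

/-- The strong limit of the operators `exp (z a n)`, and `0` where there is no such limit. -/
def limit (a : ℕ → X →L[ℂ] X) (z : ℂ) : X →L[ℂ] X :=
  open Classical in
  if h : ∃ L : X →L[ℂ] X, ∀ x, Tendsto (fun n => NormedSpace.exp (z • a n) x) atTop (𝓝 (L x))
  then h.choose else 0

theorem limit_eq {z : ℂ} {L : X →L[ℂ] X}
    (h : ∀ x, Tendsto (fun n => NormedSpace.exp (z • a n) x) atTop (𝓝 (L x))) :
    limit a z = L := by
  have exists_limit : ∃ L : X →L[ℂ] X, ∀ x,
      Tendsto (fun n => NormedSpace.exp (z • a n) x) atTop (𝓝 (L x)) := ⟨L, h⟩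
  rw [limit, dif_pos exists_limit]
  ext x
  exact tendsto_nhds_unique (exists_limit.choose_spec x) (h x)

theorem limit_zero (a : ℕ → X →L[ℂ] X) : limit a 0 = 1 := limit_eq fun x => by simp

variable [CompleteSpace X]

theorem norm_exp_sub_exp_le (h : SectorialApprox a θ C D) {z : ℂ}
    (hz : z ∈ insert 0 (sector (-θ) θ)) (m n : ℕ) (x : X) :
    ‖NormedSpace.exp (z • a m) x - NormedSpace.exp (z • a n) x‖ ≤
      C ^ 2 * (‖z‖ * ‖a m x - a n x‖) := by
  have key := TorusSemigroup.norm_exp_sub_exp_le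
    (((h.commute m n).smul_left z).smul_right z)
    (fun s hs => h.norm_exp_segment_le m hz hs.1) (fun s hs => h.norm_exp_segment_le n hz hs.1) x
  rwa [smul_apply, smul_apply, ← smul_sub, norm_smul] at key

theorem uniformCauchySeqOn (h : SectorialApprox a θ C D) (x : X) (ρ : ℝ) :
    UniformCauchySeqOn (fun n z => NormedSpace.exp (z • a n) x) atTop
      (insert 0 (sector (-θ) θ) ∩ Metric.closedBall 0 ρ) := by
  refine uniformCauchySeqOn_clm_apply_of_dense (fun n z hz => h.bound n z hz.1) h.dense
    (fun x hx => ?_) x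
  obtain ⟨y, hy⟩ := h.tendsto x hx
  rw [Metric.uniformCauchySeqOn_iff]
  intro ε hε
  obtain ⟨N, hN⟩ := Metric.cauchySeq_iff.1 hy.cauchySeq (ε / (C ^ 2 * |ρ| + 1)) (by positivity)
  refine ⟨N, fun m hm n hn z ⟨hz, hzρ⟩ => ?_⟩
  have norm_z_le : ‖z‖ ≤ |ρ| := (mem_closedBall_zero_iff.1 hzρ).trans (le_abs_self ρ)
  rw [dist_eq_norm]
  calc ‖NormedSpace.exp (z • a m) x - NormedSpace.exp (z • a n) x‖
      ≤ C ^ 2 * (‖z‖ * ‖a m x - a n x‖) := h.norm_exp_sub_exp_le hz m n x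
    _ ≤ C ^ 2 * (|ρ| * ‖a m x - a n x‖) := by gcongr
    _ = C ^ 2 * |ρ| * ‖a m x - a n x‖ := by ring
    _ ≤ (C ^ 2 * |ρ| + 1) * ‖a m x - a n x‖ := by gcongr; linarith
    _ < ε := by
      rw [mul_comm, ← lt_div_iff₀ (by positivity), ← dist_eq_norm]
      exact hN m hm n hn

theorem tendsto_limit (h : SectorialApprox a θ C D) {z : ℂ} (hz : z ∈ insert 0 (sector (-θ) θ))
    (x : X) : Tendsto (fun n => NormedSpace.exp (z • a n) x) atTop (𝓝 (limit a z x)) := by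
  have exists_limit : ∀ x, ∃ y, Tendsto (fun n => NormedSpace.exp (z • a n) x) atTop (𝓝 y) :=
    fun x => cauchySeq_tendsto_of_complete
      ((h.uniformCauchySeqOn x ‖z‖).cauchySeq ⟨hz, by simp⟩)
  choose L hL using exists_limit
  rw [limit_eq (L := continuousLinearMapOfTendsto (fun n => NormedSpace.exp (z • a n))
    (tendsto_pi_nhds.2 hL)) hL]
  exact hL x

theorem norm_limit_le (h : SectorialApprox a θ C D) {z : ℂ} (hz : z ∈ insert 0 (sector (-θ) θ)) :
    ‖limit a z‖ ≤ C :=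
  ContinuousLinearMap.opNorm_le_bound _ h.nonneg fun x =>
    le_of_tendsto (h.tendsto_limit hz x).norm
      (Eventually.of_forall fun n => ContinuousLinearMap.le_of_opNorm_le _ (h.bound n z hz) _)

theorem differentiableOn_limit (h : SectorialApprox a θ C D) :
    DifferentiableOn ℂ (limit a) (sector (-θ) θ) := by
  refine differentiableOn_clm_of_apply (isOpen_sector h.lt)
    (fun z hz => h.norm_limit_le (Set.mem_insert_of_mem _ hz)) fun x => ?_
  have locally_uniform : TendstoLocallyUniformlyOn (fun n z => NormedSpace.exp (z • a n) x)
      (fun z => limit a z x) atTop (sector (-θ) θ) := by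
    intro u hu z _
    have uniform := (h.uniformCauchySeqOn x (‖z‖ + 1)).tendstoUniformlyOn_of_tendsto
      (fun w hw => h.tendsto_limit hw.1 x)
    refine ⟨sector (-θ) θ ∩ Metric.closedBall 0 (‖z‖ + 1), ?_, ?_⟩
    · refine inter_mem self_mem_nhdsWithin (mem_nhdsWithin_of_mem_nhds ?_)
      exact Metric.closedBall_mem_nhds_of_mem (by simp)
    · filter_upwards [uniform u hu] with n hn w hw
      exact hn w ⟨Set.mem_insert_of_mem _ hw.1, hw.2⟩
  refine locally_uniform.differentiableOn (Eventually.of_forall fun n => ?_) (isOpen_sector h.lt)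
  exact ((differentiable_exp_smul_const ℂ (a n)).clm_apply
    (differentiable_const x)).differentiableOn

theorem limit_add (h : SectorialApprox a θ C D) {z w : ℂ} (hz : z ∈ sector (-θ) θ)
    (hw : w ∈ sector (-θ) θ) : limit a (z + w) = limit a z * limit a w := by
  let _ : NormedAlgebra ℚ (X →L[ℂ] X) := NormedAlgebra.restrictScalars ℚ ℂ (X →L[ℂ] X)
  have exp_add : ∀ n, NormedSpace.exp ((z + w) • a n) =
      NormedSpace.exp (z • a n) * NormedSpace.exp (w • a n) := fun n => by
    rw [add_smul, NormedSpace.exp_add_of_commute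
      (((Commute.refl (a n)).smul_left z).smul_right w)]
  refine limit_eq fun x => ?_
  simp only [exp_add, mul_apply_eq_comp]
  exact tendsto_clm_apply_of_norm_le (fun n => h.bound n z (Set.mem_insert_of_mem _ hz))
    (h.tendsto_limit (Set.mem_insert_of_mem _ hw) x)
    (h.tendsto_limit (Set.mem_insert_of_mem _ hz) _)

theorem norm_limit_apply_sub_le (h : SectorialApprox a θ C D) {z : ℂ}
    (hz : z ∈ insert 0 (sector (-θ) θ)) {x y : X} (hy : Tendsto (fun n => a n x) atTop (𝓝 y)) :
    ‖limit a z x - x‖ ≤ (C + 1) ^ 2 * (‖z‖ * ‖y‖) := by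
  refine le_of_tendsto_of_tendsto ((h.tendsto_limit hz x).sub_const x).norm
    ((hy.norm.const_mul _).const_mul _) (Eventually.of_forall fun n => ?_)
  have key := TorusSemigroup.norm_exp_sub_exp_le (C := C + 1) (Commute.zero_right (z • a n))
    (fun s hs => (h.norm_exp_segment_le n hz hs.1).trans (by linarith))
    (fun s _ => by
      rw [smul_zero, NormedSpace.exp_zero]
      exact ContinuousLinearMap.norm_id_le.trans (by linarith [h.nonneg])) x
  simpa [norm_smul] using key

theorem tendsto_limit_zero (h : SectorialApprox a θ C D) (x : X) :
    Tendsto (fun z => limit a z x) (𝓝[sector (-θ) θ] 0) (𝓝 x) := by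
  refine tendsto_clm_apply_of_dense (C := C) (L := ContinuousLinearMap.id ℂ X) ?_ h.dense
    (fun x hx => ?_) x
  · filter_upwards [self_mem_nhdsWithin] with z hz
    exact h.norm_limit_le (Set.mem_insert_of_mem _ hz)
  obtain ⟨y, hy⟩ := h.tendsto x hx
  rw [tendsto_iff_norm_sub_tendsto_zero]
  have bound_tendsto : Tendsto (fun z : ℂ => (C + 1) ^ 2 * (‖z‖ * ‖y‖)) (𝓝 0) (𝓝 0) :=
    Continuous.tendsto' (by fun_prop) _ _ (by simp)
  refine squeeze_zero' (Eventually.of_forall fun _ => norm_nonneg _) ?_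
    (bound_tendsto.mono_left nhdsWithin_le_nhds)
  filter_upwards [self_mem_nhdsWithin] with z hz
  exact h.norm_limit_apply_sub_le (Set.mem_insert_of_mem _ hz) hy

theorem limit_apply_sub (h : SectorialApprox a θ C D) {x y : X}
    (hy : Tendsto (fun n => a n x) atTop (𝓝 y)) {t : ℝ} (ht : 0 ≤ t) :
    limit a t x - x = ∫ s in (0 : ℝ)..t, limit a s y := by
  refine tendsto_nhds_unique ((h.tendsto_limit (h.ofReal_mem ht) x).sub_const x) ?_
  simp only [exp_ofReal_smul_apply_sub]
  obtain ⟨K, hK⟩ := (Metric.isBounded_range_of_tendsto _ hy).exists_norm_le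
  have mem_of_uIoc : ∀ s ∈ Set.uIoc 0 t, (s : ℂ) ∈ insert 0 (sector (-θ) θ) := fun s hs =>
    h.ofReal_mem (Set.uIoc_of_le ht ▸ hs).1.le
  refine intervalIntegral.tendsto_integral_filter_of_dominated_convergence (fun _ => C * K)
    (Eventually.of_forall fun n => ?_)
    (Eventually.of_forall fun n => Eventually.of_forall fun s hs => ?_)
    intervalIntegrable_const (Eventually.of_forall fun s hs => ?_)
  · refine (continuous_iff_continuousAt.2 fun s => ?_).aestronglyMeasurable
    exact (hasDerivAt_exp_ofReal_smul_apply (a n) (a n x) s).continuousAt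
  · exact ContinuousLinearMap.le_of_opNorm_le_of_le _ (h.bound n _ (mem_of_uIoc s hs))
      (hK _ ⟨n, rfl⟩)
  · exact tendsto_clm_apply_of_norm_le (fun n => h.bound n _ (mem_of_uIoc s hs)) hy
      (h.tendsto_limit (mem_of_uIoc s hs) y)

theorem tendsto_limit_slope (h : SectorialApprox a θ C D) {x y : X}
    (hy : Tendsto (fun n => a n x) atTop (𝓝 y)) :
    Tendsto (fun t : ℝ => (t : ℂ)⁻¹ • (limit a t x - x)) (𝓝[>] 0) (𝓝 y) := by
  have mapsTo_sector : Set.MapsTo (fun s : ℝ => (s : ℂ)) (Set.Ioi 0) (sector (-θ) θ) :=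
    fun s hs => ofReal_mem_sector h.pos hs
  have ofReal_tendsto : Tendsto (fun s : ℝ => (s : ℂ)) (𝓝[>] 0) (𝓝[sector (-θ) θ] 0) := by
    simpa using! Complex.continuous_ofReal.continuousWithinAt.tendsto_nhdsWithin mapsTo_sector
  have continuous_orbit : ContinuousOn (fun s : ℝ => limit a s y) (Set.Ioi 0) :=
    (h.differentiableOn_limit.continuousOn.clm_apply continuousOn_const).comp
      Complex.continuous_ofReal.continuousOn mapsTo_sector
  have continuous_zero : ContinuousWithinAt (fun s : ℝ => limit a s y) (Set.Ioi 0) 0 := by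
    simpa [ContinuousWithinAt, limit_zero] using! (h.tendsto_limit_zero y).comp ofReal_tendsto
  have derivative := intervalIntegral.integral_hasDerivWithinAt_right (s := Set.Ici 0)
    IntervalIntegrable.refl
    (continuous_orbit.stronglyMeasurableAtFilter_nhdsWithin measurableSet_Ioi 0) continuous_zero
  rw [hasDerivWithinAt_iff_tendsto_slope, Set.Ici_sdiff_left] at derivative
  simp only [Complex.ofReal_zero, limit_zero, one_apply_eq_self] at derivative
  refine derivative.congr' ?_
  filter_upwards [self_mem_nhdsWithin] with t ht
  rw [slope_def_module, intervalIntegral.integral_same, sub_zero, sub_zero,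
    h.limit_apply_sub hy (le_of_lt ht), ← Complex.ofReal_inv, Complex.coe_smul]

theorem isAnalyticSemigroup_limit (h : SectorialApprox a θ C D) :
    IsAnalyticSemigroup (-θ) θ (limit a) where
  neg := neg_neg_of_pos h.pos
  pos := h.pos
  analytic := h.differentiableOn_limit
  zero := limit_zero a
  tendsto := h.tendsto_limit_zero
  add _ hz _ hw := h.limit_add hz hw

end SectorialApprox

end SectorialLimit

section Generation

variable {X : Type*} [NormedAddCommGroup X] [NormedSpace ℂ X]

/-- The resolvent estimate in the right half-plane: for `Re z > 0` the operator `z - A` is onto and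
`|z| ‖x‖ ≤ M ‖z x - A x‖`. -/
def ResolventBound (A : X →ₗ.[ℂ] X) (M : ℝ) : Prop :=
  ∀ z : ℂ, 0 < z.re → (∀ x : A.domain, ‖z‖ * ‖(x : X)‖ ≤ M * ‖z • (x : X) - A x‖) ∧
    ∀ y, ∃ x : A.domain, z • (x : X) - A x = y

/-- `R z` is the resolvent `(z - A)⁻¹` for `Re z > 0`, with `‖z R z‖ ≤ M`. Nothing is required of
`R z` for the other `z`. -/
structure IsResolvent (A : X →ₗ.[ℂ] X) (R : ℂ → X →L[ℂ] X) (M : ℝ) : Prop where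
  mem : ∀ z : ℂ, 0 < z.re → ∀ y, R z y ∈ A.domain
  right : ∀ (z : ℂ) (hz : 0 < z.re) (y : X), z • R z y - A ⟨R z y, mem z hz y⟩ = y
  left : ∀ z : ℂ, 0 < z.re → ∀ x : A.domain, R z (z • (x : X) - A x) = x
  bound : ∀ z : ℂ, 0 < z.re → ‖z‖ * ‖R z‖ ≤ M

theorem norm_pos_of_re_pos {z : ℂ} (hz : 0 < z.re) : 0 < ‖z‖ :=
  hz.trans_le (Complex.re_le_norm z)

theorem re_mul_div_add_pos {z w : ℂ} (hz : 0 < z.re) (hw : 0 < w.re) :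
    0 < (z * w / (z + w)).re := by
  have hz0 : z ≠ 0 := norm_pos_iff.1 (norm_pos_of_re_pos hz)
  have hw0 : w ≠ 0 := norm_pos_iff.1 (norm_pos_of_re_pos hw)
  have inv_re_pos {u : ℂ} (hu : 0 < u.re) : 0 < u⁻¹.re := by
    rw [Complex.inv_re]
    exact div_pos hu (Complex.normSq_pos.2 (norm_pos_iff.1 (norm_pos_of_re_pos hu)))
  rw [← inv_div, ← inv_add_inv hz0 hw0]
  exact inv_re_pos (add_pos (inv_re_pos hz) (inv_re_pos hw))

namespace ResolventBound

variable {A B : X →ₗ.[ℂ] X} {M a : ℝ}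

theorem bijective (h : ResolventBound A M) {z : ℂ} (hz : 0 < z.re) :
    Function.Bijective (z • A.domain.subtype - A.toFun) := by
  refine ⟨?_, (h z hz).2⟩
  rw [← LinearMap.ker_eq_bot, LinearMap.ker_eq_bot']
  intro x hx
  have norm_le : ‖z‖ * ‖(x : X)‖ ≤ M * ‖(z • A.domain.subtype - A.toFun) x‖ := (h z hz).1 x
  rw [hx, norm_zero, mul_zero] at norm_le
  have norm_eq : ‖(x : X)‖ = 0 :=
    le_antisymm (nonpos_of_mul_nonpos_right norm_le (norm_pos_of_re_pos hz)) (norm_nonneg _)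
  exact Subtype.ext (norm_eq_zero.1 norm_eq)

theorem exists_inverse (h : ResolventBound A M) (hM : 0 ≤ M) {z : ℂ} (hz : 0 < z.re) :
    ∃ R : X →L[ℂ] X, (∀ y, ∃ x : A.domain, R y = x ∧ z • (x : X) - A x = y) ∧
      (∀ x : A.domain, R (z • (x : X) - A x) = x) ∧ ‖z‖ * ‖R‖ ≤ M := by
  have norm_pos := norm_pos_of_re_pos hz
  let e : A.domain ≃ₗ[ℂ] X := LinearEquiv.ofBijective _ (h.bijective hz)
  have solve (y : X) : z • (e.symm y : X) - A (e.symm y) = y := e.apply_symm_apply y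
  have norm_le (y : X) : ‖(A.domain.subtype ∘ₗ e.symm.toLinearMap) y‖ ≤ M / ‖z‖ * ‖y‖ := by
    rw [div_mul_eq_mul_div, le_div_iff₀' norm_pos]
    exact ((h z hz).1 (e.symm y)).trans_eq (by rw [solve])
  refine ⟨(A.domain.subtype ∘ₗ e.symm.toLinearMap).mkContinuous (M / ‖z‖) norm_le,
    fun y => ⟨e.symm y, rfl, solve y⟩, fun x => congrArg Subtype.val (e.symm_apply_apply x), ?_⟩
  rw [← le_div_iff₀' norm_pos]
  exact LinearMap.mkContinuous_norm_le _ (by positivity) norm_le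

theorem exists_isResolvent (h : ResolventBound A M) (hM : 0 ≤ M) : ∃ R, IsResolvent A R M := by
  classical
  choose R hR using fun (z : ℂ) (hz : 0 < z.re) => h.exists_inverse hM hz
  let S : ℂ → X →L[ℂ] X := fun z => if hz : 0 < z.re then R z hz else 0
  have hS {z : ℂ} (hz : 0 < z.re) : S z = R z hz := dif_pos hz
  have solution (z : ℂ) (hz : 0 < z.re) (y : X) :
      ∃ x : A.domain, S z y = x ∧ z • (x : X) - A x = y := hS hz ▸ (hR z hz).1 y
  refine ⟨S, ⟨fun z hz y => ?_, fun z hz y => ?_, fun z hz => hS hz ▸ (hR z hz).2.1,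
    fun z hz => hS hz ▸ (hR z hz).2.2⟩⟩ <;> obtain ⟨x, hx, hxy⟩ := solution z hz y
  · exact hx ▸ x.2
  · simpa only [hx] using hxy

theorem norm_apply_le (h : ResolventBound A M) {z : ℂ} (hz : 0 < z.re) (x : A.domain) :
    ‖A x‖ ≤ (1 + M) * ‖z • (x : X) - A x‖ :=
  calc ‖A x‖ = ‖z • (x : X) - (z • (x : X) - A x)‖ := by rw [sub_sub_cancel]
    _ ≤ ‖z • (x : X)‖ + ‖z • (x : X) - A x‖ := norm_sub_le _ _
    _ ≤ (1 + M) * ‖z • (x : X) - A x‖ := by linarith [norm_smul z (x : X), (h z hz).1 x]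

theorem norm_perturbation_le (h : ResolventBound A M) (ha : 0 ≤ a) (haM : a * (1 + M) ≤ 1 / 2)
    {z : ℂ} (hz : 0 < z.re) {x : A.domain} {y : X} (hy : ‖y‖ ≤ a * ‖A x‖) :
    ‖y‖ ≤ 1 / 2 * ‖z • (x : X) - A x‖ :=
  calc ‖y‖ ≤ a * ((1 + M) * ‖z • (x : X) - A x‖) := hy.trans (by gcongr; exact h.norm_apply_le hz x)
    _ = a * (1 + M) * ‖z • (x : X) - A x‖ := by ring
    _ ≤ 1 / 2 * ‖z • (x : X) - A x‖ := by gcongr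

end ResolventBound

namespace IsResolvent

variable {A B : X →ₗ.[ℂ] X} {R : ℂ → X →L[ℂ] X} {M : ℝ}

theorem exists_sub_perturbation_eq [CompleteSpace X] (h : IsResolvent A R M)
    (hB : A.domain ≤ B.domain) {z : ℂ} (hz : 0 < z.re)
    (hBz : ∀ x : A.domain, ‖B ⟨x, hB x.2⟩‖ ≤ 1 / 2 * ‖z • (x : X) - A x‖) (y : X) :
    ∃ x : A.domain, z • (x : X) - A x - B ⟨x, hB x.2⟩ = y := by
  let P : X →ₗ[ℂ] X := B.toFun ∘ₗ
    (R z : X →ₗ[ℂ] X).codRestrict B.domain fun u => hB (h.mem z hz u)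
  have norm_P_le (u : X) : ‖P u‖ ≤ 1 / 2 * ‖u‖ :=
    (hBz ⟨R z u, h.mem z hz u⟩).trans_eq (by rw [h.right z hz u])
  let Q : X →L[ℂ] X := P.mkContinuous (1 / 2) norm_P_le
  have norm_Q_lt : ‖Q‖ < 1 :=
    (P.mkContinuous_norm_le (by norm_num) norm_P_le).trans_lt (by norm_num)
  let v : X := (↑(Units.oneSub Q norm_Q_lt)⁻¹ : X →L[ℂ] X) y
  have sub_Q : v - Q v = y :=
    congrArg (fun L : X →L[ℂ] X => L y) (Units.oneSub Q norm_Q_lt).mul_inv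
  exact ⟨⟨R z v, h.mem z hz v⟩, by rw [h.right z hz v]; exact sub_Q⟩

theorem nonneg (h : IsResolvent A R M) : 0 ≤ M :=
  (by positivity : (0 : ℝ) ≤ ‖(1 : ℂ)‖ * ‖R 1‖).trans (h.bound 1 (by simp))

theorem identity (h : IsResolvent A R M) {z w : ℂ} (hz : 0 < z.re) (hw : 0 < w.re) :
    (z - w) • (R z * R w) = R w - R z := by
  ext y
  have solve : z • R w y - A ⟨R w y, h.mem w hw y⟩ = y + (z - w) • R w y :=
    calc _ = (z - w) • R w y + (w • R w y - A ⟨R w y, h.mem w hw y⟩) := by rw [sub_smul]; abel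
      _ = y + (z - w) • R w y := by rw [h.right w hw y, add_comm]
  have inverse := h.left z hz ⟨R w y, h.mem w hw y⟩
  simp only [solve, map_add, map_smul] at inverse
  exact eq_sub_of_add_eq' inverse

theorem commute (h : IsResolvent A R M) {z w : ℂ} (hz : 0 < z.re) (hw : 0 < w.re) :
    Commute (R z) (R w) := by
  rcases eq_or_ne z w with rfl | hne
  · exact Commute.refl _
  refine smul_right_injective _ (sub_ne_zero.2 hne) ?_
  change (z - w) • (R z * R w) = (z - w) • (R w * R z)
  rw [h.identity hz hw, ← neg_sub w z, neg_smul, h.identity hw hz, neg_sub]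

/-- The Yosida approximation `m A R(m) = m (m R(m) - 1)` of the operator with resolvent `R`. -/
def yosida (R : ℂ → X →L[ℂ] X) (m : ℝ) : X →L[ℂ] X :=
  (m : ℂ) • ((m : ℂ) • R m - 1)

theorem commute_resolvent_yosida (h : IsResolvent A R M) {z : ℂ} (hz : 0 < z.re) {m : ℝ}
    (hm : 0 < m) : Commute (R z) (yosida R m) :=
  (((h.commute hz (by simpa)).smul_right _).sub_right (Commute.one_right _)).smul_right _

theorem commute_yosida (h : IsResolvent A R M) {m l : ℝ} (hm : 0 < m) (hl : 0 < l) :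
    Commute (yosida R m) (yosida R l) :=
  (((h.commute_resolvent_yosida (by simpa) hl).smul_left _).sub_left
    (Commute.one_left _)).smul_left _

/-- The resolvent of the Yosida approximation at `l` is, up to the factor `1 / (m + l)`, an affine
function of the resolvent of the operator itself at `m l / (m + l)`. -/
theorem smul_sub_yosida_mul (h : IsResolvent A R M) {m : ℝ} (hm : 0 < m) {l : ℂ} (hl : 0 < l.re) :
    (l • 1 - yosida R m) * (1 + (m ^ 2 / (m + l) : ℂ) • R (m * l / (m + l))) =
      ((m : ℂ) + l) • 1 := by
  have hm_re : 0 < (m : ℂ).re := by simpa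
  have add_ne_zero : (m : ℂ) + l ≠ 0 :=
    norm_pos_iff.1 (norm_pos_of_re_pos (by rw [Complex.add_re]; positivity))
  set μ : ℂ := m * l / (m + l)
  set κ : ℂ := m ^ 2 / (m + l)
  have m_sub_μ : (m : ℂ) - μ = κ := by simp only [μ, κ]; field_simp; ring
  have mul_κ : (m + l) * κ = m ^ 2 := by simp only [κ]; field_simp
  have κ_smul : κ • (R m * R μ) = R μ - R m := by
    rw [← m_sub_μ, h.identity hm_re (re_mul_div_add_pos hm_re hl)]
  have yosida_eq : l • 1 - yosida R m = ((m : ℂ) + l) • (1 : X →L[ℂ] X) - (m ^ 2 : ℂ) • R m := by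
    rw [yosida, smul_sub, smul_smul, add_smul, ← sq]; abel
  calc (l • 1 - yosida R m) * (1 + κ • R μ)
      = ((m : ℂ) + l) • 1 + (((m + l) * κ) • R μ - (m ^ 2 : ℂ) • R m)
          - (m ^ 2 : ℂ) • κ • (R m * R μ) := by
        simp only [yosida_eq, mul_add, sub_mul, smul_mul_assoc, mul_smul_comm, one_mul, mul_one]
        module
    _ = ((m : ℂ) + l) • 1 := by rw [κ_smul, mul_κ, smul_sub, add_sub_cancel_right]

theorem norm_resolvent_yosida_le (h : IsResolvent A R M) {m : ℝ} (hm : 0 < m) {l : ℂ}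
    (hl : 0 < l.re) :
    ‖l‖ * ‖((m : ℂ) + l)⁻¹ • (1 + (m ^ 2 / (m + l) : ℂ) • R (m * l / (m + l)))‖ ≤ 1 + M := by
  have hm_re : 0 < (m : ℂ).re := by simpa
  have hM := h.nonneg
  have norm_pos : 0 < ‖(m : ℂ) + l‖ :=
    norm_pos_of_re_pos (by rw [Complex.add_re]; positivity)
  have l_le : ‖l‖ ≤ ‖(m : ℂ) + l‖ := by
    rw [← sq_le_sq₀ (norm_nonneg _) (norm_nonneg _), Complex.sq_norm, Complex.sq_norm,
      Complex.normSq_apply, Complex.normSq_apply]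
    simp only [Complex.add_re, Complex.add_im, Complex.ofReal_re, Complex.ofReal_im, zero_add]
    nlinarith
  have m_le : m ≤ ‖(m : ℂ) + l‖ := by
    refine le_trans ?_ (Complex.re_le_norm _)
    rw [Complex.add_re, Complex.ofReal_re]
    linarith
  set μ : ℂ := m * l / (m + l)
  set κ : ℂ := m ^ 2 / (m + l)
  have norm_κ : ‖l‖ * ‖κ‖ = m * ‖μ‖ := by
    rw [← norm_mul, show l * κ = m * μ by simp only [κ, μ]; ring, norm_mul, Complex.norm_real,
      Real.norm_of_nonneg hm.le]
  have norm_one_add_le : ‖1 + κ • R μ‖ ≤ 1 + ‖κ‖ * ‖R μ‖ :=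
    (norm_add_le _ _).trans (add_le_add ContinuousLinearMap.norm_id_le (norm_smul _ _).le)
  rw [norm_smul, norm_inv]
  calc ‖l‖ * (‖(m : ℂ) + l‖⁻¹ * ‖1 + κ • R μ‖)
      ≤ ‖l‖ * (‖(m : ℂ) + l‖⁻¹ * (1 + ‖κ‖ * ‖R μ‖)) := by gcongr
    _ = ‖(m : ℂ) + l‖⁻¹ * (‖l‖ + m * (‖μ‖ * ‖R μ‖)) := by rw [← mul_assoc m, ← norm_κ]; ring
    _ ≤ ‖(m : ℂ) + l‖⁻¹ * (‖(m : ℂ) + l‖ + ‖(m : ℂ) + l‖ * M) := by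
        gcongr
        exact h.bound μ (re_mul_div_add_pos hm_re hl)
    _ = 1 + M := by field_simp

theorem halfPlaneBound_yosida (h : IsResolvent A R M) {m : ℝ} (hm : 0 < m) :
    HalfPlaneBound (yosida R m) (1 + M) := by
  intro l hl
  have hm_re : 0 < (m : ℂ).re := by simpa
  have add_ne_zero : (m : ℂ) + l ≠ 0 :=
    norm_pos_iff.1 (norm_pos_of_re_pos (by rw [Complex.add_re]; positivity))
  have right_inverse : (l • 1 - yosida R m) *
      (((m : ℂ) + l)⁻¹ • (1 + (m ^ 2 / (m + l) : ℂ) • R (m * l / (m + l)))) = 1 := by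
    rw [mul_smul_comm, h.smul_sub_yosida_mul hm hl, smul_smul, inv_mul_cancel₀ add_ne_zero,
      one_smul]
  have commute : Commute (l • 1 - yosida R m)
      (((m : ℂ) + l)⁻¹ • (1 + (m ^ 2 / (m + l) : ℂ) • R (m * l / (m + l)))) :=
    ((Commute.one_right _).add_right ((((Commute.one_left _).smul_left l).sub_left
      (h.commute_resolvent_yosida (re_mul_div_add_pos hm_re hl) hm).symm).smul_right
        _)).smul_right _
  exact ⟨_, right_inverse, commute.eq ▸ right_inverse, h.norm_resolvent_yosida_le hm hl⟩

theorem tendsto_smul_resolvent (h : IsResolvent A R M) (hd : Dense (A.domain : Set X)) (y : X) :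
    Tendsto (fun m : ℝ => (m : ℂ) • R m y) atTop (𝓝 y) := by
  have norm_le {m : ℝ} (hm : 0 < m) : ‖R m‖ ≤ M / m := by
    rw [le_div_iff₀' hm]
    simpa [abs_of_pos hm] using h.bound m (by simpa)
  refine tendsto_clm_apply_of_dense (T := fun m : ℝ => (m : ℂ) • R m) (L := .id ℂ X) (C := M)
    ?_ hd (fun x hx => ?_) y
  · filter_upwards [eventually_gt_atTop 0] with m hm
    rw [norm_smul]
    exact h.bound m (by simpa)
  have vanish : Tendsto (fun m : ℝ => R m (A ⟨x, hx⟩)) atTop (𝓝 0) := by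
    refine squeeze_zero_norm' ?_ (a := fun m => M / m * ‖A ⟨x, hx⟩‖) ?_
    · filter_upwards [eventually_gt_atTop 0] with m hm
      exact (R m).le_of_opNorm_le (norm_le hm) _
    · simpa using (tendsto_const_nhds.div_atTop tendsto_id).mul_const ‖A ⟨x, hx⟩‖
  refine Tendsto.congr' ?_ (add_zero x ▸ vanish.const_add x)
  filter_upwards [eventually_gt_atTop 0] with m hm
  have inverse := h.left m (by simpa) ⟨x, hx⟩
  rw [map_sub, map_smul, sub_eq_iff_eq_add] at inverse
  exact inverse.symm

theorem tendsto_yosida (h : IsResolvent A R M) (hd : Dense (A.domain : Set X)) (x : A.domain) :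
    Tendsto (fun m => yosida R m x) atTop (𝓝 (A x)) := by
  refine (h.tendsto_smul_resolvent hd (A x)).congr' ?_
  filter_upwards [eventually_gt_atTop 0] with m hm
  have inverse := h.left m (by simpa) x
  rw [map_sub, map_smul, sub_eq_iff_eq_add'] at inverse
  change (m : ℂ) • R m (A x) = (m : ℂ) • ((m : ℂ) • R m x - x)
  rw [inverse, add_sub_cancel_right]

theorem norm_exp_smul_yosida_le [CompleteSpace X] (h : IsResolvent A R M) {m : ℝ} (hm : 0 < m)
    {z : ℂ} (hz : |z.arg| * (2 * (2 + M)) ≤ 1) :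
    ‖NormedSpace.exp (z • yosida R m)‖ ≤ 1 + 2 * (1 + M) + 6 * (2 * (1 + M)) ^ 2 := by
  have hM := h.nonneg
  have norm_one_le : ‖(1 : X →L[ℂ] X)‖ ≤ 1 := ContinuousLinearMap.norm_id_le
  have rotated : HalfPlaneBound (Complex.exp (z.arg * Complex.I) • yosida R m)
      (2 * ‖(1 : X →L[ℂ] X)‖ * (1 + M)) := by
    refine (h.halfPlaneBound_yosida hm).rotate ?_
    have norm_le : ‖Complex.exp (z.arg * Complex.I) - 1‖ ≤ |z.arg| := by
      rw [mul_comm]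
      exact Real.norm_exp_I_mul_ofReal_sub_one_le
    calc _ ≤ |z.arg| * (1 + (1 + M)) := by gcongr
      _ ≤ 1 / 2 := by linarith
  have norm_exp_le := rotated.norm_exp_le (norm_nonneg z)
  rw [smul_smul, Complex.norm_mul_exp_arg_mul_I] at norm_exp_le
  have constant_le : 2 * ‖(1 : X →L[ℂ] X)‖ * (1 + M) ≤ 2 * (1 + M) := by
    have : ‖(1 : X →L[ℂ] X)‖ * (1 + M) ≤ 1 * (1 + M) := by gcongr
    linarith
  exact norm_exp_le.trans (by gcongr)

theorem exists_sectorialApprox [CompleteSpace X] (h : IsResolvent A R M)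
    (hd : Dense (A.domain : Set X)) :
    ∃ θ C : ℝ, θ < Real.pi / 2 ∧
      SectorialApprox (fun n : ℕ => yosida R (n + 1)) θ C A.domain := by
  have hM := h.nonneg
  have angle_le : 1 / (2 * (2 + M)) ≤ 1 := by
    rw [div_le_one (by positivity)]
    linarith
  refine ⟨1 / (2 * (2 + M)), _, by linarith [Real.pi_gt_three], ⟨by positivity,
    by linarith [Real.pi_gt_three], fun m n => h.commute_yosida (by positivity) (by positivity),
    fun n z hz => h.norm_exp_smul_yosida_le (by positivity) ?_, hd, fun x hx => ⟨_,
      (h.tendsto_yosida hd ⟨x, hx⟩).comp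
        (tendsto_atTop_add_const_right _ 1 tendsto_natCast_atTop_atTop)⟩⟩⟩
  rw [← le_div_iff₀ (by positivity)]
  rcases hz with rfl | ⟨-, arg_gt, arg_lt⟩
  · rw [Complex.arg_zero, abs_zero]
    positivity
  · exact (abs_lt.2 ⟨arg_gt, arg_lt⟩).le

end IsResolvent

namespace ResolventBound

variable {A B : X →ₗ.[ℂ] X} {M a : ℝ}

theorem add [CompleteSpace X] (h : ResolventBound A M) (hM : 0 ≤ M) (hB : A.domain ≤ B.domain)
    (ha : 0 ≤ a) (haM : a * (1 + M) ≤ 1 / 2)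
    (hBA : ∀ x : A.domain, ‖B ⟨x, hB x.2⟩‖ ≤ a * ‖A x‖) : ResolventBound (A + B) (2 * M) := by
  intro z hz
  have perturbation_le (x : A.domain) : ‖B ⟨x, hB x.2⟩‖ ≤ 1 / 2 * ‖z • (x : X) - A x‖ :=
    h.norm_perturbation_le ha haM hz (hBA x)
  have add_apply (x : (A + B).domain) :
      z • (x : X) - (A + B) x = z • (x : X) - A ⟨x, x.2.1⟩ - B ⟨x, x.2.2⟩ := (sub_sub _ _ _).symm
  refine ⟨fun x => ?_, fun y => ?_⟩
  · rw [add_apply]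
    have := norm_sub_norm_le (z • (x : X) - A ⟨x, x.2.1⟩) (B ⟨x, x.2.2⟩)
    have half_le : ‖z • (x : X) - A ⟨x, x.2.1⟩‖ ≤
        2 * ‖z • (x : X) - A ⟨x, x.2.1⟩ - B ⟨x, x.2.2⟩‖ := by
      linarith [perturbation_le ⟨x, x.2.1⟩]
    calc _ ≤ M * ‖z • (x : X) - A ⟨x, x.2.1⟩‖ := (h z hz).1 ⟨x, x.2.1⟩
      _ ≤ M * (2 * ‖z • (x : X) - A ⟨x, x.2.1⟩ - B ⟨x, x.2.2⟩‖) := by gcongr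
      _ = _ := by ring
  · obtain ⟨R, hR⟩ := h.exists_isResolvent hM
    obtain ⟨x, hx⟩ := hR.exists_sub_perturbation_eq hB hz perturbation_le y
    exact ⟨⟨x, x.2, hB x.2⟩, (add_apply _).trans hx⟩

end ResolventBound

section Generator

variable {A : X →ₗ.[ℂ] X} {R : ℂ → X →L[ℂ] X} {M θ C : ℝ} {a : ℕ → X →L[ℂ] X} {D : Set X}

theorem SectorialApprox.commute_limit [CompleteSpace X] (h : SectorialApprox a θ C D)
    {S : X →L[ℂ] X} (hS : ∀ n, Commute S (a n)) {z : ℂ} (hz : z ∈ insert 0 (sector (-θ) θ))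
    (x : X) : S (limit a z x) = limit a z (S x) := by
  refine tendsto_nhds_unique ((S.continuous.tendsto _).comp (h.tendsto_limit hz x))
    ((h.tendsto_limit hz (S x)).congr fun n => ?_)
  have : Commute S (NormedSpace.exp (z • a n)) := ((hS n).smul_right z).exp_right
  exact (congrArg (fun L : X →L[ℂ] X => L x) this.eq).symm

theorem IsResolvent.mem_graph_of_resolvent_apply (h : IsResolvent A R M) {x y : X}
    (hxy : A ⟨R 1 x, h.mem 1 (by simp) x⟩ = R 1 y) : (x, y) ∈ A.graph := by
  have fixed : R 1 (x - y) = x := by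
    simpa only [hxy, one_smul, map_sub] using h.right 1 (by simp) x
  have solve := h.right 1 (by simp) (x - y)
  simp only [fixed, one_smul] at solve
  have mem : x ∈ A.domain := fixed ▸ h.mem 1 (by simp) (x - y)
  exact (LinearPMap.mem_graph_iff A).2 ⟨⟨x, mem⟩, rfl, sub_right_injective solve⟩

theorem IsResolvent.mem_graph_of_tendsto_slope [CompleteSpace X] (h : IsResolvent A R M)
    (hd : Dense (A.domain : Set X))
    (approx : SectorialApprox (fun n : ℕ => IsResolvent.yosida R (n + 1)) θ C A.domain) {x y : X}
    (hxy : Tendsto (fun t : ℝ => (t : ℂ)⁻¹ •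
      (SectorialApprox.limit (fun n : ℕ => IsResolvent.yosida R (n + 1)) t x - x))
      (𝓝[>] 0) (𝓝 y)) : (x, y) ∈ A.graph := by
  have one_re : 0 < (1 : ℂ).re := by simp
  refine h.mem_graph_of_resolvent_apply (tendsto_nhds_unique (approx.tendsto_limit_slope
    ((h.tendsto_yosida hd ⟨R 1 x, h.mem 1 one_re x⟩).comp
      (tendsto_atTop_add_const_right _ 1 tendsto_natCast_atTop_atTop)))
    ((((R 1).continuous.tendsto y).comp hxy).congr' ?_))
  filter_upwards [self_mem_nhdsWithin] with t ht
  have commute := approx.commute_limit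
    (fun n => h.commute_resolvent_yosida one_re (by positivity : (0 : ℝ) < n + 1))
    (Set.mem_insert_of_mem _ (ofReal_mem_sector approx.pos ht)) x
  simp only [Function.comp_apply, map_smul, map_sub, commute]

theorem ResolventBound.generates [CompleteSpace X] (h : ResolventBound A M) (hM : 0 ≤ M)
    (hd : Dense (A.domain : Set X)) : GeneratesBoundedAnalyticSemigroup A := by
  obtain ⟨R, hR⟩ := h.exists_isResolvent hM
  obtain ⟨θ, C, hθ, approx⟩ := hR.exists_sectorialApprox hd
  refine ⟨θ, SectorialApprox.limit fun n : ℕ => IsResolvent.yosida R (n + 1), hθ,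
    approx.isAnalyticSemigroup_limit,
    ⟨C, fun z hz => approx.norm_limit_le (Set.mem_insert_of_mem _ hz)⟩,
    fun x y => ⟨fun hxy => ?_, hR.mem_graph_of_tendsto_slope hd approx⟩⟩
  obtain ⟨u, rfl, rfl⟩ := (LinearPMap.mem_graph_iff A).1 hxy
  exact approx.tendsto_limit_slope ((hR.tendsto_yosida hd u).comp
    (tendsto_atTop_add_const_right _ 1 tendsto_natCast_atTop_atTop))

end Generator

end Generation

/-! ### Classical derivatives on the torus -/

section Partial

theorem integrable_of_continuous {α F : Type*} [TopologicalSpace α] [CompactSpace α]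
    [MeasurableSpace α] [OpensMeasurableSpace α] {μ : Measure α} [IsFiniteMeasureOnCompacts μ]
    [NormedAddCommGroup F] {φ : α → F} (h : Continuous φ) : Integrable φ μ :=
  h.integrable_of_hasCompactSupport (HasCompactSupport.of_compactSpace φ)

variable {E : Type*} [NormedAddCommGroup E] [NormedSpace ℝ E]
  {𝔸 : Type*} [NormedRing 𝔸] [NormedAlgebra ℝ 𝔸] {i : Fin 2}

/-- The translate of `x` by `s` in the `i`-th direction. -/
def shift (i : Fin 2) (x : Torus) (s : ℝ) : Torus :=
  x + Pi.single i (s : AddCircle (2 * Real.pi))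

@[simp]
theorem shift_zero (i : Fin 2) (x : Torus) : shift i x 0 = x := by simp [shift]

theorem shift_shift (i : Fin 2) (x : Torus) (s t : ℝ) :
    shift i (shift i x s) t = shift i x (s + t) := by
  simp only [shift, add_assoc, ← Pi.single_add]
  rfl

theorem continuous_shift (i : Fin 2) (s : ℝ) : Continuous fun x => shift i x s := by
  unfold shift
  fun_prop

theorem shift_cover (i : Fin 2) (v : Fin 2 → ℝ) (s : ℝ) :
    shift i (cover v) s = cover (v + s • Pi.single i 1) := by
  ext j
  rcases eq_or_ne j i with rfl | hj
  · simp [cover, shift]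
  · simp [cover, shift, hj]

/-- `φ'` is the classical partial derivative `∂ᵢ φ`, which exists everywhere. -/
def HasPartial (i : Fin 2) (φ φ' : Torus → E) : Prop :=
  ∀ x, HasDerivAt (fun s : ℝ => φ (shift i x s)) (φ' x) 0

theorem HasPartial.hasDerivAt {φ φ' : Torus → E} (h : HasPartial i φ φ') (x : Torus) (s : ℝ) :
    HasDerivAt (fun s : ℝ => φ (shift i x s)) (φ' (shift i x s)) s := by
  have recentred := HasDerivAt.scomp_of_eq s (h (shift i x s)) ((hasDerivAt_id s).sub_const s)
    (sub_self s).symm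
  rw [one_smul] at recentred
  refine recentred.congr_of_eventuallyEq (Eventually.of_forall fun t => ?_)
  simp [shift_shift]

theorem HasPartial.add {φ φ' ψ ψ' : Torus → E} (h : HasPartial i φ φ') (k : HasPartial i ψ ψ') :
    HasPartial i (fun x => φ x + ψ x) (fun x => φ' x + ψ' x) :=
  fun x => (h x).add (k x)

theorem HasPartial.mul {φ φ' ψ ψ' : Torus → 𝔸} (h : HasPartial i φ φ') (k : HasPartial i ψ ψ') :
    HasPartial i (fun x => φ x * ψ x) (fun x => φ' x * ψ x + φ x * ψ' x) :=
  fun x => ((h x).mul (k x)).congr_deriv (by simp)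

theorem IsSmooth.hasPartial {φ : Torus → E} (h : IsSmooth φ) (i : Fin 2) :
    HasPartial i φ (partialDeriv i φ) := by
  intro x
  obtain ⟨v, rfl⟩ := isOpenQuotientMap_cover.surjective x
  have differentiable : Differentiable ℝ fun w : Fin 2 → ℝ => φ (cover w) :=
    ContDiff.differentiable h (by simp)
  rw [partialDeriv_cover h]
  simp only [shift_cover]
  exact (differentiable v).hasFDerivAt.hasLineDerivAt (Pi.single i 1)

theorem integral_partial_eq_zero {φ φ' : Torus → E} (h : HasPartial i φ φ') (hc : Continuous φ)
    (hc' : Continuous φ') : ∫ x, φ' x = 0 := by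
  obtain ⟨C, hC⟩ := isCompact_univ.exists_bound_of_continuousOn hc'.continuousOn
  have derivative := (hasDerivAt_integral_of_dominated_loc_of_deriv_le (μ := volume) (𝕜 := ℝ)
    (F := fun s x => φ (shift i x s)) (F' := fun s x => φ' (shift i x s)) (x₀ := 0)
    (s := Set.univ) (bound := fun _ => C) univ_mem
    (Eventually.of_forall fun s =>
      (integrable_of_continuous (hc.comp (continuous_shift i s))).aestronglyMeasurable)
    (integrable_of_continuous (hc.comp (continuous_shift i 0)))
    (integrable_of_continuous (hc'.comp (continuous_shift i 0))).aestronglyMeasurable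
    (Eventually.of_forall fun x s _ => hC _ (Set.mem_univ _)) (integrable_const C)
    (Eventually.of_forall fun x s _ => h.hasDerivAt x s)).2
  have translation_invariance : (fun s : ℝ => ∫ x, φ (shift i x s)) = fun _ => ∫ x, φ x :=
    funext fun s => integral_add_right_eq_self φ _
  rw [translation_invariance] at derivative
  simpa using derivative.unique (hasDerivAt_const _ _)

theorem integral_mul_partial {φ φ' ψ ψ' : Torus → 𝔸} (h : HasPartial i φ φ')
    (k : HasPartial i ψ ψ') (hφ : Continuous φ) (hφ' : Continuous φ') (hψ : Continuous ψ)
    (hψ' : Continuous ψ') : ∫ x, φ x * ψ' x = -∫ x, φ' x * ψ x := by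
  have product := integral_partial_eq_zero (h.mul k) (by fun_prop) (by fun_prop)
  rw [integral_add (integrable_of_continuous (by fun_prop))
    (integrable_of_continuous (by fun_prop))] at product
  exact eq_neg_of_add_eq_zero_right product

end Partial

/-! ### Trigonometric polynomials -/

section Trig

/-- The character `x ↦ e^{i k·x}` of the torus. -/
def character (k : Fin 2 → ℤ) : C(Torus, ℂ) where
  toFun x := ∏ j, fourier (k j) (x j)
  continuous_toFun := continuous_finsetProd _ fun _ _ =>
    (ContinuousMap.continuous _).comp (continuous_apply _)

theorem character_apply (k : Fin 2 → ℤ) (x : Torus) :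
    character k x = ∏ j, fourier (k j) (x j) := rfl

theorem character_zero : character 0 = 1 := by
  ext x
  simp [character_apply]

theorem character_add (k l : Fin 2 → ℤ) : character (k + l) = character k * character l := by
  ext x
  simp [character_apply, Finset.prod_mul_distrib, -Fin.prod_univ_two]

theorem star_character (k : Fin 2 → ℤ) : star (character k) = character (-k) := by
  ext x
  simp [character_apply]

theorem character_pi_single (k : Fin 2 → ℤ) (i : Fin 2) (s : AddCircle (2 * Real.pi)) :
    character k (Pi.single i s) = fourier (k i) s := by
  rw [character_apply, Finset.prod_eq_single i]
  · rw [Pi.single_eq_same]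
  · intro j _ hj
    rw [Pi.single_eq_of_ne hj, fourier_eval_zero]
  · simp

theorem character_single_apply (i : Fin 2) (x : Torus) :
    character (Pi.single i 1) x = fourier 1 (x i) := by
  rw [character_apply, Finset.prod_eq_single i]
  · rw [Pi.single_eq_same]
  · intro j _ hj
    rw [Pi.single_eq_of_ne hj, fourier_zero]
  · simp

theorem character_add_apply (k : Fin 2 → ℤ) (x y : Torus) :
    character k (x + y) = character k x * character k y := by
  simp only [character_apply, ← Finset.prod_mul_distrib, fourier_apply, Pi.add_apply, smul_add,
    AddCircle.toCircle_add, Circle.coe_mul]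

theorem character_shift (k : Fin 2 → ℤ) (i : Fin 2) (x : Torus) (s : ℝ) :
    character k (shift i x s) = Complex.exp (Complex.I * k i * s) * character k x := by
  have hpi : (Real.pi : ℂ) ≠ 0 := by exact_mod_cast Real.pi_ne_zero
  rw [shift, character_add_apply, character_pi_single, fourier_coe_apply, mul_comm]
  congr 2
  push_cast
  field_simp

/-- Finitely supported families of Fourier coefficients. -/
abbrev Coeff : Type := (Fin 2 → ℤ) →₀ ℂ

/-- The trigonometric polynomial with given Fourier coefficients. -/
def trigPoly : Coeff →ₗ[ℂ] C(Torus, ℂ) := Finsupp.linearCombination ℂ character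

@[simp]
theorem trigPoly_single (k : Fin 2 → ℤ) (c : ℂ) :
    trigPoly (Finsupp.single k c) = c • character k := by
  simp [trigPoly]

/-- The star algebra of trigonometric polynomials. -/
def trigAlgebra : StarSubalgebra ℂ C(Torus, ℂ) where
  carrier := LinearMap.range trigPoly
  mul_mem' := by
    rintro _ _ ⟨f, rfl⟩ ⟨g, rfl⟩
    induction f using Finsupp.induction_linear with
    | zero => simp
    | add f f' hf hf' => rw [map_add, add_mul]; exact Submodule.add_mem _ hf hf'
    | single k a =>
      induction g using Finsupp.induction_linear with
      | zero => simp
      | add f f' hf hf' => rw [map_add, mul_add]; exact Submodule.add_mem _ hf hf'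
      | single l b =>
        refine ⟨Finsupp.single (k + l) (a * b), ?_⟩
        rw [trigPoly_single, trigPoly_single, trigPoly_single, character_add, smul_mul_smul_comm]
  add_mem' := fun ha hb => Submodule.add_mem _ ha hb
  algebraMap_mem' r := ⟨Finsupp.single 0 r, by
    rw [trigPoly_single, character_zero, Algebra.algebraMap_eq_smul_one]⟩
  star_mem' := by
    rintro _ ⟨f, rfl⟩
    induction f using Finsupp.induction_linear with
    | zero => simp
    | add f f' hf hf' => rw [map_add, star_add]; exact Submodule.add_mem _ hf hf'
    | single k a => exact ⟨Finsupp.single (-k) (star a), by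
        rw [trigPoly_single, trigPoly_single, star_smul, star_character]⟩

theorem denseRange_trigPoly : DenseRange trigPoly := by
  have dense : trigAlgebra.topologicalClosure = ⊤ := by
    refine ContinuousMap.starSubalgebra_topologicalClosure_eq_top_of_separatesPoints _
      fun x y hxy => ?_
    obtain ⟨i, hi⟩ := Function.ne_iff.1 hxy
    refine ⟨_, ⟨character (Pi.single i 1), ⟨Finsupp.single (Pi.single i 1) 1, by simp⟩, rfl⟩, ?_⟩
    simp only [character_single_apply, fourier_one]
    exact fun h => hi (AddCircle.injective_toCircle Real.two_pi_pos.ne' (Subtype.ext h))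
  intro f
  rw [← LinearMap.coe_range]
  exact (dense ▸ trivial : f ∈ trigAlgebra.topologicalClosure)

/-- The Fourier multiplier with symbol `m`. -/
def multiplier {ι : Type*} (m : ι → ℂ) : (ι →₀ ℂ) →ₗ[ℂ] (ι →₀ ℂ) :=
  Finsupp.linearCombination ℂ fun k => Finsupp.single k (m k)

section Multiplier

variable {ι : Type*}

@[simp]
theorem multiplier_single (m : ι → ℂ) (k : ι) (c : ℂ) :
    multiplier m (Finsupp.single k c) = Finsupp.single k (m k * c) := by
  simp [multiplier, mul_comm]

theorem multiplier_apply (m : ι → ℂ) (c : ι →₀ ℂ) (k : ι) : multiplier m c k = m k * c k := by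
  induction c using Finsupp.induction_linear with
  | zero => simp
  | add f g hf hg => simp only [map_add, Finsupp.add_apply, hf, hg, mul_add]
  | single l c =>
    rw [multiplier_single]
    rcases eq_or_ne l k with rfl | hl
    · simp only [Finsupp.single_eq_same]
    · simp only [Finsupp.single_eq_of_ne' hl, mul_zero]

theorem multiplier_comm (m m' : ι → ℂ) (c : ι →₀ ℂ) :
    multiplier m (multiplier m' c) = multiplier m' (multiplier m c) := by
  ext k
  simp only [multiplier_apply, mul_left_comm]

theorem multiplier_const (a : ℂ) (c : ι →₀ ℂ) : multiplier (fun _ => a) c = a • c := by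
  ext k
  simp only [multiplier_apply, Finsupp.smul_apply, smul_eq_mul]

end Multiplier

/-- The symbol `i kⱼ` of the partial derivative `∂ⱼ`. -/
def partialSymbol (j : Fin 2) (k : Fin 2 → ℤ) : ℂ := Complex.I * k j

theorem hasPartial_trigPoly (i : Fin 2) (c : Coeff) :
    HasPartial i (trigPoly c) (trigPoly (multiplier (partialSymbol i) c)) := by
  intro x
  induction c using Finsupp.induction_linear with
  | zero => simpa using hasDerivAt_const (0 : ℝ) (0 : ℂ)
  | add f g hf hg =>
    simp only [map_add]
    exact hf.add hg
  | single k c =>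
    have exponential : HasDerivAt (fun s : ℝ => Complex.exp (Complex.I * k i * s))
        (Complex.I * k i) 0 := by
      simpa using ((Complex.ofRealCLM.hasDerivAt (x := (0 : ℝ))).const_mul (Complex.I * k i)).cexp
    simp only [multiplier_single, trigPoly_single, ContinuousMap.coe_smul, Pi.smul_apply,
      smul_eq_mul, character_shift]
    refine ((exponential.mul_const (character k x)).const_mul c).congr_deriv ?_
    rw [partialSymbol]
    ring

/-- The symbol `-|k|²` of the Laplacian. -/
def laplaceSymbol (k : Fin 2 → ℤ) : ℂ := ∑ i, partialSymbol i k * partialSymbol i k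

/-- The squared length `|k|²` of a frequency. -/
def freqSq (k : Fin 2 → ℤ) : ℝ := ∑ i, (k i : ℝ) ^ 2

theorem laplaceSymbol_eq (k : Fin 2 → ℤ) : laplaceSymbol k = -(freqSq k : ℂ) := by
  simp only [laplaceSymbol, partialSymbol, freqSq, Fin.sum_univ_two]
  push_cast
  linear_combination ((k 0 : ℂ) ^ 2 + (k 1 : ℂ) ^ 2) * Complex.I_mul_I

theorem multiplier_laplaceSymbol (c : Coeff) : multiplier laplaceSymbol c =
    ∑ i, multiplier (partialSymbol i) (multiplier (partialSymbol i) c) := by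
  ext k
  simp only [Finsupp.finsetSum_apply, multiplier_apply, laplaceSymbol, Finset.sum_mul, mul_assoc]

end Trig

section Lp

variable {p : ℝ≥0∞} [Fact (1 ≤ p)]

variable (p) in
/-- The class of a trigonometric polynomial in `L^p`. -/
def trigLp : Coeff →ₗ[ℂ] LpT p :=
  (ContinuousMap.toLp p volume ℂ).toLinearMap ∘ₗ trigPoly

theorem coeFn_trigLp (c : Coeff) : trigLp p c =ᵐ[volume] trigPoly c :=
  ContinuousMap.coeFn_toLp volume (trigPoly c)

theorem denseRange_trigLp (hp : p ≠ ⊤) : DenseRange (trigLp p) :=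
  (ContinuousMap.toLp_denseRange ℂ volume ℂ hp).comp denseRange_trigPoly
    (ContinuousMap.toLp p volume ℂ).continuous

theorem norm_trigLp_rpow (hp : p ≠ ⊤) (c : Coeff) :
    ‖trigLp p c‖ ^ p.toReal = ∫ x, ‖trigPoly c x‖ ^ p.toReal := by
  have hp0 : p ≠ 0 := (zero_lt_one.trans_le (Fact.out : 1 ≤ p)).ne'
  rw [Lp.norm_def, (Lp.memLp (trigLp p c)).eLpNorm_eq_integral_rpow_norm hp0 hp,
    ENNReal.toReal_ofReal (by positivity), ← Real.rpow_mul (by positivity),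
    inv_mul_cancel₀ (ENNReal.toReal_pos hp0 hp).ne', Real.rpow_one]
  refine integral_congr_ae ?_
  filter_upwards [coeFn_trigLp (p := p) c] with x hx
  rw [hx]

theorem integral_trigLp_mul (c : Coeff) (φ : Torus → ℂ) :
    ∫ x, trigLp p c x * φ x = ∫ x, trigPoly c x * φ x := by
  refine integral_congr_ae ?_
  filter_upwards [coeFn_trigLp (p := p) c] with x hx
  rw [hx]

theorem isWeakPartial_trigLp (i : Fin 2) (c : Coeff) :
    IsWeakPartial i (trigLp p c) (trigLp p (multiplier (partialSymbol i) c)) := by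
  intro φ hφ
  rw [integral_trigLp_mul, integral_trigLp_mul]
  exact integral_mul_partial (hasPartial_trigPoly i c) (hφ.hasPartial i) (trigPoly c).continuous
    (trigPoly _).continuous hφ.continuous (hφ.continuous_partialDeriv i)

theorem continuous_integral_mul {φ : Torus → ℂ} (hφ : Continuous φ) :
    Continuous fun f : LpT p => ∫ x, f x * φ x := by
  have : ENNReal.HolderConjugate p p.conjExponent := .conjExponent Fact.out
  have : Fact (1 ≤ p.conjExponent) := ⟨ENNReal.HolderConjugate.one_le p.conjExponent p⟩
  let φLp : LpT p.conjExponent := ContinuousMap.toLp p.conjExponent volume ℂ ⟨φ, hφ⟩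
  let pairing : LpT p →L[ℂ] LpT p.conjExponent →L[ℂ] ℂ :=
    (ContinuousLinearMap.mul ℂ ℂ).lpPairing volume p p.conjExponent
  have pairing_eq (f : LpT p) : pairing f φLp = ∫ x, f x * φ x := by
    rw [ContinuousLinearMap.lpPairing_eq_integral]
    refine integral_congr_ae ?_
    filter_upwards [ContinuousMap.coeFn_toLp (p := p.conjExponent) (𝕜 := ℂ) volume ⟨φ, hφ⟩]
      with x hx
    rw [ContinuousLinearMap.mul_apply', hx, ContinuousMap.coe_mk]
  exact (pairing.flip φLp).continuous.congr pairing_eq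

end Lp

/-! ### The resolvent estimate for the Laplacian -/

section Resolvent

/-- `w` lies in the closed sector `{|Im w| ≤ r Re w}` around the positive real axis. -/
structure IsSectorial (r : ℝ) (w : ℂ) : Prop where
  re_nonneg : 0 ≤ w.re
  abs_im_le : |w.im| ≤ r * w.re

theorem IsSectorial.sum {ι : Type*} {s : Finset ι} {r : ℝ} {w : ι → ℂ}
    (h : ∀ i ∈ s, IsSectorial r (w i)) : IsSectorial r (∑ i ∈ s, w i) where
  re_nonneg := by
    rw [Complex.re_sum]
    exact Finset.sum_nonneg fun i hi => (h i hi).re_nonneg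
  abs_im_le := by
    rw [Complex.re_sum, Complex.im_sum, Finset.mul_sum]
    exact (Finset.abs_sum_le_sum_abs _ _).trans
      (Finset.sum_le_sum fun i hi => (h i hi).abs_im_le)

theorem IsSectorial.integral {α : Type*} [MeasurableSpace α] {μ : Measure α} {r : ℝ} {w : α → ℂ}
    (hw : Integrable w μ) (h : ∀ x, IsSectorial r (w x)) : IsSectorial r (∫ x, w x ∂μ) where
  re_nonneg := by
    rw [show (∫ x, w x ∂μ).re = ∫ x, (w x).re ∂μ from (integral_re hw).symm]
    exact integral_nonneg fun x => (h x).re_nonneg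
  abs_im_le := by
    rw [show (∫ x, w x ∂μ).re = ∫ x, (w x).re ∂μ from (integral_re hw).symm,
      show (∫ x, w x ∂μ).im = ∫ x, (w x).im ∂μ from (integral_im hw).symm, ← integral_const_mul]
    exact abs_integral_le_integral_abs.trans
      (integral_mono hw.im.abs (hw.re.const_mul r) fun x => (h x).abs_im_le)

theorem IsSectorial.norm_mul_le {z Q F : ℂ} {N r : ℝ} (hQ : IsSectorial r Q) (hr : 0 ≤ r)
    (hz : 0 ≤ z.re) (hN : 0 ≤ N) (h : z * N + Q = F) :
    ‖z‖ * N ≤ Real.sqrt (1 + (r + 1) ^ 2) * ‖F‖ := by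
  have re_eq : z.re * N + Q.re = F.re := by rw [← h]; simp
  have im_eq : z.im * N + Q.im = F.im := by rw [← h]; simp
  have re_nonneg : 0 ≤ z.re * N := mul_nonneg hz hN
  have re_sq_le : (z.re * N) ^ 2 ≤ F.re ^ 2 := by
    gcongr
    linarith [hQ.re_nonneg]
  have im_sq_le : (z.im * N) ^ 2 ≤ (|F.im| + r * F.re) ^ 2 := by
    have abs_le : |z.im * N| ≤ |F.im| + r * F.re := by
      rw [show z.im * N = F.im - Q.im by linarith]
      refine (abs_sub _ _).trans ?_
      nlinarith [hQ.abs_im_le]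
    rw [← sq_abs]
    gcongr
  have sq_le : (‖z‖ * N) ^ 2 ≤ (1 + (r + 1) ^ 2) * ‖F‖ ^ 2 := by
    rw [mul_pow, ← Complex.normSq_eq_norm_sq, ← Complex.normSq_eq_norm_sq, Complex.normSq_apply,
      Complex.normSq_apply, ← abs_mul_abs_self F.im]
    nlinarith [sq_nonneg (r * |F.im| - F.re), mul_nonneg hr (sq_nonneg F.re),
      mul_nonneg hr (sq_nonneg |F.im|), sq_nonneg |F.im|]
  have sqrt_le := Real.sqrt_le_sqrt sq_le
  rwa [Real.sqrt_sq (by positivity), Real.sqrt_mul (by positivity),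
    Real.sqrt_sq (norm_nonneg _)] at sqrt_le

/-- Here `ρ` stands for `|u|² + ε` and `2 r Re (ū u') ρ^(r-1) ū + ρ^r ū'` is the derivative of
`ρ^r ū`. -/
theorem isSectorial_deriv_mul {u u' : ℂ} {ρ r : ℝ} (hr : 0 ≤ r) (hρ : 0 < ρ)
    (hu : ‖u‖ ^ 2 ≤ ρ) :
    IsSectorial r ((((2 * (starRingEnd ℂ u * u').re * r * ρ ^ (r - 1) : ℝ) : ℂ) * starRingEnd ℂ u +
      ((ρ ^ r : ℝ) : ℂ) * starRingEnd ℂ u') * u') := by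
  set ζ := starRingEnd ℂ u * u' with hζ
  have form_eq : (((2 * ζ.re * r * ρ ^ (r - 1) : ℝ) : ℂ) * starRingEnd ℂ u +
      ((ρ ^ r : ℝ) : ℂ) * starRingEnd ℂ u') * u' =
      ((2 * r * ρ ^ (r - 1) * ζ.re : ℝ) : ℂ) * ζ + ((ρ ^ r * ‖u'‖ ^ 2 : ℝ) : ℂ) := by
    push_cast
    linear_combination ((ρ ^ r : ℝ) : ℂ) * Complex.conj_mul' u' +
      2 * (ζ.re : ℂ) * r * ((ρ ^ (r - 1) : ℝ) : ℂ) * hζ.symm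
  rw [form_eq]
  have rpow_eq : ρ ^ r = ρ ^ (r - 1) * ρ := by
    rw [← Real.rpow_add_one hρ.ne', sub_add_cancel]
  have normSq_le : ζ.re ^ 2 + ζ.im ^ 2 ≤ ρ * ‖u'‖ ^ 2 := by
    calc ζ.re ^ 2 + ζ.im ^ 2 = ‖ζ‖ ^ 2 := by
          rw [← Complex.normSq_eq_norm_sq, Complex.normSq_apply, sq, sq]
      _ = ‖u‖ ^ 2 * ‖u'‖ ^ 2 := by rw [hζ, norm_mul, RCLike.norm_conj, mul_pow]
      _ ≤ ρ * ‖u'‖ ^ 2 := by gcongr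
  have abs_mul_le : |ζ.re * ζ.im| ≤ ρ * ‖u'‖ ^ 2 / 2 := by
    rw [abs_le]
    constructor <;> nlinarith [sq_nonneg (ζ.re + ζ.im), sq_nonneg (ζ.re - ζ.im)]
  constructor
  · rw [Complex.add_re, Complex.re_ofReal_mul, Complex.ofReal_re, mul_assoc _ ζ.re]
    have := mul_self_nonneg ζ.re
    positivity
  · rw [Complex.add_re, Complex.add_im, Complex.re_ofReal_mul, Complex.im_ofReal_mul,
      Complex.ofReal_re, Complex.ofReal_im, add_zero, mul_assoc _ ζ.re, mul_assoc _ ζ.re, abs_mul,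
      abs_of_nonneg (by positivity : 0 ≤ 2 * r * ρ ^ (r - 1))]
    calc 2 * r * ρ ^ (r - 1) * |ζ.re * ζ.im| ≤ 2 * r * ρ ^ (r - 1) * (ρ * ‖u'‖ ^ 2 / 2) := by
          gcongr
      _ = r * (0 + ρ ^ r * ‖u'‖ ^ 2) := by rw [rpow_eq]; ring
      _ ≤ r * (2 * r * ρ ^ (r - 1) * (ζ.re * ζ.re) + ρ ^ r * ‖u'‖ ^ 2) := by
          have := mul_self_nonneg ζ.re
          gcongr
          positivity

section HasPartial

variable {i : Fin 2}

theorem HasPartial.normSq_add {u u' : Torus → ℂ} (h : HasPartial i u u') (ε : ℝ) :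
    HasPartial i (fun x => ‖u x‖ ^ 2 + ε) (fun x => 2 * (starRingEnd ℂ (u x) * u' x).re) := by
  refine fun x => ((h x).norm_sq.add_const ε).congr_deriv ?_
  simp only [shift_zero, Complex.inner, mul_comm]

theorem HasPartial.rpow_const {φ φ' : Torus → ℝ} (h : HasPartial i φ φ') (h0 : ∀ x, 0 < φ x)
    (r : ℝ) : HasPartial i (fun x => φ x ^ r) (fun x => φ' x * r * φ x ^ (r - 1)) := by
  intro x
  simpa using (h x).rpow_const (p := r) (Or.inl (h0 _).ne')

theorem HasPartial.ofReal {φ φ' : Torus → ℝ} (h : HasPartial i φ φ') :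
    HasPartial i (fun x => (φ x : ℂ)) (fun x => (φ' x : ℂ)) :=
  fun x => (h x).ofReal_comp

theorem HasPartial.conj {φ φ' : Torus → ℂ} (h : HasPartial i φ φ') :
    HasPartial i (fun x => starRingEnd ℂ (φ x)) (fun x => starRingEnd ℂ (φ' x)) :=
  fun x => (Complex.conjCLE : ℂ →L[ℝ] ℂ).hasFDerivAt.comp_hasDerivAt _ (h x)

end HasPartial

/-- The test function `(|u|² + ε)^r ū`, a regularization of the duality map of `L^(2 r + 2)`. -/
def dualityMap (r ε : ℝ) (u : Torus → ℂ) (x : Torus) : ℂ :=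
  (((‖u x‖ ^ 2 + ε) ^ r : ℝ) : ℂ) * starRingEnd ℂ (u x)

/-- The derivative of `dualityMap r ε u` in a direction in which `u` has derivative `u'`. -/
def dualityMapDeriv (r ε : ℝ) (u u' : Torus → ℂ) (x : Torus) : ℂ :=
  ((2 * (starRingEnd ℂ (u x) * u' x).re * r * (‖u x‖ ^ 2 + ε) ^ (r - 1) : ℝ) : ℂ) *
    starRingEnd ℂ (u x) + (((‖u x‖ ^ 2 + ε) ^ r : ℝ) : ℂ) * starRingEnd ℂ (u' x)

section DualityMap

variable {u v : Torus → ℂ} {r ε : ℝ}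

theorem hasPartial_dualityMap {i : Fin 2} (h : HasPartial i u v) (r : ℝ) (hε : 0 < ε) :
    HasPartial i (dualityMap r ε u) (dualityMapDeriv r ε u v) :=
  (((h.normSq_add ε).rpow_const (fun _ => by positivity) r).ofReal).mul h.conj

theorem continuous_normSq_add_rpow (hu : Continuous u) (r : ℝ) (hε : 0 < ε) :
    Continuous fun x => (‖u x‖ ^ 2 + ε) ^ r :=
  Continuous.rpow_const (by fun_prop) fun _ => Or.inl (by positivity)

theorem continuous_dualityMap (hu : Continuous u) (r : ℝ) (hε : 0 < ε) :
    Continuous (dualityMap r ε u) := by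
  have := continuous_normSq_add_rpow hu r hε
  unfold dualityMap
  fun_prop

theorem continuous_dualityMapDeriv (hu : Continuous u) (hv : Continuous v) (r : ℝ) (hε : 0 < ε) :
    Continuous (dualityMapDeriv r ε u v) := by
  have := continuous_normSq_add_rpow hu r hε
  have := continuous_normSq_add_rpow hu (r - 1) hε
  unfold dualityMapDeriv
  fun_prop

theorem dualityMap_mul_self (x : Torus) :
    dualityMap r ε u x * u x = (((‖u x‖ ^ 2 + ε) ^ r * ‖u x‖ ^ 2 : ℝ) : ℂ) := by
  rw [dualityMap, mul_assoc, Complex.conj_mul']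
  push_cast
  rfl

theorem norm_dualityMap (hε : 0 < ε) (x : Torus) :
    ‖dualityMap r ε u x‖ = (‖u x‖ ^ 2 + ε) ^ r * ‖u x‖ := by
  rw [dualityMap, norm_mul, RCLike.norm_conj, Complex.norm_real,
    Real.norm_of_nonneg (by positivity)]

end DualityMap

section Laplacian

variable {u : Torus → ℂ} {u' u'' : Fin 2 → Torus → ℂ} {z : ℂ} {r ε : ℝ}

theorem isSectorial_sum_integral_dualityMapDeriv (hu : Continuous u)
    (hu' : ∀ i, Continuous (u' i)) (hr : 0 ≤ r) (hε : 0 < ε) :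
    IsSectorial r (∑ i, ∫ x, dualityMapDeriv r ε u (u' i) x * u' i x) :=
  IsSectorial.sum fun i _ => IsSectorial.integral
    (integrable_of_continuous ((continuous_dualityMapDeriv hu (hu' i) r hε).mul (hu' i)))
    fun _ => isSectorial_deriv_mul hr (by positivity) (by linarith)

variable (h : ∀ i, HasPartial i u (u' i)) (h' : ∀ i, HasPartial i (u' i) (u'' i))
  (hu : Continuous u) (hu' : ∀ i, Continuous (u' i)) (hu'' : ∀ i, Continuous (u'' i))

include h h' hu hu' hu''

theorem integral_dualityMap_mul_laplacian (r : ℝ) (hε : 0 < ε) :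
    ∫ x, dualityMap r ε u x * ∑ i, u'' i x =
      -∑ i, ∫ x, dualityMapDeriv r ε u (u' i) x * u' i x := by
  have hψ := continuous_dualityMap hu r hε
  have by_parts (i : Fin 2) : ∫ x, dualityMap r ε u x * u'' i x =
      -∫ x, dualityMapDeriv r ε u (u' i) x * u' i x :=
    integral_mul_partial (hasPartial_dualityMap (h i) r hε) (h' i) hψ
      (continuous_dualityMapDeriv hu (hu' i) r hε) (hu' i) (hu'' i)
  simp only [Finset.mul_sum]
  rw [integral_finsetSum _ fun i _ => integrable_of_continuous (by fun_prop)]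
  simp only [by_parts, Finset.sum_neg_distrib]

theorem integral_dualityMap_mul_resolvent (z : ℂ) (r : ℝ) (hε : 0 < ε) :
    z * (∫ x, (‖u x‖ ^ 2 + ε) ^ r * ‖u x‖ ^ 2 : ℝ) +
        ∑ i, ∫ x, dualityMapDeriv r ε u (u' i) x * u' i x =
      ∫ x, dualityMap r ε u x * (z * u x - ∑ i, u'' i x) := by
  have hψ := continuous_dualityMap hu r hε
  have zeroth_order : ∫ x, dualityMap r ε u x * (z * u x) =
      z * (∫ x, (‖u x‖ ^ 2 + ε) ^ r * ‖u x‖ ^ 2 : ℝ) := by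
    rw [← integral_complex_ofReal, ← integral_const_mul]
    simp only [← dualityMap_mul_self, mul_left_comm]
  simp only [mul_sub]
  rw [integral_sub (integrable_of_continuous (by fun_prop))
      (integrable_of_continuous (by fun_prop)), zeroth_order,
    integral_dualityMap_mul_laplacian h h' hu hu' hu'' r hε, sub_neg_eq_add]

theorem regularized_resolvent_estimate (hz : 0 ≤ z.re) (hr : 0 ≤ r) (hε : 0 < ε) :
    ‖z‖ * ∫ x, (‖u x‖ ^ 2 + ε) ^ r * ‖u x‖ ^ 2 ≤ Real.sqrt (1 + (r + 1) ^ 2) *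
      ∫ x, (‖u x‖ ^ 2 + ε) ^ r * ‖u x‖ * ‖z * u x - ∑ i, u'' i x‖ := by
  refine ((isSectorial_sum_integral_dualityMapDeriv hu hu' hr hε).norm_mul_le hr hz
    (integral_nonneg fun _ => by positivity)
    (integral_dualityMap_mul_resolvent h h' hu hu' hu'' z r hε)).trans ?_
  gcongr
  refine (norm_integral_le_integral_norm _).trans_eq ?_
  simp only [norm_mul, norm_dualityMap hε]

theorem resolvent_estimate_rpow_mul (hz : 0 ≤ z.re) (hr : 0 ≤ r) :
    ‖z‖ * ∫ x, (‖u x‖ ^ 2) ^ r * ‖u x‖ ^ 2 ≤ Real.sqrt (1 + (r + 1) ^ 2) *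
      ∫ x, (‖u x‖ ^ 2) ^ r * ‖u x‖ * ‖z * u x - ∑ i, u'' i x‖ := by
  -- `|ε|` makes the regularization continuous in `ε` on the whole line.
  have tendsto_integral {g : Torus → ℝ} (hg : Continuous g) :
      Tendsto (fun ε : ℝ => ∫ x, (‖u x‖ ^ 2 + |ε|) ^ r * g x) (𝓝[>] 0)
        (𝓝 (∫ x, (‖u x‖ ^ 2) ^ r * g x)) := by
    have weight : Continuous fun q : ℝ × Torus => (‖u q.2‖ ^ 2 + |q.1|) ^ r :=
      Continuous.rpow_const (by fun_prop) fun _ => Or.inr hr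
    have jointly : Continuous (Function.uncurry fun (ε : ℝ) (x : Torus) =>
        (‖u x‖ ^ 2 + |ε|) ^ r * g x) := weight.mul (hg.comp continuous_snd)
    have continuous_integral := continuous_parametric_integral_of_continuous
      (μ := (volume : Measure Torus)) jointly isCompact_univ
    simp only [setIntegral_univ] at continuous_integral
    simpa using (continuous_integral.tendsto 0).mono_left (nhdsWithin_le_nhds (s := Set.Ioi 0))
  have lhs := tendsto_integral (g := fun x => ‖u x‖ ^ 2) (by fun_prop)
  have rhs := tendsto_integral (g := fun x => ‖u x‖ * ‖z * u x - ∑ i, u'' i x‖) (by fun_prop)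
  simp only [← mul_assoc] at rhs
  refine le_of_tendsto_of_tendsto (lhs.const_mul _) (rhs.const_mul _) ?_
  filter_upwards [self_mem_nhdsWithin] with ε hε
  rw [abs_of_pos hε]
  exact regularized_resolvent_estimate h h' hu hu' hu'' hz hr hε

theorem resolvent_estimate_integral (hz : 0 ≤ z.re) {P : ℝ} (hP : 2 ≤ P) :
    ‖z‖ * ∫ x, ‖u x‖ ^ P ≤ Real.sqrt (1 + P ^ 2 / 4) *
      ∫ x, ‖z * u x - ∑ i, u'' i x‖ * ‖u x‖ ^ (P - 1) := by
  have rpow_half (t : ℝ) (ht : 0 ≤ t) : (t ^ 2) ^ ((P - 2) / 2) = t ^ (P - 2) := by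
    rw [← Real.rpow_natCast, ← Real.rpow_mul ht]
    congr 1
    push_cast
    ring
  have rpow_mul_sq (t : ℝ) (ht : 0 ≤ t) : (t ^ 2) ^ ((P - 2) / 2) * t ^ 2 = t ^ P := by
    rw [rpow_half t ht, ← Real.rpow_natCast, ← Real.rpow_add_of_nonneg ht (by linarith) (by simp)]
    congr 1
    push_cast
    ring
  have rpow_mul_self (t : ℝ) (ht : 0 ≤ t) : (t ^ 2) ^ ((P - 2) / 2) * t = t ^ (P - 1) := by
    rw [rpow_half t ht, ← Real.rpow_add_one' ht (by linarith)]
    congr 1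
    ring
  have estimate := resolvent_estimate_rpow_mul h h' hu hu' hu'' hz
    (r := (P - 2) / 2) (by linarith)
  simp only [rpow_mul_sq _ (norm_nonneg _), rpow_mul_self _ (norm_nonneg _)] at estimate
  rw [show 1 + P ^ 2 / 4 = 1 + ((P - 2) / 2 + 1) ^ 2 by ring]
  simpa only [mul_comm] using estimate

end Laplacian

/-- Hölder's inequality for `‖f‖_P ‖u^(P-1)‖_P'`. -/
theorem integral_mul_rpow_le {α E F : Type*} [TopologicalSpace α] [CompactSpace α]
    [MeasurableSpace α] [OpensMeasurableSpace α] {μ : Measure α} [IsFiniteMeasureOnCompacts μ]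
    [NormedAddCommGroup E] [NormedAddCommGroup F] {f : α → E} {u : α → F} (hf : Continuous f)
    (hu : Continuous u) {P : ℝ} (hP : 1 < P) :
    ∫ x, ‖f x‖ * ‖u x‖ ^ (P - 1) ∂μ ≤
      (∫ x, ‖f x‖ ^ P ∂μ) ^ (1 / P) * (∫ x, ‖u x‖ ^ P ∂μ) ^ (1 - 1 / P) := by
  have memLp {g : α → ℝ} (hg : Continuous g) (s : ℝ≥0∞) : MemLp g s μ :=
    hg.memLp_of_hasCompactSupport (HasCompactSupport.of_compactSpace g)
  have hu_rpow : Continuous fun x => ‖u x‖ ^ (P - 1) :=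
    hu.norm.rpow_const fun _ => Or.inr (by linarith)
  have holder := integral_mul_le_Lp_mul_Lq_of_nonneg (μ := μ) (.conjExponent hP)
    (f := fun x => ‖f x‖) (g := fun x => ‖u x‖ ^ (P - 1))
    (Eventually.of_forall fun x => norm_nonneg _)
    (Eventually.of_forall fun x => by positivity) (memLp hf.norm _) (memLp hu_rpow _)
  have hP0 : P ≠ 0 := by linarith
  have hP1 : P - 1 ≠ 0 := by linarith
  have rpow_rpow (x : α) : (‖u x‖ ^ (P - 1)) ^ (P / (P - 1)) = ‖u x‖ ^ P := by
    rw [← Real.rpow_mul (norm_nonneg _), mul_div_cancel₀ _ hP1]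
  have exponent : 1 / (P / (P - 1)) = 1 - 1 / P := by
    rw [one_div_div, sub_div, div_self hP0]
  simpa only [Real.conjExponent, rpow_rpow, exponent] using holder

section Lp

variable {p : ℝ≥0∞} [Fact (1 ≤ p)]

theorem integral_trigPoly_mul_rpow_le (hp1 : 1 < p) (hp : p ≠ ⊤) (c d : Coeff) :
    ∫ x, ‖trigPoly d x‖ * ‖trigPoly c x‖ ^ (p.toReal - 1) ≤
      ‖trigLp p d‖ * ‖trigLp p c‖ ^ (p.toReal - 1) := by
  have hP : 1 < p.toReal := by simpa using ENNReal.toReal_strict_mono hp hp1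
  have holder := integral_mul_rpow_le (μ := volume) (trigPoly d).continuous
    (trigPoly c).continuous hP
  rwa [← norm_trigLp_rpow hp, ← norm_trigLp_rpow hp, ← Real.rpow_mul (norm_nonneg _),
    ← Real.rpow_mul (norm_nonneg _), mul_one_div_cancel (by linarith), Real.rpow_one,
    mul_sub, mul_one, mul_one_div_cancel (by linarith)] at holder

theorem resolvent_estimate_trigLp (hp2 : 2 ≤ p) (hp : p ≠ ⊤) {z : ℂ} (hz : 0 ≤ z.re)
    (c : Coeff) : ‖z‖ * ‖trigLp p c‖ ≤
      resolventConst p * ‖trigLp p (z • c - multiplier laplaceSymbol c)‖ := by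
  have hP : 2 ≤ p.toReal := by simpa using ENNReal.toReal_mono hp hp2
  set d := z • c - multiplier laplaceSymbol c with hd
  have trigPoly_d (x : Torus) : trigPoly d x = z * trigPoly c x -
      ∑ i, trigPoly (multiplier (partialSymbol i) (multiplier (partialSymbol i) c)) x := by
    rw [hd, map_sub, map_smul, multiplier_laplaceSymbol, map_sum, ContinuousMap.sub_apply,
      ContinuousMap.sum_apply]
    rfl
  have estimate := resolvent_estimate_integral (fun i => hasPartial_trigPoly i c)
    (fun i => hasPartial_trigPoly i _) (trigPoly c).continuous
    (fun i => (trigPoly _).continuous) (fun i => (trigPoly _).continuous) hz hP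
  simp only [← trigPoly_d, ← norm_trigLp_rpow hp] at estimate
  rcases (norm_nonneg (trigLp p c)).eq_or_lt with h0 | h0
  · rw [← h0, mul_zero]
    exact mul_nonneg (Real.sqrt_nonneg _) (norm_nonneg _)
  refine le_of_mul_le_mul_right ?_ (Real.rpow_pos_of_pos h0 (p.toReal - 1))
  calc ‖z‖ * ‖trigLp p c‖ * ‖trigLp p c‖ ^ (p.toReal - 1)
      = ‖z‖ * ‖trigLp p c‖ ^ p.toReal := by
        rw [mul_assoc, ← Real.rpow_one_add' h0.le (by linarith), add_sub_cancel]
    _ ≤ resolventConst p * ∫ x, ‖trigPoly d x‖ * ‖trigPoly c x‖ ^ (p.toReal - 1) := estimate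
    _ ≤ resolventConst p * (‖trigLp p d‖ * ‖trigLp p c‖ ^ (p.toReal - 1)) := by
        refine mul_le_mul_of_nonneg_left ?_ (Real.sqrt_nonneg _)
        exact integral_trigPoly_mul_rpow_le (ENNReal.one_lt_two.trans_le hp2) hp c d
    _ = resolventConst p * ‖trigLp p d‖ * ‖trigLp p c‖ ^ (p.toReal - 1) := by ring

end Lp

end Resolvent

/-! ### Functions of time and space, and the heat operator -/

section Jets

theorem hasDerivAt_integral_of_continuous {α E : Type*} [TopologicalSpace α] [CompactSpace α]
    [SecondCountableTopology α] [MeasurableSpace α] [OpensMeasurableSpace α] {μ : Measure α}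
    [IsFiniteMeasure μ] [NormedAddCommGroup E] [NormedSpace ℝ E] {φ φ' : ℝ → α → E}
    (h : ∀ t x, HasDerivAt (fun s => φ s x) (φ' t x) t) (hφ : ∀ t, Continuous (φ t))
    (hφ' : Continuous (Function.uncurry φ')) (t : ℝ) :
    HasDerivAt (fun s => ∫ x, φ s x ∂μ) (∫ x, φ' t x ∂μ) t := by
  obtain ⟨C, hC⟩ := ((isCompact_Icc (a := t - 1) (b := t + 1)).prod
    (isCompact_univ (X := α))).exists_bound_of_continuousOn hφ'.continuousOn
  exact (hasDerivAt_integral_of_dominated_loc_of_deriv_le (μ := μ) (𝕜 := ℝ)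
    (F := φ) (F' := φ') (s := Set.Icc (t - 1) (t + 1)) (bound := fun _ => C)
    (Icc_mem_nhds (by linarith) (by linarith))
    (Eventually.of_forall fun s => (integrable_of_continuous (hφ s)).aestronglyMeasurable)
    (integrable_of_continuous (hφ t))
    (integrable_of_continuous (hφ'.uncurry_left t)).aestronglyMeasurable
    (Eventually.of_forall fun x s hs => hC (s, x) ⟨hs, Set.mem_univ _⟩)
    (integrable_const C) (Eventually.of_forall fun x s _ => h s x)).2

/-- A real function of time and space, together with its derivatives `∂ₜ`, `∂ᵢ` and `∂ᵢ²`, all of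
them continuous. Carrying the derivatives along makes the chain rule for the heat operator an
algebraic identity. -/
structure ParabolicJet where
  val : ℝ → Torus → ℝ
  dt : ℝ → Torus → ℝ
  dx : Fin 2 → ℝ → Torus → ℝ
  dxx : Fin 2 → ℝ → Torus → ℝ
  hasDt : ∀ t x, HasDerivAt (fun s => val s x) (dt t x) t
  hasDx : ∀ i t, HasPartial i (val t) (dx i t)
  hasDxx : ∀ i t, HasPartial i (dx i t) (dxx i t)
  cont : Continuous (Function.uncurry val)
  cont_dt : Continuous (Function.uncurry dt)
  cont_dx : ∀ i, Continuous (Function.uncurry (dx i))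
  cont_dxx : ∀ i, Continuous (Function.uncurry (dxx i))

namespace ParabolicJet

/-- The heat operator `∂ₜ - Δ`. -/
def heat (J : ParabolicJet) (t : ℝ) (x : Torus) : ℝ := J.dt t x - ∑ i, J.dxx i t x

/-- The squared length of the spatial gradient. -/
def gradSq (J : ParabolicJet) (t : ℝ) (x : Torus) : ℝ := ∑ i, J.dx i t x ^ 2

/-- The pointwise sum of two jets. -/
def add (J K : ParabolicJet) : ParabolicJet where
  val t x := J.val t x + K.val t x
  dt t x := J.dt t x + K.dt t x
  dx i t x := J.dx i t x + K.dx i t x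
  dxx i t x := J.dxx i t x + K.dxx i t x
  hasDt t x := (J.hasDt t x).add (K.hasDt t x)
  hasDx i t := (J.hasDx i t).add (K.hasDx i t)
  hasDxx i t := (J.hasDxx i t).add (K.hasDxx i t)
  cont := J.cont.add K.cont
  cont_dt := J.cont_dt.add K.cont_dt
  cont_dx i := (J.cont_dx i).add (K.cont_dx i)
  cont_dxx i := (J.cont_dxx i).add (K.cont_dxx i)

/-- The scalar multiple of a jet. -/
def smul (c : ℝ) (J : ParabolicJet) : ParabolicJet where
  val t x := c * J.val t x
  dt t x := c * J.dt t x
  dx i t x := c * J.dx i t x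
  dxx i t x := c * J.dxx i t x
  hasDt t x := (J.hasDt t x).const_mul c
  hasDx i t x := (J.hasDx i t x).const_mul c
  hasDxx i t x := (J.hasDxx i t x).const_mul c
  cont := continuous_const.mul J.cont
  cont_dt := continuous_const.mul J.cont_dt
  cont_dx i := continuous_const.mul (J.cont_dx i)
  cont_dxx i := continuous_const.mul (J.cont_dxx i)

/-- The pointwise product of two jets. -/
def mul (J K : ParabolicJet) : ParabolicJet where
  val t x := J.val t x * K.val t x
  dt t x := J.dt t x * K.val t x + J.val t x * K.dt t x
  dx i t x := J.dx i t x * K.val t x + J.val t x * K.dx i t x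
  dxx i t x := (J.dxx i t x * K.val t x + J.dx i t x * K.dx i t x) +
    (J.dx i t x * K.dx i t x + J.val t x * K.dxx i t x)
  hasDt t x := (J.hasDt t x).mul (K.hasDt t x)
  hasDx i t := (J.hasDx i t).mul (K.hasDx i t)
  hasDxx i t := ((J.hasDxx i t).mul (K.hasDx i t)).add ((J.hasDx i t).mul (K.hasDxx i t))
  cont := J.cont.mul K.cont
  cont_dt := (J.cont_dt.mul K.cont).add (J.cont.mul K.cont_dt)
  cont_dx i := ((J.cont_dx i).mul K.cont).add (J.cont.mul (K.cont_dx i))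
  cont_dxx i := (((J.cont_dxx i).mul K.cont).add ((J.cont_dx i).mul (K.cont_dx i))).add
    (((J.cont_dx i).mul (K.cont_dx i)).add (J.cont.mul (K.cont_dxx i)))

theorem continuous_rpow (J : ParabolicJet) (h : ∀ t x, 0 < J.val t x) (r : ℝ) :
    Continuous (Function.uncurry fun t x => J.val t x ^ r) :=
  J.cont.rpow_const fun q => Or.inl (h q.1 q.2).ne'

/-- The real power of a positive jet. -/
def rpow (J : ParabolicJet) (h : ∀ t x, 0 < J.val t x) (r : ℝ) : ParabolicJet where
  val t x := J.val t x ^ r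
  dt t x := J.dt t x * r * J.val t x ^ (r - 1)
  dx i t x := J.dx i t x * r * J.val t x ^ (r - 1)
  dxx i t x := J.dxx i t x * r * J.val t x ^ (r - 1) +
    J.dx i t x * r * (J.dx i t x * (r - 1) * J.val t x ^ (r - 1 - 1))
  hasDt t x := (J.hasDt t x).rpow_const (Or.inl (h t x).ne')
  hasDx i t := (J.hasDx i t).rpow_const (h t) r
  hasDxx i t := HasPartial.mul (fun x => (J.hasDxx i t x).mul_const r)
    ((J.hasDx i t).rpow_const (h t) (r - 1))
  cont := J.continuous_rpow h r
  cont_dt := (J.cont_dt.mul continuous_const).mul (J.continuous_rpow h _)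
  cont_dx i := ((J.cont_dx i).mul continuous_const).mul (J.continuous_rpow h _)
  cont_dxx i := (((J.cont_dxx i).mul continuous_const).mul (J.continuous_rpow h _)).add
    (((J.cont_dx i).mul continuous_const).mul
      (((J.cont_dx i).mul continuous_const).mul (J.continuous_rpow h _)))

variable (J K : ParabolicJet) (t : ℝ) (x : Torus)

theorem heat_add : (J.add K).heat t x = J.heat t x + K.heat t x := by
  simp only [heat, add, Fin.sum_univ_two]
  ring

theorem heat_smul (c : ℝ) : (J.smul c).heat t x = c * J.heat t x := by
  simp only [heat, smul, Fin.sum_univ_two]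
  ring

theorem heat_mul : (J.mul K).heat t x = J.heat t x * K.val t x + J.val t x * K.heat t x -
    2 * ∑ i, J.dx i t x * K.dx i t x := by
  simp only [heat, mul, Fin.sum_univ_two]
  ring

theorem heat_rpow (h : ∀ t x, 0 < J.val t x) (r : ℝ) :
    (J.rpow h r).heat t x = r * J.val t x ^ (r - 1) * J.heat t x -
      r * (r - 1) * J.val t x ^ (r - 1 - 1) * J.gradSq t x := by
  simp only [heat, gradSq, rpow, Fin.sum_univ_two]
  ring

theorem gradSq_rpow (h : ∀ t x, 0 < J.val t x) (r : ℝ) :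
    (J.rpow h r).gradSq t x = r ^ 2 * (J.val t x ^ (r - 1)) ^ 2 * J.gradSq t x := by
  simp only [gradSq, rpow, Fin.sum_univ_two]
  ring

theorem gradSq_add_le : (J.add K).gradSq t x ≤ 2 * (J.gradSq t x + K.gradSq t x) := by
  simp only [gradSq, ← Finset.sum_add_distrib, Finset.mul_sum]
  exact Finset.sum_le_sum fun i _ => add_sq_le

theorem gradSq_nonneg : 0 ≤ J.gradSq t x :=
  Finset.sum_nonneg fun _ _ => sq_nonneg _

theorem continuous_val : Continuous (J.val t) := J.cont.uncurry_left t

theorem continuous_dt : Continuous (J.dt t) := J.cont_dt.uncurry_left t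

theorem continuous_dx (i : Fin 2) : Continuous (J.dx i t) := (J.cont_dx i).uncurry_left t

theorem continuous_dxx (i : Fin 2) : Continuous (J.dxx i t) := (J.cont_dxx i).uncurry_left t

theorem continuous_heat : Continuous (J.heat t) :=
  (J.continuous_dt t).sub (continuous_finsetSum _ fun i _ => J.continuous_dxx t i)

theorem integral_heat : ∫ x, J.heat t x = ∫ x, J.dt t x := by
  have integrable_dxx (i : Fin 2) : Integrable (J.dxx i t) :=
    integrable_of_continuous (J.continuous_dxx t i)
  have integral_dxx (i : Fin 2) : ∫ x, J.dxx i t x = 0 :=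
    integral_partial_eq_zero (J.hasDxx i t) (J.continuous_dx t i) (J.continuous_dxx t i)
  simp only [heat]
  rw [integral_sub (integrable_of_continuous (J.continuous_dt t))
      (integrable_finsetSum _ fun i _ => integrable_dxx i),
    integral_finsetSum _ fun i _ => integrable_dxx i]
  simp only [integral_dxx, Finset.sum_const_zero, sub_zero]

theorem hasDerivAt_integral : HasDerivAt (fun s => ∫ x, J.val s x) (∫ x, J.heat t x) t := by
  rw [integral_heat]
  exact hasDerivAt_integral_of_continuous J.hasDt J.continuous_val J.cont_dt t

end ParabolicJet

end Jets

/-! ### A Bellman function for the heat flow -/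

section Bellman

open ParabolicJet

/-- `J` behaves like `|f|² + ε` for a solution `f` of the heat equation with `|∇f|² = A`. -/
structure IsCaloricSq (J : ParabolicJet) (A : ℝ → Torus → ℝ) : Prop where
  pos : ∀ t x, 0 < J.val t x
  nonneg : ∀ t x, 0 ≤ A t x
  heat : ∀ t x, J.heat t x = -2 * A t x
  gradSq : ∀ t x, J.gradSq t x ≤ 4 * J.val t x * A t x

theorem rpow_sub_one_mul {a : ℝ} (ha : 0 < a) (r : ℝ) : a ^ (r - 1) * a = a ^ r := by
  rw [← Real.rpow_add_one ha.ne', sub_add_cancel]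

namespace IsCaloricSq

variable {J : ParabolicJet} {A : ℝ → Torus → ℝ} (h : IsCaloricSq J A) {r : ℝ} (t : ℝ) (x : Torus)

include h

theorem le_neg_heat_rpow_of_one_le (hr : 1 ≤ r) :
    2 * r * J.val t x ^ (r - 1) * A t x ≤ -(J.rpow h.pos r).heat t x := by
  have nonneg : 0 ≤ r * (r - 1) * J.val t x ^ (r - 1 - 1) * J.gradSq t x := by
    have := Real.rpow_pos_of_pos (h.pos t x) (r - 1 - 1)
    have := J.gradSq_nonneg t x
    have : 0 ≤ r - 1 := by linarith
    positivity
  rw [heat_rpow, h.heat]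
  linarith

theorem le_neg_heat_rpow_of_le_one (hr0 : 0 ≤ r) (hr : r ≤ 1) :
    2 * r * (2 * r - 1) * J.val t x ^ (r - 1) * A t x ≤ -(J.rpow h.pos r).heat t x := by
  have gradient_term : r * (1 - r) * J.val t x ^ (r - 1 - 1) * J.gradSq t x ≤
      4 * r * (1 - r) * J.val t x ^ (r - 1) * A t x := by
    have := Real.rpow_pos_of_pos (h.pos t x) (r - 1 - 1)
    have : 0 ≤ 1 - r := by linarith
    calc r * (1 - r) * J.val t x ^ (r - 1 - 1) * J.gradSq t x
        ≤ r * (1 - r) * J.val t x ^ (r - 1 - 1) * (4 * J.val t x * A t x) := by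
          gcongr
          exact h.gradSq t x
      _ = 4 * r * (1 - r) * J.val t x ^ (r - 1) * A t x := by
          rw [← rpow_sub_one_mul (h.pos t x) (r - 1)]
          ring
  rw [heat_rpow, h.heat]
  linarith

theorem gradSq_rpow_le (r : ℝ) : (J.rpow h.pos r).gradSq t x ≤
    4 * r ^ 2 * J.val t x ^ r * (J.val t x ^ (r - 1) * A t x) := by
  calc (J.rpow h.pos r).gradSq t x
      ≤ r ^ 2 * (J.val t x ^ (r - 1)) ^ 2 * (4 * J.val t x * A t x) := by
        rw [gradSq_rpow]
        gcongr
        exact h.gradSq t x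
    _ = 4 * r ^ 2 * J.val t x ^ r * (J.val t x ^ (r - 1) * A t x) := by
        rw [← rpow_sub_one_mul (h.pos t x) r]
        ring

end IsCaloricSq

section Product

theorem neg_cross_term_le {a w γ : ℝ} (ha : 0 < a) (hw : 0 ≤ w) (hγ : γ ^ 2 ≤ 1) (v s y : ℝ) :
    -(2 * γ * w * v * (s * y)) ≤ w * v ^ 2 * (s ^ 2 / (4 * a)) + 4 * (a * w * y ^ 2) := by
  have square_nonneg : 0 ≤ a * w * (v * s / (2 * a) + 2 * γ * y) ^ 2 := by positivity
  have square_eq : a * w * (v * s / (2 * a) + 2 * γ * y) ^ 2 =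
      w * v ^ 2 * (s ^ 2 / (4 * a)) + 2 * γ * w * v * (s * y) + γ ^ 2 * (4 * (a * w * y ^ 2)) := by
    field_simp
    ring
  have := mul_le_of_le_one_left (by positivity : 0 ≤ 4 * (a * w * y ^ 2)) hγ
  linarith

variable {a v : ParabolicJet} {A : ℝ → Torus → ℝ}

theorem heat_mul_rpow (hv : ∀ t x, 0 < v.val t x) (γ t : ℝ) (x : Torus) :
    (a.mul (v.rpow hv γ)).heat t x = a.heat t x * v.val t x ^ γ +
      a.val t x * (γ * v.val t x ^ (γ - 1) * v.heat t x -
        γ * (γ - 1) * v.val t x ^ (γ - 1 - 1) * v.gradSq t x) -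
      2 * γ * v.val t x ^ (γ - 1) * ∑ i, a.dx i t x * v.dx i t x := by
  rw [heat_mul, heat_rpow]
  simp only [ParabolicJet.rpow, Fin.sum_univ_two]
  ring

theorem IsCaloricSq.neg_cross_terms_le (ha : IsCaloricSq a A) (hv : ∀ t x, 0 < v.val t x) {γ : ℝ}
    (hγ : γ ^ 2 ≤ 1) (t : ℝ) (x : Torus) :
    -(2 * γ * v.val t x ^ (γ - 1) * ∑ i, a.dx i t x * v.dx i t x) ≤
      v.val t x ^ γ * A t x + 4 * (a.val t x * v.val t x ^ (γ - 1 - 1) * v.gradSq t x) := by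
  have ha0 := ha.pos t x
  have hw := Real.rpow_pos_of_pos (hv t x) (γ - 1 - 1)
  have gradient_le : a.gradSq t x / (4 * a.val t x) ≤ A t x := by
    rw [div_le_iff₀ (by positivity)]
    linarith [ha.gradSq t x]
  rw [← rpow_sub_one_mul (hv t x) γ, ← rpow_sub_one_mul (hv t x) (γ - 1)]
  calc -(2 * γ * (v.val t x ^ (γ - 1 - 1) * v.val t x) * ∑ i, a.dx i t x * v.dx i t x)
      = ∑ i, -(2 * γ * v.val t x ^ (γ - 1 - 1) * v.val t x * (a.dx i t x * v.dx i t x)) := by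
        rw [Finset.sum_neg_distrib, ← Finset.mul_sum]
        ring
    _ ≤ ∑ i, (v.val t x ^ (γ - 1 - 1) * v.val t x ^ 2 * (a.dx i t x ^ 2 / (4 * a.val t x)) +
          4 * (a.val t x * v.val t x ^ (γ - 1 - 1) * v.dx i t x ^ 2)) :=
        Finset.sum_le_sum fun i _ => neg_cross_term_le ha0 hw.le hγ _ _ _
    _ = v.val t x ^ (γ - 1 - 1) * v.val t x ^ 2 * (a.gradSq t x / (4 * a.val t x)) +
          4 * (a.val t x * v.val t x ^ (γ - 1 - 1) * v.gradSq t x) := by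
        simp only [ParabolicJet.gradSq, Fin.sum_univ_two]
        ring
    _ ≤ v.val t x ^ (γ - 1 - 1) * v.val t x ^ 2 * A t x +
          4 * (a.val t x * v.val t x ^ (γ - 1 - 1) * v.gradSq t x) := by gcongr
    _ = v.val t x ^ (γ - 1 - 1) * v.val t x * v.val t x * A t x +
          4 * (a.val t x * v.val t x ^ (γ - 1 - 1) * v.gradSq t x) := by ring

theorem IsCaloricSq.le_neg_heat_mul_rpow (ha : IsCaloricSq a A) (hv : ∀ t x, 0 < v.val t x)
    {γ t : ℝ} {x : Torus} (hheat : v.heat t x ≤ 0) (h0 : 0 ≤ γ) (h1 : γ ≤ 1) :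
    v.val t x ^ γ * A t x - 5 * (a.val t x * v.val t x ^ (γ - 1 - 1) * v.gradSq t x) ≤
      -(a.mul (v.rpow hv γ)).heat t x := by
  have ha0 := ha.pos t x
  have heat_term : 0 ≤ a.val t x * (γ * v.val t x ^ (γ - 1) * -v.heat t x) := by
    have := Real.rpow_pos_of_pos (hv t x) (γ - 1)
    have : 0 ≤ -v.heat t x := by linarith
    positivity
  have gradient_term : γ * (1 - γ) * (a.val t x * v.val t x ^ (γ - 1 - 1) * v.gradSq t x) ≤
      a.val t x * v.val t x ^ (γ - 1 - 1) * v.gradSq t x := by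
    have := Real.rpow_pos_of_pos (hv t x) (γ - 1 - 1)
    have := v.gradSq_nonneg t x
    exact mul_le_of_le_one_left (by positivity) (by nlinarith)
  have cross_terms := ha.neg_cross_terms_le hv (pow_le_one₀ (n := 2) h0 h1) t x
  rw [heat_mul_rpow, ha.heat]
  linarith

end Product

theorem two_mul_sqrt_mul_sqrt_le {A B β : ℝ} (hA : 0 ≤ A) (hB : 0 ≤ B) (hβ : 0 < β) :
    2 * (Real.sqrt A * Real.sqrt B) ≤ β⁻¹ * A + β * B := by
  have square_nonneg : 0 ≤ β⁻¹ * (Real.sqrt A - β * Real.sqrt B) ^ 2 := by positivity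
  have square_eq : β⁻¹ * (Real.sqrt A - β * Real.sqrt B) ^ 2 =
      β⁻¹ * A + β * B - 2 * (Real.sqrt A * Real.sqrt B) := by
    rw [sub_sq, mul_pow, Real.sq_sqrt hA, Real.sq_sqrt hB]
    field_simp
    ring
  linarith

section BellmanFunction

/-- The function `v = a^(p/2) + b^(q/2)` with `1/p + 1/q = 1`. -/
def bellmanBase (a b : ParabolicJet) (ha : ∀ t x, 0 < a.val t x) (hb : ∀ t x, 0 < b.val t x)
    (P : ℝ) : ParabolicJet :=
  (a.rpow ha (P / 2)).add (b.rpow hb (P.conjExponent / 2))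

theorem bellmanBase_pos {a b : ParabolicJet} (ha : ∀ t x, 0 < a.val t x)
    (hb : ∀ t x, 0 < b.val t x) (P t : ℝ) (x : Torus) : 0 < (bellmanBase a b ha hb P).val t x :=
  add_pos (Real.rpow_pos_of_pos (ha t x) _) (Real.rpow_pos_of_pos (hb t x) _)

/-- The Bellman function `v + δ a v^γ` with `v = a^(p/2) + b^(q/2)`, `γ = 1 - 2/p` and
`δ = 1/(20 p)`. -/
def bellman (a b : ParabolicJet) (ha : ∀ t x, 0 < a.val t x) (hb : ∀ t x, 0 < b.val t x)
    (P : ℝ) : ParabolicJet :=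
  (bellmanBase a b ha hb P).add
    ((a.mul ((bellmanBase a b ha hb P).rpow (bellmanBase_pos ha hb P) (1 - 2 / P))).smul
      (1 / (20 * P)))

variable {a b : ParabolicJet} {P : ℝ}

section Values

variable (ha : ∀ t x, 0 < a.val t x) (hb : ∀ t x, 0 < b.val t x) (hP : 2 ≤ P) (t : ℝ) (x : Torus)

include hP

theorem mul_bellmanBase_rpow_le_one :
    a.val t x * (bellmanBase a b ha hb P).val t x ^ (1 - 2 / P - 1) ≤ 1 := by
  set v := (bellmanBase a b ha hb P).val t x
  have hv0 : 0 < v := bellmanBase_pos ha hb P t x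
  have a_le : a.val t x ≤ v ^ (2 / P) := by
    have rpow_le : a.val t x ^ (P / 2) ≤ v :=
      le_add_of_nonneg_right (Real.rpow_pos_of_pos (hb t x) _).le
    have := Real.rpow_le_rpow (Real.rpow_nonneg (ha t x).le _) rpow_le
      (by positivity : 0 ≤ 2 / P)
    rwa [← Real.rpow_mul (ha t x).le, show P / 2 * (2 / P) = 1 by field_simp,
      Real.rpow_one] at this
  calc a.val t x * v ^ (1 - 2 / P - 1) ≤ v ^ (2 / P) * v ^ (1 - 2 / P - 1) := by gcongr
    _ = 1 := by
        rw [← Real.rpow_add hv0, show 2 / P + (1 - 2 / P - 1) = 0 by ring, Real.rpow_zero]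

theorem bellman_val_le :
    (bellman a b ha hb P).val t x ≤ 2 * (bellmanBase a b ha hb P).val t x := by
  set v := (bellmanBase a b ha hb P).val t x
  have hv0 : 0 < v := bellmanBase_pos ha hb P t x
  have ha0 := ha t x
  have correction_le : a.val t x * v ^ (1 - 2 / P) ≤ v := by
    rw [← rpow_sub_one_mul hv0 (1 - 2 / P), ← mul_assoc]
    exact mul_le_of_le_one_left hv0.le (mul_bellmanBase_rpow_le_one ha hb hP t x)
  have coefficient_le : 1 / (20 * P) ≤ 1 := by
    rw [div_le_one (by positivity)]
    linarith
  change v + 1 / (20 * P) * (a.val t x * v ^ (1 - 2 / P)) ≤ 2 * v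
  have := mul_le_of_le_one_left (by positivity : 0 ≤ a.val t x * v ^ (1 - 2 / P)) coefficient_le
  linarith

theorem bellman_val_nonneg : 0 ≤ (bellman a b ha hb P).val t x := by
  have := bellmanBase_pos ha hb P t x
  have := ha t x
  change 0 ≤ (bellmanBase a b ha hb P).val t x + 1 / (20 * P) *
    (a.val t x * (bellmanBase a b ha hb P).val t x ^ (1 - 2 / P))
  positivity

end Values

/-- The constant in the Bellman inequality `heat_bellman_le`. -/
def bellmanConst (P : ℝ) : ℝ := min (1 / (20 * P)) (P.conjExponent * (P.conjExponent - 1) / 2)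

theorem conjExponent_sub_one (hP : 1 < P) : P.conjExponent - 1 = 1 / (P - 1) := by
  have : P - 1 ≠ 0 := by linarith
  rw [Real.conjExponent]
  field_simp
  ring

theorem bellmanConst_pos (hP : 1 < P) : 0 < bellmanConst P := by
  have : 0 < P - 1 := by linarith
  rw [bellmanConst, conjExponent_sub_one hP, Real.conjExponent]
  exact lt_min (by positivity) (by positivity)

variable {A B : ℝ → Torus → ℝ} (ha : IsCaloricSq a A) (hb : IsCaloricSq b B) (hP : 2 ≤ P) (t : ℝ)
  (x : Torus)

include hP

theorem le_neg_heat_bellmanBase :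
    P * (a.val t x ^ (P / 2 - 1) * A t x) + P.conjExponent * (P.conjExponent - 1) *
        (b.val t x ^ (P.conjExponent / 2 - 1) * B t x) ≤
      -(bellmanBase a b ha.pos hb.pos P).heat t x := by
  have conjExponent_le : P.conjExponent ≤ 2 := by
    rw [Real.conjExponent, div_le_iff₀ (by linarith)]
    linarith
  have conjExponent_pos : 0 < P.conjExponent := div_pos (by linarith) (by linarith)
  have heat_a := ha.le_neg_heat_rpow_of_one_le t x (r := P / 2) (by linarith)
  have heat_b := hb.le_neg_heat_rpow_of_le_one t x (r := P.conjExponent / 2) (by positivity)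
    (by linarith)
  rw [bellmanBase, heat_add]
  linarith

theorem heat_bellmanBase_nonpos : (bellmanBase a b ha.pos hb.pos P).heat t x ≤ 0 := by
  have lower_bound := le_neg_heat_bellmanBase ha hb hP t x
  have := ha.nonneg t x
  have := hb.nonneg t x
  have := Real.rpow_pos_of_pos (ha.pos t x) (P / 2 - 1)
  have := Real.rpow_pos_of_pos (hb.pos t x) (P.conjExponent / 2 - 1)
  have : 0 < P - 1 := by linarith
  have : 0 ≤ P * (a.val t x ^ (P / 2 - 1) * A t x) := by positivity
  have : 0 ≤ P.conjExponent * (P.conjExponent - 1) *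
      (b.val t x ^ (P.conjExponent / 2 - 1) * B t x) := by
    rw [conjExponent_sub_one (by linarith), Real.conjExponent]
    positivity
  linarith

omit hP in
theorem gradSq_bellmanBase_le :
    (bellmanBase a b ha.pos hb.pos P).gradSq t x ≤
      2 * (bellmanBase a b ha.pos hb.pos P).val t x *
        (P ^ 2 * (a.val t x ^ (P / 2 - 1) * A t x) +
          P.conjExponent ^ 2 * (b.val t x ^ (P.conjExponent / 2 - 1) * B t x)) := by
  set v := (bellmanBase a b ha.pos hb.pos P).val t x
  have summand_le {J : ParabolicJet} {D : ℝ → Torus → ℝ} (hJ : IsCaloricSq J D) (r : ℝ)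
      (hle : J.val t x ^ (r / 2) ≤ v) : (J.rpow hJ.pos (r / 2)).gradSq t x ≤
        v * (r ^ 2 * (J.val t x ^ (r / 2 - 1) * D t x)) := by
    have := Real.rpow_pos_of_pos (hJ.pos t x) (r / 2 - 1)
    have := hJ.nonneg t x
    calc (J.rpow hJ.pos (r / 2)).gradSq t x
        ≤ 4 * (r / 2) ^ 2 * J.val t x ^ (r / 2) * (J.val t x ^ (r / 2 - 1) * D t x) :=
          hJ.gradSq_rpow_le t x (r / 2)
      _ = J.val t x ^ (r / 2) * (r ^ 2 * (J.val t x ^ (r / 2 - 1) * D t x)) := by ring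
      _ ≤ v * (r ^ 2 * (J.val t x ^ (r / 2 - 1) * D t x)) := by gcongr
  have gradSq_a := summand_le ha P (le_add_of_nonneg_right (Real.rpow_pos_of_pos (hb.pos t x) _).le)
  have gradSq_b := summand_le hb P.conjExponent
    (le_add_of_nonneg_left (Real.rpow_pos_of_pos (ha.pos t x) _).le)
  refine (gradSq_add_le _ _ t x).trans ?_
  linarith

theorem mul_gradSq_bellmanBase_le :
    a.val t x * (bellmanBase a b ha.pos hb.pos P).val t x ^ (1 - 2 / P - 1 - 1) *
        (bellmanBase a b ha.pos hb.pos P).gradSq t x ≤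
      2 * (P ^ 2 * (a.val t x ^ (P / 2 - 1) * A t x) +
        P.conjExponent ^ 2 * (b.val t x ^ (P.conjExponent / 2 - 1) * B t x)) := by
  set v := (bellmanBase a b ha.pos hb.pos P).val t x
  set S := P ^ 2 * (a.val t x ^ (P / 2 - 1) * A t x) +
    P.conjExponent ^ 2 * (b.val t x ^ (P.conjExponent / 2 - 1) * B t x)
  have hv0 : 0 < v := bellmanBase_pos ha.pos hb.pos P t x
  have ha0 := ha.pos t x
  have hS0 : 0 ≤ S := by
    have := hb.pos t x
    have := ha.nonneg t x
    have := hb.nonneg t x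
    positivity
  calc a.val t x * v ^ (1 - 2 / P - 1 - 1) * (bellmanBase a b ha.pos hb.pos P).gradSq t x
      ≤ a.val t x * v ^ (1 - 2 / P - 1 - 1) * (2 * v * S) := by
        gcongr
        exact gradSq_bellmanBase_le ha hb t x
    _ = a.val t x * v ^ (1 - 2 / P - 1) * (2 * S) := by
        rw [← rpow_sub_one_mul hv0 (1 - 2 / P - 1)]
        ring
    _ ≤ 2 * S :=
        mul_le_of_le_one_left (by positivity) (mul_bellmanBase_rpow_le_one ha.pos hb.pos hP t x)

omit ha hb in
theorem inv_rpow_le_bellmanBase_rpow (ha : ∀ t x, 0 < a.val t x) (hb : ∀ t x, 0 < b.val t x) :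
    (b.val t x ^ (P.conjExponent / 2 - 1))⁻¹ ≤ (bellmanBase a b ha hb P).val t x ^ (1 - 2 / P) := by
  have rpow_le : b.val t x ^ (P.conjExponent / 2) ≤ (bellmanBase a b ha hb P).val t x :=
    le_add_of_nonneg_left (Real.rpow_pos_of_pos (ha t x) _).le
  have exponent_nonneg : 0 ≤ 1 - 2 / P := by
    rw [sub_nonneg, div_le_one (by positivity)]
    exact hP
  have exponent_eq : -(P.conjExponent / 2 - 1) = P.conjExponent / 2 * (1 - 2 / P) := by
    have : P - 1 ≠ 0 := by linarith
    rw [Real.conjExponent]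
    field_simp
    ring
  rw [← Real.rpow_neg (hb t x).le, exponent_eq, Real.rpow_mul (hb t x).le]
  exact Real.rpow_le_rpow (Real.rpow_nonneg (hb t x).le _) rpow_le exponent_nonneg

theorem sub_le_neg_heat_mul_bellmanBase_rpow :
    (bellmanBase a b ha.pos hb.pos P).val t x ^ (1 - 2 / P) * A t x -
        10 * (P ^ 2 * (a.val t x ^ (P / 2 - 1) * A t x) +
          P.conjExponent ^ 2 * (b.val t x ^ (P.conjExponent / 2 - 1) * B t x)) ≤
      -(a.mul ((bellmanBase a b ha.pos hb.pos P).rpow (bellmanBase_pos ha.pos hb.pos P)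
        (1 - 2 / P))).heat t x := by
  have exponent_nonneg : 0 ≤ 1 - 2 / P := by
    rw [sub_nonneg, div_le_one (by positivity)]
    exact hP
  have product := ha.le_neg_heat_mul_rpow (bellmanBase_pos ha.pos hb.pos P)
    (heat_bellmanBase_nonpos ha hb hP t x) exponent_nonneg (sub_le_self 1 (by positivity))
  linarith [mul_gradSq_bellmanBase_le ha hb hP t x]

theorem bellmanConst_mul_le_neg_heat_bellman :
    bellmanConst P * ((b.val t x ^ (P.conjExponent / 2 - 1))⁻¹ * A t x +
        b.val t x ^ (P.conjExponent / 2 - 1) * B t x) ≤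
      -(bellman a b ha.pos hb.pos P).heat t x := by
  set v := bellmanBase a b ha.pos hb.pos P
  set q := P.conjExponent with hq
  set α := a.val t x ^ (P / 2 - 1) * A t x
  set β := b.val t x ^ (q / 2 - 1)
  have hA := ha.nonneg t x
  have hB := hb.nonneg t x
  have hα0 : 0 ≤ α := mul_nonneg (Real.rpow_nonneg (ha.pos t x).le _) hA
  have hβ0 : 0 < β := Real.rpow_pos_of_pos (hb.pos t x) _
  have base := le_neg_heat_bellmanBase ha hb hP t x
  have correction := mul_le_mul_of_nonneg_left (sub_le_neg_heat_mul_bellmanBase_rpow ha hb hP t x)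
    (by positivity : 0 ≤ 1 / (20 * P))
  rw [mul_sub, mul_neg] at correction
  -- The value of `δ` is chosen so that half of `base` absorbs the error terms of `correction`.
  have absorbed : 1 / (20 * P) * (10 * (P ^ 2 * α + q ^ 2 * (β * B t x))) =
      P / 2 * α + q * (q - 1) / 2 * (β * B t x) := by
    have : P - 1 ≠ 0 := by linarith
    rw [hq, conjExponent_sub_one (by linarith), Real.conjExponent]
    field_simp
    ring
  have coefficient_A : bellmanConst P * (β⁻¹ * A t x) ≤
      1 / (20 * P) * (v.val t x ^ (1 - 2 / P) * A t x) := by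
    gcongr
    · exact min_le_left _ _
    · exact inv_rpow_le_bellmanBase_rpow hP t x ha.pos hb.pos
  have coefficient_B : bellmanConst P * (β * B t x) ≤ q * (q - 1) / 2 * (β * B t x) := by
    gcongr
    exact min_le_right _ _
  have : 0 ≤ P / 2 * α := by positivity
  rw [bellman, heat_add, heat_smul, mul_add]
  linarith

theorem heat_bellman_le :
    2 * bellmanConst P * (Real.sqrt (A t x) * Real.sqrt (B t x)) ≤
      -(bellman a b ha.pos hb.pos P).heat t x := by
  have := bellmanConst_pos (P := P) (by linarith)
  calc 2 * bellmanConst P * (Real.sqrt (A t x) * Real.sqrt (B t x))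
      = bellmanConst P * (2 * (Real.sqrt (A t x) * Real.sqrt (B t x))) := by ring
    _ ≤ bellmanConst P * ((b.val t x ^ (P.conjExponent / 2 - 1))⁻¹ * A t x +
          b.val t x ^ (P.conjExponent / 2 - 1) * B t x) := by
        gcongr
        exact two_mul_sqrt_mul_sqrt_le (ha.nonneg t x) (hb.nonneg t x)
          (Real.rpow_pos_of_pos (hb.pos t x) _)
    _ ≤ -(bellman a b ha.pos hb.pos P).heat t x :=
        bellmanConst_mul_le_neg_heat_bellman ha hb hP t x

end BellmanFunction

end Bellman

/-! ### The heat flow of trigonometric polynomials -/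

section Flow

/-- The solution `e^(tΔ) u` at time `t` of the heat equation with initial value `u = trigPoly c`. -/
def flow (c : Coeff) (t : ℝ) : C(Torus, ℂ) :=
  trigPoly (multiplier (fun k => Complex.exp (laplaceSymbol k * t)) c)

theorem flow_zero (c : Coeff) : flow c 0 = trigPoly c := by simp [flow, multiplier_const]

theorem flow_add (c d : Coeff) (t : ℝ) : flow (c + d) t = flow c t + flow d t := by simp [flow]

theorem flow_single (k : Fin 2 → ℤ) (a : ℂ) (t : ℝ) :
    flow (Finsupp.single k a) t = (Complex.exp (laplaceSymbol k * t) * a) • character k := by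
  rw [flow, multiplier_single, trigPoly_single]

theorem hasPartial_flow (i : Fin 2) (c : Coeff) (t : ℝ) :
    HasPartial i (flow c t) (flow (multiplier (partialSymbol i) c) t) := by
  unfold flow
  rw [multiplier_comm]
  exact hasPartial_trigPoly i _

theorem hasDerivAt_flow (c : Coeff) (t : ℝ) (x : Torus) :
    HasDerivAt (fun s => flow c s x) (flow (multiplier laplaceSymbol c) t x) t := by
  induction c using Finsupp.induction_linear with
  | zero => simpa [flow] using hasDerivAt_const t (0 : ℂ)
  | add f g hf hg =>
    simp only [map_add, flow_add]
    exact hf.add hg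
  | single k c =>
    have exp_deriv := ((Complex.ofRealCLM.hasDerivAt (x := t)).const_mul (laplaceSymbol k)).cexp
    simp only [multiplier_single, flow_single, ContinuousMap.coe_smul, Pi.smul_apply, smul_eq_mul]
    refine ((exp_deriv.mul_const c).mul_const (character k x)).congr_deriv ?_
    simp only [Complex.ofRealCLM_apply, Complex.ofReal_one]
    ring

theorem continuous_flow (c : Coeff) : Continuous fun q : ℝ × Torus => flow c q.1 q.2 := by
  induction c using Finsupp.induction_linear with
  | zero => simpa [flow] using continuous_const
  | add f g hf hg =>
    simp only [flow_add]
    exact hf.add hg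
  | single k c =>
    simp only [flow_single, ContinuousMap.coe_smul, Pi.smul_apply, smul_eq_mul]
    fun_prop

theorem flow_laplaceSymbol (c : Coeff) (t : ℝ) (x : Torus) :
    flow (multiplier laplaceSymbol c) t x =
      ∑ i, flow (multiplier (partialSymbol i) (multiplier (partialSymbol i) c)) t x := by
  rw [multiplier_laplaceSymbol]
  simp [flow]

theorem freqSq_pos {k : Fin 2 → ℤ} (hk : k ≠ 0) : 0 < freqSq k := by
  obtain ⟨i, hi⟩ := Function.ne_iff.1 hk
  exact Finset.sum_pos' (fun _ _ => sq_nonneg _)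
    ⟨i, Finset.mem_univ i, by have : k i ≠ 0 := hi; positivity⟩

theorem tendsto_exp_laplaceSymbol {k : Fin 2 → ℤ} (hk : k ≠ 0) :
    Tendsto (fun t : ℝ => Complex.exp (laplaceSymbol k * t)) atTop (𝓝 0) := by
  have norm_exp : ∀ t : ℝ, ‖Complex.exp (laplaceSymbol k * t)‖ = Real.exp (-(freqSq k * t)) :=
    fun t => by rw [Complex.norm_exp, laplaceSymbol_eq]; simp
  rw [tendsto_zero_iff_norm_tendsto_zero]
  simp only [norm_exp]
  exact Real.tendsto_exp_neg_atTop_nhds_zero.comp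
    (tendsto_id.const_mul_atTop (freqSq_pos hk))

theorem tendsto_flow (c : Coeff) : Tendsto (flow c) atTop (𝓝 (c 0 • 1)) := by
  induction c using Finsupp.induction_linear with
  | zero => simp [show flow 0 = fun _ => 0 by funext t; simp [flow]]
  | add f g hf hg =>
    rw [funext (flow_add f g), Finsupp.add_apply, add_smul]
    exact hf.add hg
  | single k a =>
    rw [funext (flow_single k a)]
    rcases eq_or_ne k 0 with rfl | hk
    · simp [laplaceSymbol, partialSymbol, character_zero]
    · simpa [hk.symm] using ((tendsto_exp_laplaceSymbol hk).mul_const a).smul_const (character k)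

theorem tendsto_flow_partialSymbol (i : Fin 2) (c : Coeff) :
    Tendsto (flow (multiplier (partialSymbol i) c)) atTop (𝓝 0) := by
  simpa [multiplier_apply, partialSymbol] using tendsto_flow (multiplier (partialSymbol i) c)

theorem HasPartial.re {i : Fin 2} {φ φ' : Torus → ℂ} (h : HasPartial i φ φ') :
    HasPartial i (fun x => (φ x).re) (fun x => (φ' x).re) :=
  fun x => Complex.reCLM.hasFDerivAt.comp_hasDerivAt _ (h x)

theorem continuous_conj_flow_mul_flow (c d : Coeff) :
    Continuous fun q : ℝ × Torus => starRingEnd ℂ (flow c q.1 q.2) * flow d q.1 q.2 :=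
  (Complex.continuous_conj.comp (continuous_flow c)).mul (continuous_flow d)

/-- The function `|f_t|² + ε` for the heat flow `f_t` of a trigonometric polynomial. -/
def caloricJet (c : Coeff) (ε : ℝ) : ParabolicJet where
  val t x := ‖flow c t x‖ ^ 2 + ε
  dt t x := 2 * (starRingEnd ℂ (flow c t x) * flow (multiplier laplaceSymbol c) t x).re
  dx i t x := 2 * (starRingEnd ℂ (flow c t x) * flow (multiplier (partialSymbol i) c) t x).re
  dxx i t x := 2 * (starRingEnd ℂ (flow (multiplier (partialSymbol i) c) t x) *
      flow (multiplier (partialSymbol i) c) t x + starRingEnd ℂ (flow c t x) *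
        flow (multiplier (partialSymbol i) (multiplier (partialSymbol i) c)) t x).re
  hasDt t x := by
    refine ((hasDerivAt_flow c t x).norm_sq.add_const ε).congr_deriv ?_
    rw [Complex.inner, mul_comm (flow _ _ _)]
  hasDx i t := (hasPartial_flow i c t).normSq_add ε
  hasDxx i t x := (((hasPartial_flow i c t).conj.mul (hasPartial_flow i _ t)).re x).const_mul 2
  cont := by
    have := continuous_flow c
    simp only [Function.uncurry_def]
    fun_prop
  cont_dt := continuous_const.mul (Complex.continuous_re.comp (continuous_conj_flow_mul_flow _ _))
  cont_dx i :=
    continuous_const.mul (Complex.continuous_re.comp (continuous_conj_flow_mul_flow _ _))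
  cont_dxx i := continuous_const.mul (Complex.continuous_re.comp
    ((continuous_conj_flow_mul_flow _ _).add (continuous_conj_flow_mul_flow _ _)))

theorem sq_two_mul_re_conj_mul_le (w z : ℂ) :
    (2 * (starRingEnd ℂ w * z).re) ^ 2 ≤ 4 * ‖w‖ ^ 2 * ‖z‖ ^ 2 := by
  have re_sq_le := sq_le_sq.2 ((Complex.abs_re_le_norm (starRingEnd ℂ w * z)).trans (le_abs_self _))
  rw [norm_mul, RCLike.norm_conj] at re_sq_le
  linarith

theorem isCaloricSq_caloricJet (c : Coeff) {ε : ℝ} (hε : 0 < ε) :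
    IsCaloricSq (caloricJet c ε)
      fun t x => ∑ i, ‖flow (multiplier (partialSymbol i) c) t x‖ ^ 2 where
  pos t x := by
    change 0 < ‖flow c t x‖ ^ 2 + ε
    positivity
  nonneg t x := by positivity
  heat t x := by
    have re_conj_mul : ∀ w : ℂ, (starRingEnd ℂ w * w).re = ‖w‖ ^ 2 := fun w => by
      rw [Complex.conj_mul', ← Complex.ofReal_pow, Complex.ofReal_re]
    simp only [ParabolicJet.heat, caloricJet, flow_laplaceSymbol, Fin.sum_univ_two, Complex.add_re,
      re_conj_mul, mul_add]
    ring
  gradSq t x := by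
    change ∑ i, (2 * (starRingEnd ℂ (flow c t x) *
      flow (multiplier (partialSymbol i) c) t x).re) ^ 2 ≤
      4 * (‖flow c t x‖ ^ 2 + ε) * ∑ i, ‖flow (multiplier (partialSymbol i) c) t x‖ ^ 2
    rw [Finset.mul_sum]
    refine Finset.sum_le_sum fun i _ => (sq_two_mul_re_conj_mul_le _ _).trans ?_
    gcongr
    exact le_add_of_nonneg_right hε.le

end Flow

/-! ### Second derivatives of trigonometric polynomials -/

section Riesz

theorem continuous_integral_of_continuous_uncurry {X α E : Type*} [TopologicalSpace X]
    [TopologicalSpace α] [CompactSpace α] [MeasurableSpace α] [OpensMeasurableSpace α]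
    {μ : Measure α} [IsFiniteMeasure μ] [NormedAddCommGroup E] [NormedSpace ℝ E] {f : X → α → E}
    (h : Continuous (Function.uncurry f)) : Continuous fun y => ∫ x, f y x ∂μ := by
  let F : X → C(α, E) := fun y => ⟨f y, h.uncurry_left y⟩
  have continuous_F : Continuous F := ContinuousMap.continuous_of_continuous_uncurry F h
  have lipschitz : LipschitzWith (μ.real Set.univ).toNNReal fun u : C(α, E) => ∫ x, u x ∂μ := by
    refine LipschitzWith.of_dist_le_mul fun u v => ?_
    rw [dist_eq_norm, dist_eq_norm, Real.coe_toNNReal _ measureReal_nonneg,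
      mul_comm (μ.real Set.univ), ← integral_sub (integrable_of_continuous u.continuous)
        (integrable_of_continuous v.continuous)]
    exact norm_integral_le_of_norm_le_const
      (Eventually.of_forall fun x => (u - v).norm_coe_le_norm x)
  exact lipschitz.continuous.comp continuous_F

theorem norm_le_of_norm_deriv_le_neg_deriv {E : Type*} [NormedAddCommGroup E] [NormedSpace ℝ E]
    {Φ Φ' : ℝ → E} {ψ ψ' : ℝ → ℝ} (hΦ : ∀ t, HasDerivAt Φ (Φ' t) t)
    (hψ : ∀ t, HasDerivAt ψ (ψ' t) t) (bound : ∀ t, ‖Φ' t‖ ≤ -ψ' t) (nonneg : ∀ t, 0 ≤ ψ t)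
    (lim : Tendsto Φ atTop (𝓝 0)) (a : ℝ) : ‖Φ a‖ ≤ ψ a := by
  have increment_le : ∀ T, a ≤ T → ‖Φ T - Φ a‖ ≤ ψ a - ψ T := fun T hT =>
    image_norm_le_of_norm_deriv_right_le_deriv_boundary (f := fun t => Φ t - Φ a)
      (fun t _ => ((hΦ t).sub_const _).continuousAt.continuousWithinAt)
      (fun t _ => ((hΦ t).sub_const _).hasDerivWithinAt) (by simp)
      (fun t => (hψ t).const_sub (ψ a)) (fun t _ => bound t) (Set.right_mem_Icc.2 hT)
  have limit : Tendsto (fun T => ‖Φ T - Φ a‖) atTop (𝓝 ‖Φ a‖) := by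
    simpa using (lim.sub_const (Φ a)).norm
  refine le_of_tendsto limit ?_
  filter_upwards [eventually_ge_atTop a] with T hT
  linarith [increment_le T hT, nonneg T]

section Pairing

variable (i j : Fin 2) (c d : Coeff) (t : ℝ)

theorem integrable_conj_flow_mul_flow :
    Integrable fun x => starRingEnd ℂ (flow c t x) * flow d t x :=
  integrable_of_continuous ((Complex.continuous_conj.comp (flow c t).continuous).mul
    (flow d t).continuous)

theorem integral_conj_flow_mul_partial :
    ∫ x, starRingEnd ℂ (flow d t x) * flow (multiplier (partialSymbol i) c) t x =
      -∫ x, starRingEnd ℂ (flow (multiplier (partialSymbol i) d) t x) * flow c t x :=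
  integral_mul_partial (hasPartial_flow i d t).conj (hasPartial_flow i c t)
    (Complex.continuous_conj.comp (flow d t).continuous)
    (Complex.continuous_conj.comp (flow _ t).continuous)
    (flow c t).continuous (flow _ t).continuous

theorem integral_conj_laplacian_mul_flow :
    ∫ x, starRingEnd ℂ (flow (multiplier laplaceSymbol d) t x) * flow c t x =
      ∫ x, starRingEnd ℂ (flow d t x) * flow (multiplier laplaceSymbol c) t x := by
  simp only [flow_laplaceSymbol, map_sum, Finset.mul_sum, Finset.sum_mul]
  rw [integral_finsetSum _ fun i _ => integrable_conj_flow_mul_flow _ _ _,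
    integral_finsetSum _ fun i _ => integrable_conj_flow_mul_flow _ _ _]
  refine Finset.sum_congr rfl fun i _ => ?_
  rw [integral_conj_flow_mul_partial, integral_conj_flow_mul_partial, neg_neg]

theorem hasDerivAt_integral_conj_flow_mul_flow :
    HasDerivAt (fun s => ∫ x, starRingEnd ℂ (flow d s x) * flow c s x)
      (2 * ∫ x, starRingEnd ℂ (flow d t x) * flow (multiplier laplaceSymbol c) t x) t := by
  have integrand_deriv (t : ℝ) (x : Torus) :
      HasDerivAt (fun s => starRingEnd ℂ (flow d s x) * flow c s x)
        (starRingEnd ℂ (flow (multiplier laplaceSymbol d) t x) * flow c t x +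
          starRingEnd ℂ (flow d t x) * flow (multiplier laplaceSymbol c) t x) t :=
    ((Complex.conjCLE : ℂ →L[ℝ] ℂ).hasFDerivAt.comp_hasDerivAt _ (hasDerivAt_flow d t x)).mul
      (hasDerivAt_flow c t x)
  refine (hasDerivAt_integral_of_continuous integrand_deriv
    (fun t => (Complex.continuous_conj.comp (flow d t).continuous).mul (flow c t).continuous)
    ((continuous_conj_flow_mul_flow _ _).add (continuous_conj_flow_mul_flow _ _)) t).congr_deriv ?_
  rw [integral_add (integrable_conj_flow_mul_flow _ _ _) (integrable_conj_flow_mul_flow _ _ _),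
    integral_conj_laplacian_mul_flow, ← two_mul]

theorem hasDerivAt_integral_conj_flow_mul_second_derivative :
    HasDerivAt (fun s => ∫ x, starRingEnd ℂ (flow d s x) *
        flow (multiplier (partialSymbol i) (multiplier (partialSymbol j) c)) s x)
      (-(2 * ∫ x, starRingEnd ℂ (flow (multiplier (partialSymbol i) d) t x) *
        flow (multiplier (partialSymbol j) (multiplier laplaceSymbol c)) t x)) t := by
  refine (hasDerivAt_integral_conj_flow_mul_flow _ d t).congr_deriv ?_
  rw [multiplier_comm laplaceSymbol, multiplier_comm laplaceSymbol, integral_conj_flow_mul_partial,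
    mul_neg]

theorem tendsto_integral_conj_flow_mul_partial :
    Tendsto (fun s => ∫ x, starRingEnd ℂ (flow d s x) *
      flow (multiplier (partialSymbol i) c) s x) atTop (𝓝 0) := by
  have bound_tendsto := ((tendsto_flow d).norm.mul (tendsto_flow_partialSymbol i c).norm).mul_const
    ((volume : Measure Torus).real Set.univ)
  rw [norm_zero, mul_zero, zero_mul] at bound_tendsto
  refine squeeze_zero_norm (fun t => norm_integral_le_of_norm_le_const
    (Eventually.of_forall fun x => ?_)) bound_tendsto
  rw [norm_mul, RCLike.norm_conj]
  gcongr <;> exact ContinuousMap.norm_coe_le_norm _ _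

end Pairing

section Embedding

variable (i j : Fin 2) (c f g : Coeff) {P ε : ℝ} (hε : 0 < ε)

/-- The Bellman function evaluated along the heat flows of `f` and `g`. -/
def caloricBellman (P : ℝ) : ParabolicJet :=
  bellman (caloricJet f ε) (caloricJet g ε) (isCaloricSq_caloricJet f hε).pos
    (isCaloricSq_caloricJet g hε).pos P

theorem norm_le_sqrt_sum {ι E : Type*} [Fintype ι] [SeminormedAddCommGroup E] (w : ι → E) (i : ι) :
    ‖w i‖ ≤ Real.sqrt (∑ j, ‖w j‖ ^ 2) :=
  Real.le_sqrt_of_sq_le (Finset.single_le_sum (f := fun j => ‖w j‖ ^ 2)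
    (fun _ _ => sq_nonneg _) (Finset.mem_univ i))

theorem norm_conj_partial_mul_partial_le (hP : 2 ≤ P) (t : ℝ) (x : Torus) :
    ‖starRingEnd ℂ (flow (multiplier (partialSymbol i) g) t x) *
        flow (multiplier (partialSymbol j) f) t x‖ ≤
      (2 * bellmanConst P)⁻¹ * -(caloricBellman f g hε P).heat t x := by
  have := bellmanConst_pos (by linarith : 1 < P)
  rw [norm_mul, RCLike.norm_conj, le_inv_mul_iff₀ (by positivity), mul_comm ‖_‖]
  refine le_trans ?_ (heat_bellman_le (isCaloricSq_caloricJet f hε) (isCaloricSq_caloricJet g hε)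
    hP t x)
  gcongr
  · exact norm_le_sqrt_sum (fun j => flow (multiplier (partialSymbol j) f) t x) j
  · exact norm_le_sqrt_sum (fun i => flow (multiplier (partialSymbol i) g) t x) i

theorem norm_two_mul_integral_conj_partial_mul_partial_le (hP : 2 ≤ P) (t : ℝ) :
    ‖2 * ∫ x, starRingEnd ℂ (flow (multiplier (partialSymbol i) g) t x) *
        flow (multiplier (partialSymbol j) f) t x‖ ≤
      -((bellmanConst P)⁻¹ * ∫ x, (caloricBellman f g hε P).heat t x) := by
  have integral_le : _ ≤ ∫ x, (2 * bellmanConst P)⁻¹ * -(caloricBellman f g hε P).heat t x :=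
    norm_integral_le_of_norm_le (integrable_of_continuous
      (continuous_const.mul ((caloricBellman f g hε P).continuous_heat t).neg))
      (Eventually.of_forall (norm_conj_partial_mul_partial_le i j f g hε hP t))
  rw [integral_const_mul, integral_neg, mul_inv] at integral_le
  rw [norm_mul, Complex.norm_ofNat]
  linarith

theorem integral_caloricBellman_le (hP : 2 ≤ P) :
    ∫ x, (caloricBellman f g hε P).val 0 x ≤ 2 * ∫ x, ((‖trigPoly f x‖ ^ 2 + ε) ^ (P / 2) +
      (‖trigPoly g x‖ ^ 2 + ε) ^ (P.conjExponent / 2)) := by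
  set ha := (isCaloricSq_caloricJet f hε).pos
  set hb := (isCaloricSq_caloricJet g hε).pos
  have base_val (x : Torus) : (bellmanBase (caloricJet f ε) (caloricJet g ε) ha hb P).val 0 x =
      (‖trigPoly f x‖ ^ 2 + ε) ^ (P / 2) + (‖trigPoly g x‖ ^ 2 + ε) ^ (P.conjExponent / 2) := by
    rw [← flow_zero, ← flow_zero]
    rfl
  simp only [← integral_const_mul, ← base_val]
  exact integral_mono (integrable_of_continuous (ParabolicJet.continuous_val _ 0))
    (integrable_of_continuous (continuous_const.mul (ParabolicJet.continuous_val _ 0)))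
    (bellman_val_le ha hb hP 0)

include hε in
theorem norm_integral_conj_mul_second_derivative_le_regularized (hP : 2 ≤ P) :
    ‖∫ x, starRingEnd ℂ (trigPoly g x) *
        trigPoly (multiplier (partialSymbol i) (multiplier (partialSymbol j) c)) x‖ ≤
      2 / bellmanConst P * ∫ x, ((‖trigPoly (multiplier laplaceSymbol c) x‖ ^ 2 + ε) ^ (P / 2) +
        (‖trigPoly g x‖ ^ 2 + ε) ^ (P.conjExponent / 2)) := by
  set f := multiplier laplaceSymbol c
  have := bellmanConst_pos (by linarith : 1 < P)
  have initial_le := norm_le_of_norm_deriv_le_neg_deriv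
    (hasDerivAt_integral_conj_flow_mul_second_derivative i j c g)
    (fun t => ((caloricBellman f g hε P).hasDerivAt_integral t).const_mul (bellmanConst P)⁻¹)
    (fun t => (norm_neg _).trans_le
      (norm_two_mul_integral_conj_partial_mul_partial_le i j f g hε hP t))
    (fun t => mul_nonneg (by positivity)
      (integral_nonneg (bellman_val_nonneg _ _ hP t)))
    (tendsto_integral_conj_flow_mul_partial i _ g) 0
  simp only [flow_zero] at initial_le
  rw [div_eq_inv_mul, mul_assoc]
  exact initial_le.trans (by gcongr; exact integral_caloricBellman_le f g hε hP)

theorem norm_integral_conj_trigPoly_mul_second_derivative_le (hP : 2 ≤ P) :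
    ‖∫ x, starRingEnd ℂ (trigPoly g x) *
        trigPoly (multiplier (partialSymbol i) (multiplier (partialSymbol j) c)) x‖ ≤
      2 / bellmanConst P * ∫ x, (‖trigPoly (multiplier laplaceSymbol c) x‖ ^ P +
        ‖trigPoly g x‖ ^ P.conjExponent) := by
  have hq : 0 ≤ P.conjExponent := (Real.HolderConjugate.conjExponent (by linarith)).symm.nonneg
  let regularized (ε : ℝ) (x : Torus) : ℝ :=
    (‖trigPoly (multiplier laplaceSymbol c) x‖ ^ 2 + |ε|) ^ (P / 2) +
      (‖trigPoly g x‖ ^ 2 + |ε|) ^ (P.conjExponent / 2)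
  have continuous_regularized : Continuous (Function.uncurry regularized) :=
    (Continuous.rpow_const (by fun_prop) fun _ => Or.inr (by positivity)).add
      (Continuous.rpow_const (by fun_prop) fun _ => Or.inr (by positivity))
  have tendsto_integral : Tendsto (fun ε => ∫ x, regularized ε x) (𝓝[>] 0)
      (𝓝 (∫ x, regularized 0 x)) :=
    ((continuous_integral_of_continuous_uncurry continuous_regularized).tendsto 0).mono_left
      nhdsWithin_le_nhds
  have limit_le := ge_of_tendsto (tendsto_integral.const_mul (2 / bellmanConst P)) (by
    filter_upwards [self_mem_nhdsWithin] with ε hε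
    simp only [regularized, abs_of_pos (Set.mem_Ioi.1 hε)]
    exact norm_integral_conj_mul_second_derivative_le_regularized i j c g hε hP)
  have sq_rpow (w : ℂ) (s : ℝ) : (‖w‖ ^ 2 + |(0 : ℝ)|) ^ (s / 2) = ‖w‖ ^ s := by
    rw [abs_zero, add_zero, ← Real.rpow_natCast_mul (norm_nonneg _), Nat.cast_ofNat,
      mul_div_cancel₀ _ two_ne_zero]
  simpa only [regularized, sq_rpow] using limit_le

theorem norm_integral_conj_mul_second_derivative_le (hP : 2 ≤ P) (u : C(Torus, ℂ)) :
    ‖∫ x, starRingEnd ℂ (u x) *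
        trigPoly (multiplier (partialSymbol i) (multiplier (partialSymbol j) c)) x‖ ≤
      2 / bellmanConst P * ∫ x, (‖trigPoly (multiplier laplaceSymbol c) x‖ ^ P +
        ‖u x‖ ^ P.conjExponent) := by
  have hq : 0 ≤ P.conjExponent := (Real.HolderConjugate.conjExponent (by linarith)).symm.nonneg
  refine denseRange_trigPoly.induction_on u (isClosed_le (Continuous.norm ?_)
    (continuous_const.mul ?_)) fun g =>
      norm_integral_conj_trigPoly_mul_second_derivative_le i j c g hP
  · exact continuous_integral_of_continuous_uncurry
      (.mul (Complex.continuous_conj.comp (by fun_prop)) (by fun_prop))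
  · exact continuous_integral_of_continuous_uncurry
      (.add (.rpow_const (by fun_prop) fun _ => Or.inr (by positivity))
        (.rpow_const (by fun_prop) fun _ => Or.inr hq))

end Embedding

section Duality

variable {P q : ℝ}

theorem conj_smul_rpow_mul_self (hP : P ≠ 0) (m : ℝ) (w : ℂ) :
    starRingEnd ℂ ((m * ‖w‖ ^ (P - 2) : ℝ) * w) * w = (m * ‖w‖ ^ P : ℝ) := by
  have rpow_eq : ‖w‖ ^ P = ‖w‖ ^ (P - 2) * ‖w‖ ^ 2 := by
    rw [← Real.rpow_add_natCast' (norm_nonneg _) (by simpa using hP)]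
    simp
  rw [map_mul, Complex.conj_ofReal, mul_assoc, Complex.conj_mul', rpow_eq]
  push_cast
  ring

theorem norm_smul_rpow_mul_self_rpow (hPq : P.HolderConjugate q) {m : ℝ} (hm : 0 ≤ m) (w : ℂ) :
    ‖((m * ‖w‖ ^ (P - 2) : ℝ) : ℂ) * w‖ ^ q = m ^ q * ‖w‖ ^ P := by
  have rpow_eq : ‖w‖ ^ (P - 2) * ‖w‖ = ‖w‖ ^ (P - 1) := by
    have exponent : P - 2 + 1 = P - 1 := by ring
    rw [← Real.rpow_add_one' (norm_nonneg _) (exponent ▸ hPq.sub_one_ne_zero), exponent]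
  rw [norm_mul, Complex.norm_real, Real.norm_of_nonneg (by positivity), mul_assoc, rpow_eq,
    Real.mul_rpow hm (by positivity), ← Real.rpow_mul (norm_nonneg _), hPq.sub_one_mul_conj]

variable {α : Type*} [TopologicalSpace α] [CompactSpace α] [MeasurableSpace α]
  [OpensMeasurableSpace α] {μ : Measure α} [IsFiniteMeasure μ]

/-- Testing against `u = m |h|^(P-2) h` with `m = (2 K)^(1-P)` absorbs half of the left side. -/
theorem integral_norm_rpow_le_of_pairing_le (hPq : P.HolderConjugate q) (hP : 2 ≤ P) {h f : C(α, ℂ)}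
    {K : ℝ} (hK : 0 < K) (pairing_le : ∀ u : C(α, ℂ), ‖∫ x, starRingEnd ℂ (u x) * h x ∂μ‖ ≤
      K * ∫ x, (‖f x‖ ^ P + ‖u x‖ ^ q) ∂μ) :
    ∫ x, ‖h x‖ ^ P ∂μ ≤ (2 * K) ^ P * ∫ x, ‖f x‖ ^ P ∂μ := by
  set m : ℝ := (2 * K) ^ (1 - P)
  have hm : 0 < m := by positivity
  have m_eq : m = 2 * K * (2 * K) ^ (-P) := by
    rw [← Real.rpow_one_add' (by positivity) (by linarith), ← sub_eq_add_neg]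
  have m_rpow : K * m ^ q = m / 2 := by
    rw [← Real.rpow_mul (by positivity), ← neg_sub P 1, neg_mul, hPq.sub_one_mul_conj, m_eq]
    ring
  let u : C(α, ℂ) := ⟨fun x => (m * ‖h x‖ ^ (P - 2) : ℝ) * h x,
    (Complex.continuous_ofReal.comp (continuous_const.mul
      (h.continuous.norm.rpow_const fun _ => Or.inr (by linarith)))).mul h.continuous⟩
  have integrable_rpow (v : C(α, ℂ)) : Integrable (fun x => ‖v x‖ ^ P) μ :=
    integrable_of_continuous (v.continuous.norm.rpow_const fun _ => Or.inr (by linarith))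
  have tested := pairing_le u
  simp only [u, ContinuousMap.coe_mk, conj_smul_rpow_mul_self (by linarith : P ≠ 0),
    norm_smul_rpow_mul_self_rpow hPq hm.le] at tested
  rw [integral_complex_ofReal, Complex.norm_real, integral_const_mul,
    integral_add (integrable_rpow f) ((integrable_rpow h).const_mul _), integral_const_mul,
    Real.norm_of_nonneg (by positivity), mul_add, ← mul_assoc K (m ^ q), m_rpow] at tested
  have m_mul : (2 * K) ^ P * m = 2 * K := by
    rw [← Real.rpow_add (by positivity), add_sub_cancel, Real.rpow_one]
  refine le_of_mul_le_mul_right ?_ hm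
  rw [mul_right_comm, m_mul]
  linarith

end Duality

theorem norm_second_derivative_trigLp_le {p : ℝ≥0∞} [Fact (1 ≤ p)] (hp2 : 2 ≤ p) (hp : p ≠ ⊤)
    (i j : Fin 2) (c : Coeff) :
    ‖trigLp p (multiplier (partialSymbol i) (multiplier (partialSymbol j) c))‖ ≤
      4 / bellmanConst p.toReal * ‖trigLp p (multiplier laplaceSymbol c)‖ := by
  have hP : 2 ≤ p.toReal := by simpa using ENNReal.toReal_mono hp hp2
  have hP1 : 1 < p.toReal := by linarith
  have := bellmanConst_pos hP1
  have rpow_le := integral_norm_rpow_le_of_pairing_le (.conjExponent hP1) hP (by positivity)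
    (norm_integral_conj_mul_second_derivative_le i j c hP)
  rw [← norm_trigLp_rpow hp, ← norm_trigLp_rpow hp, ← Real.mul_rpow (by positivity)
    (norm_nonneg _), Real.rpow_le_rpow_iff (norm_nonneg _) (by positivity) (by linarith)] at rpow_le
  convert rpow_le using 2
  ring

end Riesz

/-! ### First derivatives of trigonometric polynomials -/

section Translation

-- By Taylor's formula `f 1 - f 0 - f' 0` is at most the bound on the second derivative.
theorem norm_deriv_zero_le_of_norm_deriv_deriv_le {E : Type*} [NormedAddCommGroup E]
    [NormedSpace ℝ E] {f f' f'' : ℝ → E} {M : ℝ}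
    (hf : ∀ t ∈ Set.Icc (0 : ℝ) 1, HasDerivWithinAt f (f' t) (Set.Icc 0 1) t)
    (hf' : ∀ t ∈ Set.Icc (0 : ℝ) 1, HasDerivWithinAt f' (f'' t) (Set.Icc 0 1) t)
    (hM : ∀ t ∈ Set.Icc (0 : ℝ) 1, ‖f'' t‖ ≤ M) : ‖f' 0‖ ≤ ‖f 0‖ + ‖f 1‖ + M := by
  have hM0 : 0 ≤ M := (norm_nonneg _).trans (hM 0 (by simp))
  have slope_variation : ∀ t ∈ Set.Ico (0 : ℝ) 1, ‖f' t - (1 : ℝ) • f' 0‖ ≤ M := fun t ht => by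
    have := norm_image_sub_le_of_norm_deriv_le_segment' hf'
      (fun s hs => hM s (Set.Ico_subset_Icc_self hs)) t (Set.Ico_subset_Icc_self ht)
    rw [one_smul]
    exact this.trans (mul_le_of_le_one_right hM0 (by linarith [ht.2]))
  have remainder := norm_image_sub_le_of_norm_deriv_le_segment_01'
    (fun t ht => (hf t ht).sub ((hasDerivWithinAt_id t _).smul_const (f' 0))) slope_variation
  simp only [Pi.sub_apply, id_eq, one_smul, zero_smul, sub_zero] at remainder
  calc ‖f' 0‖ = ‖f 1 - f 0 - (f 1 - f' 0 - f 0)‖ := by congr 1; abel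
    _ ≤ ‖f 1 - f 0‖ + ‖f 1 - f' 0 - f 0‖ := norm_sub_le _ _
    _ ≤ ‖f 0‖ + ‖f 1‖ + M := by
      gcongr
      rw [add_comm]
      exact norm_sub_le _ _

/-- The translation by `s` in the `i`-th direction, acting on Fourier coefficients. -/
def translate (i : Fin 2) (s : ℝ) : Coeff →ₗ[ℂ] Coeff :=
  multiplier fun k => Complex.exp (Complex.I * k i * s)

theorem translate_zero (i : Fin 2) (c : Coeff) : translate i 0 c = c := by
  simp [translate, multiplier_const]

theorem trigPoly_translate (i : Fin 2) (s : ℝ) (c : Coeff) (x : Torus) :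
    trigPoly (translate i s c) x = trigPoly c (shift i x s) := by
  induction c using Finsupp.induction_linear with
  | zero => simp
  | add f g hf hg => simp only [map_add, ContinuousMap.add_apply, hf, hg]
  | single k c =>
    simp only [translate, multiplier_single, trigPoly_single, ContinuousMap.coe_smul, Pi.smul_apply,
      smul_eq_mul, character_shift]
    ring

variable {p : ℝ≥0∞} [Fact (1 ≤ p)]

theorem norm_trigLp_translate (hp : p ≠ ⊤) (i : Fin 2) (s : ℝ) (c : Coeff) :
    ‖trigLp p (translate i s c)‖ = ‖trigLp p c‖ := by
  have hp0 : 0 < p.toReal := ENNReal.toReal_pos (zero_lt_one.trans_le Fact.out).ne' hp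
  refine (Real.rpow_left_inj (norm_nonneg _) (norm_nonneg _) hp0.ne').1 ?_
  simp only [norm_trigLp_rpow hp, trigPoly_translate]
  exact integral_add_right_eq_self (fun x => ‖trigPoly c x‖ ^ p.toReal) _

theorem hasDerivAt_trigLp_translate (i : Fin 2) (c : Coeff) (s : ℝ) :
    HasDerivAt (fun s : ℝ => trigLp p (translate i s c))
      (trigLp p (translate i s (multiplier (partialSymbol i) c))) s := by
  induction c using Finsupp.induction_linear with
  | zero => simpa using hasDerivAt_const s (0 : LpT p)
  | add f g hf hg =>
    simp only [map_add]
    exact hf.add hg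
  | single k c =>
    have trigLp_single (a : ℂ) :
        trigLp p (Finsupp.single k a) = a • trigLp p (Finsupp.single k 1) := by
      rw [← map_smul, Finsupp.smul_single_one]
    have exp_deriv : HasDerivAt (fun s : ℝ => Complex.exp (Complex.I * k i * s))
        (Complex.exp (Complex.I * k i * s) * (Complex.I * k i)) s := by
      simpa using ((Complex.ofRealCLM.hasDerivAt (x := s)).const_mul (Complex.I * k i)).cexp
    simp only [translate, multiplier_single]
    simp only [trigLp_single (_ * _), partialSymbol, ← mul_assoc]
    exact (exp_deriv.mul_const c).smul_const _ |>.congr_deriv (by simp only [mul_assoc])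

theorem norm_first_derivative_trigLp_le (hp : p ≠ ⊤) (i : Fin 2) (c : Coeff) :
    ‖trigLp p (multiplier (partialSymbol i) c)‖ ≤ 2 * ‖trigLp p c‖ +
      ‖trigLp p (multiplier (partialSymbol i) (multiplier (partialSymbol i) c))‖ := by
  have landau := norm_deriv_zero_le_of_norm_deriv_deriv_le
    (fun t _ => (hasDerivAt_trigLp_translate (p := p) i c t).hasDerivWithinAt)
    (fun t _ => (hasDerivAt_trigLp_translate i _ t).hasDerivWithinAt)
    (fun t _ => (norm_trigLp_translate hp i t _).le)
  simp only [translate_zero, norm_trigLp_translate hp] at landau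
  linarith

end Translation

/-! ### Solving `z u - Δ u = f` in `W^{2,p}` -/

section Solve

section Uniqueness

theorem character_cover (k : Fin 2 → ℤ) (v : Fin 2 → ℝ) :
    character k (cover v) = ∏ j, Complex.exp (Complex.I * k j * v j) := by
  rw [character_apply]
  refine Finset.prod_congr rfl fun j _ => ?_
  have hpi : (Real.pi : ℂ) ≠ 0 := by exact_mod_cast Real.pi_ne_zero
  rw [cover, fourier_coe_apply]
  congr 1
  push_cast
  field_simp

theorem isSmooth_character (k : Fin 2 → ℤ) : IsSmooth (E := ℂ) (character k) := by
  simp only [IsSmooth, character_cover]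
  exact contDiff_prod fun j _ =>
    (contDiff_const.mul (Complex.ofRealCLM.contDiff.comp (contDiff_apply ℝ ℝ j))).cexp

theorem partialDeriv_character (i : Fin 2) (k : Fin 2 → ℤ) (x : Torus) :
    partialDeriv i (character k) x = partialSymbol i k * character k x := by
  simpa [partialDeriv, shift] using (hasPartial_trigPoly i (Finsupp.single k 1) x).deriv

theorem IsWeakPartial.integral_character {p : ℝ≥0∞} {i : Fin 2} {f g : LpT p}
    (h : IsWeakPartial i f g) (k : Fin 2 → ℤ) :
    ∫ x, g x * character k x = -(partialSymbol i k * ∫ x, f x * character k x) := by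
  rw [← integral_const_mul, ← neg_eq_iff_eq_neg, ← h _ (isSmooth_character k)]
  simp only [partialDeriv_character, mul_left_comm]

theorem continuous_integral_mul_continuousMap {α : Type*} [TopologicalSpace α] [CompactSpace α]
    [MeasurableSpace α] [OpensMeasurableSpace α] {μ : Measure α} {w : α → ℂ}
    (hw : Integrable w μ) : Continuous fun φ : C(α, ℂ) => ∫ x, w x * φ x ∂μ := by
  have integrable (φ : C(α, ℂ)) : Integrable (fun x => w x * φ x) μ :=
    hw.mul_bdd (c := ‖φ‖) φ.continuous.aestronglyMeasurable (.of_forall φ.norm_coe_le_norm)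
  refine LipschitzWith.continuous (K := Real.toNNReal (∫ x, ‖w x‖ ∂μ))
    (LipschitzWith.of_dist_le_mul fun φ ψ => ?_)
  rw [dist_eq_norm, dist_eq_norm, Real.coe_toNNReal _ (integral_nonneg fun _ => norm_nonneg _),
    ← integral_sub (integrable φ) (integrable ψ), ← integral_mul_const]
  refine norm_integral_le_of_norm_le (hw.norm.mul_const _) (.of_forall fun x => ?_)
  rw [← mul_sub, norm_mul]
  gcongr
  exact (φ - ψ).norm_coe_le_norm x

variable {p : ℝ≥0∞} [Fact (1 ≤ p)]

theorem eq_zero_of_integral_character {w : LpT p} (h : ∀ k, ∫ x, w x * character k x = 0) :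
    w = 0 := by
  have hw := integrable_LpT w
  have orthogonal_trigPoly (c : Coeff) : ∫ x, w x * trigPoly c x = 0 := by
    induction c using Finsupp.induction_linear with
    | zero => simp
    | add f g hf hg =>
      simp only [map_add, ContinuousMap.add_apply, mul_add]
      rw [integral_add (integrable_mul hw (trigPoly f).continuous)
        (integrable_mul hw (trigPoly g).continuous), hf, hg, add_zero]
    | single k c =>
      simp only [trigPoly_single, ContinuousMap.coe_smul, Pi.smul_apply, smul_eq_mul,
        mul_left_comm _ c]
      rw [integral_const_mul, h, mul_zero]
  have orthogonal (φ : C(Torus, ℂ)) : ∫ x, w x * φ x = 0 :=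
    denseRange_trigPoly.induction_on (p := fun φ : C(Torus, ℂ) => ∫ x, w x * φ x = 0) φ
      (isClosed_eq (continuous_integral_mul_continuousMap hw) continuous_const) orthogonal_trigPoly
  exact Lp.eq_zero_iff_ae_eq_zero.2
    (ae_zero_of_forall_smooth hw fun φ hφ => orthogonal ⟨φ, hφ.continuous⟩)

theorem integral_secondDeriv_mul_character (i : Fin 2) (u : W2 p) (k : Fin 2 → ℤ) :
    ∫ x, secondDeriv p i i u x * character k x =
      partialSymbol i k * partialSymbol i k * ∫ x, (u : LpT p) x * character k x := by
  obtain ⟨G, hG, hH⟩ := hessian_spec u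
  have twice := (hH i i).integral_character k
  rw [(hG i).integral_character k] at twice
  exact twice.trans (by ring)

theorem integral_laplacian_mul_character (u : W2 p) (k : Fin 2 → ℤ) :
    ∫ x, (∑ i, secondDeriv p i i u : LpT p) x * character k x =
      laplaceSymbol k * ∫ x, (u : LpT p) x * character k x := by
  rw [laplaceSymbol, Finset.sum_mul]
  simp only [← integral_secondDeriv_mul_character]
  rw [← integral_finsetSum _ fun i _ =>
    integrable_mul (integrable_LpT _) (character k).continuous]
  refine integral_congr_ae ?_
  filter_upwards [Lp.coeFn_finsetSum Finset.univ fun i => secondDeriv p i i u] with x hx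
  rw [hx, Finset.sum_apply, Finset.sum_mul]

theorem sub_laplaceSymbol_ne_zero {z : ℂ} (hz : 0 < z.re) (k : Fin 2 → ℤ) :
    z - laplaceSymbol k ≠ 0 := fun h => by
  have re_eq : z.re + freqSq k = 0 := by simpa [laplaceSymbol_eq] using congrArg Complex.re h
  have : 0 ≤ freqSq k := Finset.sum_nonneg fun _ _ => sq_nonneg _
  linarith

theorem eq_zero_of_smul_sub_laplacian_eq_zero {u : W2 p} {z : ℂ} (hz : 0 < z.re)
    (h : z • (u : LpT p) - ∑ i, secondDeriv p i i u = 0) : u = 0 := by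
  refine Subtype.ext (eq_zero_of_integral_character fun k => ?_)
  have eigen := integral_laplacian_mul_character u k
  have integral_smul : ∫ x, (z • (u : LpT p) : LpT p) x * character k x =
      z * ∫ x, (u : LpT p) x * character k x := by
    rw [← integral_const_mul]
    refine integral_congr_ae ?_
    filter_upwards [Lp.coeFn_smul z (u : LpT p)] with x hx
    rw [hx, Pi.smul_apply, smul_eq_mul, mul_assoc]
  rw [← sub_eq_zero.1 h, integral_smul, ← sub_eq_zero, ← sub_mul] at eigen
  exact (mul_eq_zero.1 eigen).resolve_left (sub_laplaceSymbol_ne_zero hz k)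

end Uniqueness

section Resolvent

/-- The symbol `(z + |k|²)⁻¹` of the resolvent of the Laplacian. -/
def resolventSymbol (z : ℂ) (k : Fin 2 → ℤ) : ℂ := (z - laplaceSymbol k)⁻¹

theorem smul_sub_multiplier_resolventSymbol {z : ℂ} (hz : 0 < z.re) (c : Coeff) :
    z • multiplier (resolventSymbol z) c -
      multiplier laplaceSymbol (multiplier (resolventSymbol z) c) = c := by
  ext k
  simp only [Finsupp.sub_apply, Finsupp.smul_apply, smul_eq_mul, multiplier_apply, ← sub_mul]
  rw [resolventSymbol, mul_inv_cancel_left₀ (sub_laplaceSymbol_ne_zero hz k)]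

variable {p : ℝ≥0∞} [Fact (1 ≤ p)] (hp2 : 2 ≤ p) (hp : p ≠ ⊤) {z : ℂ} (hz : 0 < z.re)

include hp2 hp hz

theorem norm_trigLp_resolventSymbol_le (c : Coeff) :
    ‖trigLp p (multiplier (resolventSymbol z) c)‖ ≤ resolventConst p / ‖z‖ * ‖trigLp p c‖ := by
  have hz0 : 0 < ‖z‖ := norm_pos_iff.2 fun h => by simp [h] at hz
  have := resolvent_estimate_trigLp hp2 hp hz.le (multiplier (resolventSymbol z) c)
  rwa [smul_sub_multiplier_resolventSymbol hz, ← le_div_iff₀' hz0, mul_div_right_comm] at this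

theorem norm_trigLp_laplaceSymbol_resolventSymbol_le (c : Coeff) :
    ‖trigLp p (multiplier laplaceSymbol (multiplier (resolventSymbol z) c))‖ ≤
      (resolventConst p + 1) * ‖trigLp p c‖ := by
  have laplacian_eq : multiplier laplaceSymbol (multiplier (resolventSymbol z) c) =
      z • multiplier (resolventSymbol z) c - c := by
    nth_rewrite 3 [← smul_sub_multiplier_resolventSymbol hz c]
    abel
  have zeroth_order := resolvent_estimate_trigLp hp2 hp hz.le (multiplier (resolventSymbol z) c)
  rw [smul_sub_multiplier_resolventSymbol hz] at zeroth_order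
  rw [laplacian_eq, map_sub, map_smul]
  refine (norm_sub_le _ _).trans ?_
  rw [norm_smul, add_one_mul]
  gcongr

theorem exists_norm_second_derivative_resolventSymbol_le (i j : Fin 2) :
    ∃ C, ∀ c, ‖trigLp p (multiplier (partialSymbol i) (multiplier (partialSymbol j)
      (multiplier (resolventSymbol z) c)))‖ ≤ C * ‖trigLp p c‖ := by
  have hP : 1 < p.toReal := by
    have : 2 ≤ p.toReal := by simpa using ENNReal.toReal_mono hp hp2
    linarith
  have := bellmanConst_pos hP
  refine ⟨4 / bellmanConst p.toReal * (resolventConst p + 1), fun c => ?_⟩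
  refine (norm_second_derivative_trigLp_le hp2 hp i j _).trans ?_
  rw [mul_assoc]
  gcongr
  exact norm_trigLp_laplaceSymbol_resolventSymbol_le hp2 hp hz c

theorem exists_norm_first_derivative_resolventSymbol_le (i : Fin 2) :
    ∃ C, ∀ c, ‖trigLp p (multiplier (partialSymbol i) (multiplier (resolventSymbol z) c))‖ ≤
      C * ‖trigLp p c‖ := by
  obtain ⟨C, hC⟩ := exists_norm_second_derivative_resolventSymbol_le hp2 hp hz i i
  refine ⟨2 * (resolventConst p / ‖z‖) + C, fun c => ?_⟩
  refine (norm_first_derivative_trigLp_le hp i _).trans ?_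
  linarith [norm_trigLp_resolventSymbol_le hp2 hp hz c, hC c]

end Resolvent

section Limit

variable {p : ℝ≥0∞} [Fact (1 ≤ p)]

theorem IsWeakPartial.of_tendsto {ι : Type*} {l : Filter ι} [l.NeBot] {i : Fin 2}
    {f g : ι → LpT p} {f' g' : LpT p} (h : ∀ n, IsWeakPartial i (f n) (g n))
    (hf : Tendsto f l (𝓝 f')) (hg : Tendsto g l (𝓝 g')) : IsWeakPartial i f' g' := by
  intro φ hφ
  have left := ((continuous_integral_mul (hφ.continuous_partialDeriv i)).tendsto f').comp hf
  have right := (((continuous_integral_mul hφ.continuous).tendsto g').comp hg).neg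
  exact tendsto_nhds_unique left (right.congr fun n => (h n φ hφ).symm)

theorem exists_tendsto_of_norm_le {𝕜 V E F : Type*} [Semiring 𝕜] [AddCommGroup V] [Module 𝕜 V]
    [SeminormedAddCommGroup E] [Module 𝕜 E] [SeminormedAddCommGroup F] [Module 𝕜 F]
    [CompleteSpace F] {S : V →ₗ[𝕜] E} {T : V →ₗ[𝕜] F} {C : ℝ} (hT : ∀ v, ‖T v‖ ≤ C * ‖S v‖)
    {v : ℕ → V} (hv : CauchySeq fun n => S (v n)) :
    ∃ y, Tendsto (fun n => T (v n)) atTop (𝓝 y) := by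
  refine cauchySeq_tendsto_of_complete ?_
  rw [cauchySeq_iff_tendsto_dist_atTop_0] at hv ⊢
  refine squeeze_zero (fun _ => dist_nonneg) (fun n => ?_) (by simpa using hv.const_mul C)
  rw [dist_eq_norm, dist_eq_norm, ← map_sub, ← map_sub]
  exact hT _

/-- The trigonometric polynomials with coefficients `d n` converge to `u` in `W^{2,p}`; first
derivatives are left out, as they are never needed. -/
structure IsTrigLimit (d : ℕ → Coeff) (u : W2 p) : Prop where
  tendsto : Tendsto (fun n => trigLp p (d n)) atTop (𝓝 (u : LpT p))
  tendsto_secondDeriv : ∀ i j, Tendsto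
    (fun n => trigLp p (multiplier (partialSymbol j) (multiplier (partialSymbol i) (d n)))) atTop
      (𝓝 (secondDeriv p i j u))

theorem IsTrigLimit.tendsto_laplacian {d : ℕ → Coeff} {u : W2 p} (h : IsTrigLimit d u) :
    Tendsto (fun n => trigLp p (multiplier laplaceSymbol (d n))) atTop
      (𝓝 (∑ i, secondDeriv p i i u)) := by
  simp only [multiplier_laplaceSymbol, map_sum]
  exact tendsto_finsetSum _ fun i _ => h.tendsto_secondDeriv i i

theorem IsTrigLimit.tendsto_resolvent {d : ℕ → Coeff} {u : W2 p} (h : IsTrigLimit d u) (z : ℂ) :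
    Tendsto (fun n => trigLp p (z • d n - multiplier laplaceSymbol (d n))) atTop
      (𝓝 (z • (u : LpT p) - ∑ i, secondDeriv p i i u)) := by
  simp only [map_sub, map_smul]
  exact (h.tendsto.const_smul z).sub h.tendsto_laplacian

theorem exists_isTrigLimit_of_tendsto {d : ℕ → Coeff} {u : LpT p} {G : Fin 2 → LpT p}
    {H : Fin 2 → Fin 2 → LpT p} (hu : Tendsto (fun n => trigLp p (d n)) atTop (𝓝 u))
    (hG : ∀ i, Tendsto (fun n => trigLp p (multiplier (partialSymbol i) (d n))) atTop (𝓝 (G i)))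
    (hH : ∀ i j, Tendsto
      (fun n => trigLp p (multiplier (partialSymbol j) (multiplier (partialSymbol i) (d n)))) atTop
      (𝓝 (H i j))) : ∃ v : W2 p, IsTrigLimit d v := by
  have weakDerivs : HasWeakDerivs u G H :=
    ⟨fun i => .of_tendsto (fun n => isWeakPartial_trigLp i _) hu (hG i),
      fun i j => .of_tendsto (fun n => isWeakPartial_trigLp j _) (hG i) (hH i j)⟩
  let v : W2 p := ⟨u, G, H, weakDerivs⟩
  have secondDeriv_eq (i j : Fin 2) : secondDeriv p i j v = H i j :=
    congrFun₂ (hessian_eq (f := v) weakDerivs) i j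
  exact ⟨v, hu, fun i j => (secondDeriv_eq i j).symm ▸ hH i j⟩

theorem exists_isTrigLimit_solution (hp2 : 2 ≤ p) (hp : p ≠ ⊤) {z : ℂ} (hz : 0 < z.re)
    (f : LpT p) : ∃ (d : ℕ → Coeff) (u : W2 p), IsTrigLimit d u ∧
      z • (u : LpT p) - ∑ i, secondDeriv p i i u = f := by
  obtain ⟨y, hy, y_tendsto⟩ := mem_closure_iff_seq_limit.1 (denseRange_trigLp hp f)
  choose c hc using hy
  obtain rfl : (fun n => trigLp p (c n)) = y := funext hc
  obtain ⟨u, hu⟩ := exists_tendsto_of_norm_le (T := trigLp p ∘ₗ multiplier (resolventSymbol z))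
    (norm_trigLp_resolventSymbol_le hp2 hp hz) y_tendsto.cauchySeq
  choose C₁ hC₁ using exists_norm_first_derivative_resolventSymbol_le hp2 hp hz
  choose G hG using fun i => exists_tendsto_of_norm_le
    (T := trigLp p ∘ₗ multiplier (partialSymbol i) ∘ₗ multiplier (resolventSymbol z))
    (hC₁ i) y_tendsto.cauchySeq
  choose C₂ hC₂ using exists_norm_second_derivative_resolventSymbol_le hp2 hp hz
  choose H hH using fun i j => exists_tendsto_of_norm_le
    (T := trigLp p ∘ₗ multiplier (partialSymbol j) ∘ₗ multiplier (partialSymbol i) ∘ₗ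
      multiplier (resolventSymbol z)) (hC₂ j i) y_tendsto.cauchySeq
  obtain ⟨v, hv⟩ := exists_isTrigLimit_of_tendsto hu hG hH
  refine ⟨_, v, hv, tendsto_nhds_unique (hv.tendsto_resolvent z) ?_⟩
  simpa only [smul_sub_multiplier_resolventSymbol hz] using y_tendsto

theorem exists_isTrigLimit (hp2 : 2 ≤ p) (hp : p ≠ ⊤) (u : W2 p) :
    ∃ d : ℕ → Coeff, IsTrigLimit d u := by
  have one_pos : 0 < (1 : ℂ).re := by simp
  obtain ⟨d, v, hd, hv⟩ := exists_isTrigLimit_solution hp2 hp one_pos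
    ((1 : ℂ) • (u : LpT p) - ∑ i, secondDeriv p i i u)
  have v_sub_u : v - u = 0 := by
    refine eq_zero_of_smul_sub_laplacian_eq_zero one_pos ?_
    simp only [map_sub, Finset.sum_sub_distrib, Submodule.coe_sub, smul_sub]
    rw [← sub_eq_zero.2 hv]
    abel
  exact ⟨d, sub_eq_zero.1 v_sub_u ▸ hd⟩

theorem resolvent_estimate (hp2 : 2 ≤ p) (hp : p ≠ ⊤) {z : ℂ} (hz : 0 ≤ z.re) (u : W2 p) :
    ‖z‖ * ‖(u : LpT p)‖ ≤ resolventConst p * ‖z • (u : LpT p) - ∑ i, secondDeriv p i i u‖ := by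
  obtain ⟨d, hd⟩ := exists_isTrigLimit hp2 hp u
  exact le_of_tendsto_of_tendsto' (hd.tendsto.norm.const_mul _)
    ((hd.tendsto_resolvent z).norm.const_mul _) fun n => resolvent_estimate_trigLp hp2 hp hz (d n)

theorem norm_secondDeriv_le (hp2 : 2 ≤ p) (hp : p ≠ ⊤) (i j : Fin 2) (u : W2 p) :
    ‖secondDeriv p i j u‖ ≤
      4 / bellmanConst p.toReal * ‖(∑ i, secondDeriv p i i u : LpT p)‖ := by
  obtain ⟨d, hd⟩ := exists_isTrigLimit hp2 hp u
  exact le_of_tendsto_of_tendsto' (hd.tendsto_secondDeriv i j).norm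
    (hd.tendsto_laplacian.norm.const_mul _)
    fun n => norm_second_derivative_trigLp_le hp2 hp j i (d n)

end Limit

end Solve

/-! ### The operators on `L^p` -/

section Operators

variable {p : ℝ≥0∞} [Fact (1 ≤ p)]

theorem laplaceOp_apply (ν : ℝ) (u : W2 p) :
    laplaceOp ν p u = (ν : ℂ) • ∑ i, secondDeriv p i i u := by
  change ((ν : ℂ) • ∑ i, secondDeriv p i i) u = _
  rw [LinearMap.smul_apply, LinearMap.sum_apply]

theorem dense_W2 (hp : p ≠ ⊤) : Dense (W2 p : Set (LpT p)) := by
  refine (denseRange_trigLp hp).mono ?_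
  rintro _ ⟨c, rfl⟩
  exact ⟨_, _, fun i => isWeakPartial_trigLp i c, fun i j => isWeakPartial_trigLp j _⟩

theorem resolventBound_laplaceOp (hp2 : 2 ≤ p) (hp : p ≠ ⊤) {ν : ℝ} (hν : 0 < ν) :
    ResolventBound (laplaceOp ν p) (resolventConst p) := by
  intro z hz
  have hν' : (ν : ℂ) ≠ 0 := by exact_mod_cast hν.ne'
  have re_pos : 0 < (z / ν).re := by
    rw [Complex.div_ofReal_re]
    positivity
  have rescaled (u : W2 p) : z • (u : LpT p) - laplaceOp ν p u =
      (ν : ℂ) • ((z / ν) • (u : LpT p) - ∑ i, secondDeriv p i i u) := by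
    rw [laplaceOp_apply, smul_sub, smul_smul, mul_div_cancel₀ _ hν']
  constructor
  · intro u
    have estimate := resolvent_estimate hp2 hp re_pos.le u
    rw [norm_div, Complex.norm_real, Real.norm_of_nonneg hν.le, div_mul_eq_mul_div,
      div_le_iff₀ hν] at estimate
    rw [rescaled u, norm_smul, Complex.norm_real, Real.norm_of_nonneg hν.le]
    linarith
  · intro y
    obtain ⟨_, u, _, hu⟩ := exists_isTrigLimit_solution hp2 hp re_pos ((ν : ℂ)⁻¹ • y)
    exact ⟨u, by rw [rescaled u, hu, smul_inv_smul₀ hν']⟩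

theorem generates_laplaceOp_add (hp2 : 2 ≤ p) (hp : p ≠ ⊤) {ν : ℝ} (hν : 0 < ν)
    (B : LpT p →ₗ.[ℂ] LpT p) (hB : W2 p ≤ B.domain) {a : ℝ} (ha : 0 ≤ a) (haδ : a ≤ threshold p)
    (hBa : ∀ f : W2 p, ‖B ⟨f, hB f.2⟩‖ ≤ a * ‖laplaceOp ν p f‖) :
    GeneratesBoundedAnalyticSemigroup (laplaceOp ν p + B) := by
  have resolventConst_nonneg : 0 ≤ resolventConst p := Real.sqrt_nonneg _
  have small : a * (1 + resolventConst p) ≤ 1 / 2 :=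
    calc a * (1 + resolventConst p) ≤ threshold p * (1 + resolventConst p) := by gcongr
      _ = 1 / 2 := by rw [threshold]; field_simp
  have domain_add : (laplaceOp ν p + B).domain = W2 p := inf_eq_left.2 hB
  refine ((resolventBound_laplaceOp hp2 hp hν).add resolventConst_nonneg hB ha small hBa).generates
    (by positivity) ?_
  rw [domain_add]
  exact dense_W2 hp

theorem exists_hessianBound (hp2 : 2 ≤ p) (hp : p ≠ ⊤) {ν : ℝ} (hν : 0 < ν) :
    ∃ K : ℝ, 0 < K ∧ HessianBound ν p K := by
  have hP : 1 < p.toReal := by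
    have : 2 ≤ p.toReal := by simpa using ENNReal.toReal_mono hp hp2
    linarith
  have := bellmanConst_pos hP
  refine ⟨16 / (bellmanConst p.toReal * ν), by positivity, fun f i j => ?_⟩
  refine (norm_secondDeriv_le hp2 hp i j f).trans_eq ?_
  rw [laplaceOp_apply, norm_smul, Complex.norm_real, Real.norm_of_nonneg hν.le]
  field_simp
  ring

theorem norm_mulOp_le {p : ℝ≥0∞} (a : C(Torus, ℝ)) (f : LpT p) : ‖mulOp p a f‖ ≤ ‖a‖ * ‖f‖ := by
  have coeFn_mulOp : mulOp p a f =ᵐ[volume] fun x => (a x : ℂ) * f x := by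
    rw [mulOp, LinearMap.coe_mk, AddHom.coe_mk]
    exact MemLp.coeFn_toLp _
  refine Lp.norm_le_mul_norm_of_ae_le_mul ?_
  filter_upwards [coeFn_mulOp] with x hx
  rw [hx, norm_mul, Complex.norm_real]
  gcongr
  exact a.norm_coe_le_norm x

namespace NoiseFamily

variable (S : NoiseFamily)

theorem norm_covariance_le_size (i j : Fin 2) : ‖S.covariance i j‖ ≤ S.size :=
  (le_ciSup (f := fun j => ‖S.covariance i j‖) (Set.finite_range _).bddAbove j).trans
    (le_ciSup (f := fun i => ⨆ j, ‖S.covariance i j‖) (Set.finite_range _).bddAbove i)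

theorem size_nonneg : 0 ≤ S.size := (norm_nonneg _).trans (S.norm_covariance_le_size 0 0)

theorem noiseOp_apply (u : W2 p) :
    S.noiseOp p u = (1 / 2 : ℂ) • ∑ i, ∑ j, mulOp p (S.covariance i j) (secondDeriv p i j u) := by
  change ((1 / 2 : ℂ) • ∑ i, ∑ j, mulOp p (S.covariance i j) ∘ₗ secondDeriv p i j) u = _
  simp only [LinearMap.smul_apply, LinearMap.sum_apply, LinearMap.comp_apply]

theorem norm_noiseOp_le {ν K : ℝ} (hK : HessianBound ν p K) (u : W2 p) :
    ‖S.noiseOp p u‖ ≤ K * S.size * ‖laplaceOp ν p u‖ := by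
  have := S.size_nonneg
  have term_le (i j : Fin 2) : ‖mulOp p (S.covariance i j) (secondDeriv p i j u)‖ ≤
      S.size * (K / 4 * ‖laplaceOp ν p u‖) :=
    (norm_mulOp_le _ _).trans <| by
      gcongr
      exacts [S.norm_covariance_le_size i j, hK u i j]
  rw [S.noiseOp_apply, norm_smul]
  calc ‖(1 / 2 : ℂ)‖ * ‖∑ i, ∑ j, mulOp p (S.covariance i j) (secondDeriv p i j u)‖
      ≤ 1 * ∑ _i : Fin 2, ∑ _j : Fin 2, S.size * (K / 4 * ‖laplaceOp ν p u‖) := by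
        gcongr
        · norm_num
        · exact norm_sum_le_of_le _ fun i _ => norm_sum_le_of_le _ fun j _ => term_le i j
    _ = K * S.size * ‖laplaceOp ν p u‖ := by
        simp only [Fin.sum_univ_two]
        ring

end NoiseFamily

end Operators

end

end TorusSemigroup

theorem mainTheorem9 (ν : ℝ) (hν : 0 < ν) (p : ENNReal) [Fact (1 ≤ p)] (hp2 : 2 ≤ p)
    (hp : p ≠ ⊤) :
    -- the `L^p` resolvent bound for the Laplacian
    (∀ (z : ℂ), 0 ≤ z.re → ∀ u : W2 p,
      ‖z‖ * ‖(u : LpT p)‖ ≤ resolventConst p * ‖z • (u : LpT p) - laplaceOp 1 p u‖) ∧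
    -- the explicit threshold for relatively bounded perturbations of `νΔ`
    (∀ (B : LpT p →ₗ.[ℂ] LpT p) (hB : W2 p ≤ B.domain) (a : ℝ), 0 ≤ a → a ≤ threshold p →
      (∀ f : W2 p, ‖B ⟨f, hB f.2⟩‖ ≤ a * ‖laplaceOp ν p f‖) →
      GeneratesBoundedAnalyticSemigroup (laplaceOp ν p + B)) ∧
    -- the second derivatives are bounded relatively to `νΔ`, with a constant `K = K(ν, p)`
    (∃ K : ℝ, 0 < K ∧ HessianBound ν p K) ∧
    -- for small noise, `A` is a small perturbation of `νΔ` and generates an analytic semigroup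
    (∀ K : ℝ, 0 < K → HessianBound ν p K → ∀ S : NoiseFamily, S.size < threshold p / K →
      (K * S.size < threshold p ∧
        ∀ f : W2 p, ‖S.noiseOp p f‖ ≤ K * S.size * ‖laplaceOp ν p f‖) ∧
      GeneratesBoundedAnalyticSemigroup (laplaceOp ν p + S.noiseOp p)) := by
  refine ⟨fun z hz u => ?_, fun B hB a ha haδ h => generates_laplaceOp_add hp2 hp hν B hB ha haδ h,
    exists_hessianBound hp2 hp hν, fun K hK hH S hS => ?_⟩
  · rw [laplaceOp_apply, Complex.ofReal_one, one_smul]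
    exact resolvent_estimate hp2 hp hz u
  · have small : K * S.size < threshold p := by
      rw [lt_div_iff₀ hK] at hS
      linarith
    have relatively_bounded := fun f => S.norm_noiseOp_le hH f
    exact ⟨⟨small, relatively_bounded⟩, generates_laplaceOp_add hp2 hp hν (S.noiseOp p) le_rfl
      (mul_nonneg hK.le S.size_nonneg) small.le relatively_bounded⟩
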